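/- Let $\mathbb{R}^{2,1}$ be $\mathbb{R}^3$ with the inner product $B(x,y)=x_1y_1+x_2y_2-x_3y_3$ and its standard orientation. Let $\mathbb{S}^3$ be the sphere of rays in $\mathbb{R}^4$ with its standard metric $\mathbf{d}$, write $(\!(v)\!)$ for the ray through $v\neq 0$, and embed $\mathbb{R}^{2,1}$ in $\mathbb{S}^3$ by $x\mapsto(\!(1,x_1,x_2,x_3)\!)$; affine automorphisms of $\mathbb{R}^{2,1}$ extend to projective automorphisms of $\mathbb{S}^3$. Let $\mathbb{S}_+$ be the set of the $(\!(0,c)\!)$ with $B(c,c)<0$, $c_3>0$, and $\partial\mathbb{S}_+$ the set of the $(\!(0,c)\!)$ with $B(c,c)=0$, $c_3>0$. For $p=(\!(0,c_1,c_2,c_3)\!)\in\partial\mathbb{S}_+$, the accordant great segment is $$\zeta_p=\{(\!(s(0,c_1,c_2,c_3)+t(0,-c_2,c_1,0))\!) : s\in\mathbb{R},\ t>0\},$$ the open great semicircle from $p$ to its antipode, tangent to $\partial\mathbb{S}_+$ at $p$ and leaving $p$ in the direction of the (counterclockwise) orientation of $\partial\mathbb{S}_+$. Let $\Gamma$ be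 the holonomy group of a Margulis space-time with parabolics and with linear parts in $\mathrm{SO}(2,1)^\circ$: a group of affine isometries of $\mathbb{R}^{2,1}$ with linear parts in $\mathrm{SO}(2,1)^\circ$, free of finite rank at least $2$, acting properly discontinuously on $\mathbb{R}^{2,1}$, and containing an element whose linear part is parabolic. For $g$ with hyperbolic or parabolic linear part $L(g)$, a vector $v\ne0$ with $L(g)v=v$ is called positive if $(v,x,L(g)x)$ is a positively oriented frame for every null or time-like $x$ that is not an eigenvector of $L(g)$; the Margulis (respectively Charette–Drumm) invariant of $g$ is positive if $B(g(x)-x,v)>0$ for a positive $v$ and all $x$. Assume the sign normalization that some element of $\Gamma$ with hyperbolic or parabolic linear part has positive invariant. Let $K\subset\mathbb{R}^{2,1}$ be compact, $y\in\mathbb{S}_+$, and let $\gamma_i\in\Gamma$ be a sequence with $\gamma_i(y)\to y_\infty\in\partial\mathbb{S}_+$. Then for every $\varepsilon>0$ there is $I_0$ such that for all $i>I_0$ $$\gamma_i(K)\subset\{p\in\mathbb{S}^3 : \mathbf{d}(p,\mathrm{clo}(\zeta_{y_\infty}))<\varepsilon\}.$$ Equivalently, for all $z_i\in K$, every accumulation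 point of the sequence $\gamma_i(z_i)$ in $\mathbb{S}^3$ lies in $\mathrm{clo}(\zeta_{y_\infty})$. -/

import Mathlib

open Filter Topology

noncomputable section

namespace Margulis

/-- The Lorentzian vector space `ℝ^{2,1}`, which is also the flat Lorentzian space with origin `0`. -/
abbrev R21 : Type := Fin 3 → ℝ

/-- The Lorentzian inner product `x₁ y₁ + x₂ y₂ - x₃ y₃`. -/
def lorentz (x y : R21) : ℝ := x 0 * y 0 + x 1 * y 1 - x 2 * y 2

/-- Affine automorphisms of the Lorentzian space. -/
abbrev Aff : Type := R21 ≃ᵃ[ℝ] R21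

/-- `A ∈ SO(2,1)°`: a linear isometry of the Lorentzian inner product, of determinant one, that
maps the positive time cone into itself. -/
structure IsSO21o (A : R21 ≃ₗ[ℝ] R21) : Prop where
  isometry : ∀ x y, lorentz (A x) (A y) = lorentz x y
  det_eq_one : LinearMap.det (A : R21 →ₗ[ℝ] R21) = 1
  time_orientation : ∀ x, lorentz x x < 0 → 0 < x 2 → 0 < A x 2

/-- A linear part is parabolic if it is unipotent and not the identity. -/
def IsParabolic (A : R21 ≃ₗ[ℝ] R21) : Prop :=
  (∃ x, A x ≠ x) ∧ ((A : R21 →ₗ[ℝ] R21) - LinearMap.id) ^ 3 = 0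

/-- A linear part in `SO(2,1)°` is hyperbolic if it has an eigenvalue greater than one. -/
def IsHyperbolic (A : R21 ≃ₗ[ℝ] R21) : Prop :=
  ∃ c : ℝ, 1 < c ∧ ∃ x : R21, x ≠ 0 ∧ A x = c • x

/-- The group `Γ` acts properly discontinuously on the Lorentzian space. -/
def ActsProperlyDiscontinuously (Γ : Subgroup Aff) : Prop :=
  ∀ K : Set R21, IsCompact K → {g : Aff | g ∈ Γ ∧ (g '' K ∩ K).Nonempty}.Finite

/-- `Γ` is the holonomy group of a Margulis space-time with linear parts in `SO(2,1)°`: a group of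
affine Lorentzian isometries, free of finite rank at least two, that acts properly
discontinuously. (The action is then free: stabilizers are finite and `Γ` is torsion-free.) -/
structure IsMargulisHolonomy (Γ : Subgroup Aff) : Prop where
  linear_mem : ∀ g ∈ Γ, IsSO21o g.linear
  free : ∃ n : ℕ, 2 ≤ n ∧ Nonempty (Γ ≃* FreeGroup (Fin n))
  proper : ActsProperlyDiscontinuously Γ

/-- The vector `v` is an eigenvector of `A` of eigenvalue one that is positive relative to `A`:
the frame `(v, x, A x)` is positively oriented for every null or time-like vector `x` that is
not an eigenvector of `A`. -/
def IsPositiveFixedVector (A : R21 ≃ₗ[ℝ] R21) (v : R21) : Prop :=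
  v ≠ 0 ∧ A v = v ∧
    ∀ x : R21, lorentz x x ≤ 0 → (¬ ∃ c : ℝ, A x = c • x) → 0 < (Matrix.of ![v, x, A x]).det

/-- The Margulis invariant (when `g` is hyperbolic), respectively the Charette-Drumm invariant
(when `g` is parabolic), of `g` is positive. The number `lorentz (g x - x) v` does not depend
on `x`, and the positive `v` form an open ray. -/
def HasPositiveInvariant (g : Aff) : Prop :=
  (IsHyperbolic g.linear ∨ IsParabolic g.linear) ∧
    ∃ v : R21, IsPositiveFixedVector g.linear v ∧ ∀ x : R21, 0 < lorentz (g x - x) v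

/-! ### The sphere of directions of `ℝ⁴` -/

/-- The ambient space `ℝ⁴`, with coordinates `x₀, x₁, x₂, x₃`. -/
abbrev R4 : Type := EuclideanSpace ℝ (Fin 4)

/-- The sphere of rays in `ℝ⁴`, each ray being represented by its unit vector. -/
abbrev SI3 : Type := Metric.sphere (0 : R4) 1

/-- The point of the sphere given by the ray through a nonzero vector. -/
def ray (v : R4) (hv : v ≠ 0) : SI3 :=
  ⟨‖v‖⁻¹ • v, by
    rw [mem_sphere_zero_iff_norm, norm_smul, norm_inv, norm_norm,
      inv_mul_cancel₀ (norm_ne_zero_iff.mpr hv)]⟩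

/-- The standard (angular) metric of the sphere. -/
def bdd (p q : SI3) : ℝ := InnerProductGeometry.angle (p : R4) (q : R4)

/-- The open `ε`-neighbourhood of a set, for the standard metric of the sphere. -/
def nbhd (ε : ℝ) (A : Set SI3) : Set SI3 := {p | ∃ a ∈ A, bdd p a < ε}

/-- The vector of `ℝ⁴` with zeroth coordinate `t` and remaining coordinates `x`. -/
def vec4 (t : ℝ) (x : R21) : R4 := WithLp.toLp 2 (Fin.cons t x)

/-- The last three coordinates of a vector of `ℝ⁴`. -/
def space (v : R4) : R21 := fun i => v i.succ

@[simp] theorem vec4_zero (t : ℝ) (x : R21) : vec4 t x 0 = t := rfl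

@[simp] theorem space_vec4 (t : ℝ) (x : R21) : space (vec4 t x) = x := rfl

theorem vec4_ne_zero {t : ℝ} {x : R21} (h : t ≠ 0 ∨ x ≠ 0) : vec4 t x ≠ 0 := by
  intro h0
  rcases h with h | h
  · exact h (by rw [← vec4_zero t x, h0]; rfl)
  · exact h (by rw [← space_vec4 t x, h0]; rfl)

theorem eq_zero_of_space {v : R4} (h0 : v 0 = 0) (h1 : space v = 0) : v = 0 := by
  ext i
  refine Fin.cases h0 (fun j => ?_) i
  exact congrFun h1 j

/-- The embedding of the Lorentzian space as an open hemisphere, `x ↦ ((1, x₁, x₂, x₃))`. -/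
def embed (x : R21) : SI3 := ray (vec4 1 x) (vec4_ne_zero (Or.inl one_ne_zero))

/-- The linear extension of an affine map to `ℝ⁴`, `(x₀, x) ↦ (x₀, L x + x₀ b)`. -/
def homogenize (g : Aff) (v : R4) : R4 := vec4 (v 0) (g.linear (space v) + v 0 • g 0)

theorem homogenize_ne_zero (g : Aff) {v : R4} (hv : v ≠ 0) : homogenize g v ≠ 0 := by
  by_cases h0 : v 0 = 0
  · refine vec4_ne_zero (Or.inr ?_)
    rw [h0, zero_smul, add_zero]
    intro h1
    exact hv (eq_zero_of_space h0 ((LinearEquiv.map_eq_zero_iff _).mp h1))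
  · exact vec4_ne_zero (Or.inl h0)

/-- The projective automorphism of the sphere that extends an affine automorphism. -/
def act (g : Aff) (p : SI3) : SI3 :=
  ray (homogenize g p) (homogenize_ne_zero g (ne_zero_of_mem_unit_sphere p))

/-- `𝕊₊`: the directions of the positive time-like vectors, in the sphere `x₀ = 0` at infinity. -/
def Splus : Set SI3 :=
  {p | (p : R4) 0 = 0 ∧ lorentz (space p) (space p) < 0 ∧ 0 < space p 2}

/-- `∂𝕊₊`: the directions of the positive null vectors. -/
def bdSplus : Set SI3 :=
  {p | (p : R4) 0 = 0 ∧ lorentz (space p) (space p) = 0 ∧ 0 < space p 2}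

/-- The accordant great segment `ζ_p` at `p = ((0, c₁, c₂, c₃)) ∈ ∂𝕊₊`: the open great semicircle
from `p` to its antipode that is tangent to `∂𝕊₊` at `p` and leaves `p` in the direction
`(0, -c₂, c₁, 0)` of the (counterclockwise) boundary orientation of `∂𝕊₊`. -/
def zeta (p : SI3) : Set SI3 :=
  {q | ∃ s t : ℝ, 0 < t ∧
    (q : R4) = s • (p : R4) + t • vec4 0 ![-(space p 1), space p 0, 0]}

end Margulis

end

noncomputable section

namespace Margulis

/-! ### Lorentzian linear algebra -/

/-! The Margulis invariant is replaced by a quantity linear in the linear part. The skew part of `A`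
with respect to the Lorentzian form is encoded by a vector `axial A`; for `A` in SO(2,1)° it is
fixed by `A`, and in the hyperbolic and parabolic cases it is a positive multiple of the positive
fixed vectors. Hence `inv g`, the pairing of `axial` with any displacement `g x - x`, has the sign
of the Margulis or Charette–Drumm invariant, and it passes to rescaled limits even when the linear
parts diverge.

Sign. A parabolic element with positive invariant yields a hyperbolic one
(`exists_hyperbolic_pos_of_parabolic`). Two hyperbolic elements with invariants of opposite signs
contradict proper discontinuity (`opposite_sign_aux`) unless certain null directions coincide;
conjugation excludes that, because a group preserving a null line is solvable and a free group of
rank at least two is not. So every hyperbolic element has nonnegative invariant.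

Inequality. After passing to a subsequence the linear parts of `γ n`, divided by `tau`, tend to the
rank one map with image `p` and kernel the orthogonal of `r`, where `p` and `r` are null; here `p`
is the direction of the limit of `γ n (y)`. Let `u` be a limit direction of `γ n (z n)`. When `h r`
is not parallel to `p`, the trace of `γ n * h⁻¹` tends to infinity, so these elements are eventually
hyperbolic; dividing their nonnegative invariants by `tau` and by the norm of `γ n (z n)` gives `0 ≤
det3 u (h r) p`. By closure this holds with any limit vector in place of `h r`
(`Normalized.det3_nonneg_of_mem`).

Tangency. The main point is `lorentz u p = 0` (`Normalized.lorentz_eq_zero`). Otherwise the plane of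
`u` and `p` meets the null cone in a second line `q`, and by the inequality one of the open arcs
between `p` and `q` contains no limit point. If a hyperbolic `a` in the group expands `p`, composing
`γ n` with suitable negative powers of `a` moves the escape direction to the other fixed line of
`a`, and the inequality for the new sequence is contradictory. If there is no such `a`, distinct
translates of the arc are disjoint. For a finitely generated group this forbids `p` from being an
attracting direction, by a combinatorial argument on the Cayley graph drawn with chords of the
circle (`CyclicAction.false_of_accumulation`); it stands in for the fact that an end of a gap of the
limit set is a hyperbolic fixed point.

Conclusion. Once `u` is orthogonal to `p` it is a combination of `p` and the tangent vector `tang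
p`, and the inequality makes the coefficient of `tang p` nonnegative, which is membership in the
closed accordant segment. Compactness of the sphere turns this into the uniform statement. -/

/-- The determinant of three vectors. -/
def det3 (a b c : R21) : ℝ :=
  a 0 * (b 1 * c 2 - b 2 * c 1) - a 1 * (b 0 * c 2 - b 2 * c 0) + a 2 * (b 0 * c 1 - b 1 * c 0)

/-- The Lorentzian cross product. -/
def cross (a b : R21) : R21 :=
  ![a 1 * b 2 - a 2 * b 1, a 2 * b 0 - a 0 * b 2, -(a 0 * b 1 - a 1 * b 0)]

/-- The basis vectors. -/
def bv (j : Fin 3) : R21 := Pi.single j 1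

/-- The axial vector of the skew part of a linear map. -/
def axial (T : R21 →ₗ[ℝ] R21) : R21 :=
  ![-(T (bv 2) 1 + T (bv 1) 2), T (bv 2) 0 + T (bv 0) 2, T (bv 0) 1 - T (bv 1) 0]

/-- The trace, in coordinates. -/
def tr3 (T : R21 →ₗ[ℝ] R21) : ℝ := T (bv 0) 0 + T (bv 1) 1 + T (bv 2) 2

theorem det_of (a b c : R21) : (Matrix.of ![a, b, c]).det = det3 a b c := by
  simp [Matrix.det_fin_three, det3]; ring

@[simp] theorem cross_zero (a b : R21) : cross a b 0 = a 1 * b 2 - a 2 * b 1 := rfl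
@[simp] theorem cross_one (a b : R21) : cross a b 1 = a 2 * b 0 - a 0 * b 2 := rfl
@[simp] theorem cross_two (a b : R21) : cross a b 2 = -(a 0 * b 1 - a 1 * b 0) := rfl

theorem lorentz_cross (a b c : R21) : lorentz (cross a b) c = det3 a b c := by
  simp [lorentz, det3]; ring

theorem ext3 {a b : R21} (h0 : a 0 = b 0) (h1 : a 1 = b 1) (h2 : a 2 = b 2) : a = b := by
  ext i; fin_cases i <;> assumption

theorem lorentz_comm (a b : R21) : lorentz a b = lorentz b a := by simp [lorentz]; ring
theorem lorentz_add_left (a b c : R21) : lorentz (a + b) c = lorentz a c + lorentz b c := by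
  simp [lorentz]; ring
theorem lorentz_sub_left (a b c : R21) : lorentz (a - b) c = lorentz a c - lorentz b c := by
  simp [lorentz]; ring
theorem lorentz_smul_left (t : ℝ) (a c : R21) : lorentz (t • a) c = t * lorentz a c := by
  simp [lorentz]; ring
theorem lorentz_add_right (a b c : R21) : lorentz a (b + c) = lorentz a b + lorentz a c := by
  simp [lorentz]; ring
theorem lorentz_sub_right (a b c : R21) : lorentz a (b - c) = lorentz a b - lorentz a c := by
  simp [lorentz]; ring
theorem lorentz_smul_right (t : ℝ) (a c : R21) : lorentz a (t • c) = t * lorentz a c := by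
  simp [lorentz]; ring

theorem det3_rotate (a b c : R21) : det3 a b c = det3 b c a := by simp [det3]; ring
theorem det3_swap (a b c : R21) : det3 a b c = -det3 a c b := by simp [det3]; ring

theorem eq_of_lorentz {a b : R21} (h : ∀ x, lorentz a x = lorentz b x) : a = b := by
  have h0 := h (bv 0); have h1 := h (bv 1); have h2 := h (bv 2)
  simp [lorentz, bv] at h0 h1 h2
  exact ext3 h0 h1 h2

theorem vec_eq (x : R21) : x = x 0 • bv 0 + x 1 • bv 1 + x 2 • bv 2 := by
  apply ext3 <;> simp [bv]

theorem map_vec (T : R21 →ₗ[ℝ] R21) (x : R21) :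
    T x = x 0 • T (bv 0) + x 1 • T (bv 1) + x 2 • T (bv 2) := by
  conv_lhs => rw [vec_eq x]
  simp

theorem map_apply3 (T : R21 →ₗ[ℝ] R21) (x : R21) (i : Fin 3) :
    T x i = x 0 * T (bv 0) i + x 1 * T (bv 1) i + x 2 * T (bv 2) i := by
  conv_lhs => rw [map_vec T x]
  simp

/-- In dimension three every skew bilinear form is a determinant with one vector fixed. This
characterizes `axial T` and makes it natural under isometries. -/
theorem det3_axial (T : R21 →ₗ[ℝ] R21) (x y : R21) :
    det3 (axial T) x y = lorentz (T x) y - lorentz x (T y) := by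
  simp only [det3, lorentz, axial, map_apply3 T x, map_apply3 T y, Matrix.cons_val_zero,
    Matrix.cons_val_one, Matrix.cons_val]
  ring

theorem axial_unique {T : R21 →ₗ[ℝ] R21} {a : R21}
    (h : ∀ x y, det3 a x y = lorentz (T x) y - lorentz x (T y)) : a = axial T := by
  have h' : ∀ x y, det3 a x y = det3 (axial T) x y := fun x y => by rw [h, det3_axial]
  have h0 := h' (bv 1) (bv 2); have h1 := h' (bv 0) (bv 2); have h2 := h' (bv 0) (bv 1)
  simp [det3, bv] at h0 h1 h2
  exact ext3 h0 h1 h2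

/-- The determinant of a linear map scales `det3`. -/
theorem det3_map (T : R21 →ₗ[ℝ] R21) (x y z : R21) :
    det3 (T x) (T y) (T z) = LinearMap.det T * det3 x y z := by
  have h : LinearMap.det T = det3 (T (bv 0)) (T (bv 1)) (T (bv 2)) := by
    rw [← LinearMap.det_toMatrix', Matrix.det_fin_three]
    simp only [LinearMap.toMatrix'_apply, det3, bv]
    ring
  rw [h]
  simp only [det3, map_apply3 T x, map_apply3 T y, map_apply3 T z]
  ring

/-- Plücker relation in the quotient by a null vector. -/
theorem plucker {a : R21} (ha : lorentz a a = 0) (b c d : R21) :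
    det3 a b d * lorentz a c = det3 a b c * lorentz a d + det3 a c d * lorentz a b := by
  simp only [det3, lorentz] at *
  linear_combination -(b 0 * (c 1 * d 2 - c 2 * d 1) - b 1 * (c 0 * d 2 - c 2 * d 0)
    + b 2 * (c 0 * d 1 - c 1 * d 0)) * ha

theorem cross_cross (a b c : R21) :
    cross a (cross b c) = lorentz a b • c - lorentz a c • b := by
  apply ext3 <;> simp [lorentz] <;> ring

theorem lorentz_cross_cross (a b c d : R21) :
    lorentz (cross a b) (cross c d) = lorentz a d * lorentz b c - lorentz a c * lorentz b d := by
  simp [lorentz]; ring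

/-! ### Isometries and causal vectors -/

/-- The bilinear pairing of a linear map with a vector that computes the Margulis invariant. -/
def kap (T : R21 →ₗ[ℝ] R21) (u : R21) : ℝ := lorentz (axial T) u

/-- Future null vectors. -/
def IsNF (x : R21) : Prop := lorentz x x = 0 ∧ 0 < x 2

/-- Future time-like vectors. -/
def IsTF (x : R21) : Prop := lorentz x x < 0 ∧ 0 < x 2

theorem IsNF.ne_zero {x : R21} (h : IsNF x) : x ≠ 0 := by
  rintro rfl; exact absurd h.2 (by simp)

theorem IsNF.smul {x : R21} (h : IsNF x) {c : ℝ} (hc : 0 < c) : IsNF (c • x) := by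
  refine ⟨?_, by simpa using mul_pos hc h.2⟩
  rw [lorentz_smul_left, lorentz_smul_right, h.1]; simp

theorem IsTF.lorentz_neg {x y : R21} (hx : IsTF x) (hy : IsTF y ∨ IsNF y) : lorentz x y < 0 := by
  have hy0 : lorentz y y ≤ 0 ∧ 0 < y 2 := by
    rcases hy with h | h
    · exact ⟨h.1.le, h.2⟩
    · exact ⟨h.1.le, h.2⟩
  obtain ⟨hx1, hx2⟩ := hx
  obtain ⟨hy1, hy2⟩ := hy0
  simp only [lorentz] at *
  have h1 : (x 0 * y 0 + x 1 * y 1) ^ 2 < (x 2 * y 2) ^ 2 := by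
    have h2 : (x 0 * y 0 + x 1 * y 1) ^ 2 ≤ (x 0 ^ 2 + x 1 ^ 2) * (y 0 ^ 2 + y 1 ^ 2) := by
      nlinarith [sq_nonneg (x 0 * y 1 - x 1 * y 0)]
    have h3 : (x 0 ^ 2 + x 1 ^ 2) * (y 0 ^ 2 + y 1 ^ 2) ≤ (x 0 ^ 2 + x 1 ^ 2) * y 2 ^ 2 := by
      apply mul_le_mul_of_nonneg_left <;> nlinarith
    have h4 : (x 0 ^ 2 + x 1 ^ 2) * y 2 ^ 2 < x 2 ^ 2 * y 2 ^ 2 := by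
      apply mul_lt_mul_of_pos_right <;> nlinarith
    nlinarith
  have := abs_lt_of_sq_lt_sq h1 (by positivity)
  linarith [(abs_lt.mp this).2]

theorem isTF_bv : IsTF (bv 2) := by
  constructor <;> simp [lorentz, bv]

theorem IsNF.lorentz_nonpos {x y : R21} (hx : IsNF x) (hy : IsNF y) : lorentz x y ≤ 0 := by
  obtain ⟨hx1, hx2⟩ := hx
  obtain ⟨hy1, hy2⟩ := hy
  simp only [lorentz] at *
  have h1 : (x 0 * y 0 + x 1 * y 1) ^ 2 ≤ (x 2 * y 2) ^ 2 := by
    have e : (x 2 * y 2) ^ 2 = (x 0 ^ 2 + x 1 ^ 2) * (y 0 ^ 2 + y 1 ^ 2) := by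
      have e1 : x 2 ^ 2 = x 0 ^ 2 + x 1 ^ 2 := by linarith
      have e2 : y 2 ^ 2 = y 0 ^ 2 + y 1 ^ 2 := by linarith
      rw [mul_pow, e1, e2]
    rw [e]
    nlinarith [sq_nonneg (x 0 * y 1 - x 1 * y 0)]
  have := abs_le_of_sq_le_sq h1 (by positivity)
  linarith [(abs_le.mp this).2]

theorem eq_smul_of_null {x y : R21} (hx : lorentz x x = 0) (hy : IsNF y) (hxy : lorentz x y = 0) :
    x = (x 2 / y 2) • y := by
  obtain ⟨hy1, hy2⟩ := hy
  simp only [lorentz] at *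
  have hsq : (x 0 * y 2 - x 2 * y 0) ^ 2 + (x 1 * y 2 - x 2 * y 1) ^ 2 = 0 := by
    linear_combination (y 2) ^ 2 * hx + (x 2) ^ 2 * hy1 - 2 * x 2 * y 2 * hxy
  have h0 : x 0 * y 2 - x 2 * y 0 = 0 := by nlinarith [sq_nonneg (x 0 * y 2 - x 2 * y 0), sq_nonneg (x 1 * y 2 - x 2 * y 1)]
  have h1 : x 1 * y 2 - x 2 * y 1 = 0 := by nlinarith [sq_nonneg (x 0 * y 2 - x 2 * y 0), sq_nonneg (x 1 * y 2 - x 2 * y 1)]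
  apply ext3 <;> simp <;> field_simp <;> linarith

theorem IsNF.parallel {x y : R21} (hx : IsNF x) (hy : IsNF y) (hxy : lorentz x y = 0) :
    ∃ c : ℝ, 0 < c ∧ x = c • y :=
  ⟨x 2 / y 2, div_pos hx.2 hy.2, eq_smul_of_null hx.1 hy hxy⟩

/-- The Gram determinant; the minus sign comes from the signature. -/
theorem det3_sq (x y z : R21) : det3 x y z ^ 2 =
    -(lorentz x x * (lorentz y y * lorentz z z - lorentz y z ^ 2)
      - lorentz x y * (lorentz x y * lorentz z z - lorentz y z * lorentz x z)
      + lorentz x z * (lorentz x y * lorentz y z - lorentz y y * lorentz x z)) := by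
  simp only [det3, lorentz]; ring

theorem IsNF.det3_sq {x y z : R21} (hx : IsNF x) (hy : IsNF y) (hz : IsNF z) :
    det3 x y z ^ 2 = -2 * (lorentz x y * lorentz y z * lorentz x z) := by
  rw [Margulis.det3_sq, hx.1, hy.1, hz.1]; ring

theorem IsNF.det3_ne_zero {x y z : R21} (hx : IsNF x) (hy : IsNF y) (hz : IsNF z)
    (hxy : lorentz x y ≠ 0) (hyz : lorentz y z ≠ 0) (hxz : lorentz x z ≠ 0) : det3 x y z ≠ 0 := by
  intro h
  have := hx.det3_sq hy hz
  rw [h] at this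
  have h2 : lorentz x y * lorentz y z * lorentz x z ≠ 0 := by positivity
  apply h2; linarith

/-- Reverse Cauchy–Schwarz inequality: a vector orthogonal to a time-like one is not time-like. -/
theorem IsTF.lorentz_le {x y : R21} (hx : IsTF x) (hy : IsTF y) (h : lorentz x x = lorentz y y) :
    lorentz x y ≤ lorentz x x := by
  have hn := hx.lorentz_neg (Or.inl hy)
  have h1 := hx.1
  -- the Gram determinant of a time-like plane is nonpositive
  have h2 : lorentz x x ^ 2 ≤ lorentz x y ^ 2 := by
    have e : lorentz x y ^ 2 - lorentz x x * lorentz y y = lorentz (cross x y) (cross x y) := by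
      rw [lorentz_cross_cross, lorentz_comm y x]; ring
    by_contra hlt
    have hc : lorentz (cross x y) (cross x y) < 0 := by rw [← e, ← h]; nlinarith
    have hz : lorentz (cross x y) x = 0 := by simp [lorentz]; ring
    by_cases h3 : 0 < cross x y 2
    · have := hx.lorentz_neg (Or.inl ⟨hc, h3⟩)
      rw [lorentz_comm] at this; linarith
    · have h4 : 0 < (-(1 : ℝ) • cross x y) 2 := by
        have : cross x y 2 ≠ 0 := by
          intro h0
          simp only [lorentz, h0] at hc
          nlinarith [sq_nonneg (cross x y 0), sq_nonneg (cross x y 1)]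
        have : cross x y 2 < 0 := lt_of_le_of_ne (not_lt.mp h3) this
        simp only [Pi.smul_apply, smul_eq_mul]; linarith
      have := hx.lorentz_neg (Or.inl ⟨by rw [lorentz_smul_left, lorentz_smul_right]; linarith, h4⟩)
      rw [lorentz_smul_right, lorentz_comm] at this; linarith
  nlinarith

namespace IsSO21o

variable {A : R21 ≃ₗ[ℝ] R21}

theorem lorentz_symm (hA : IsSO21o A) (x y : R21) : lorentz (A.symm x) y = lorentz x (A y) := by
  rw [← hA.isometry, LinearEquiv.apply_symm_apply]

theorem det3 (hA : IsSO21o A) (x y z : R21) :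
    Margulis.det3 (A x) (A y) (A z) = Margulis.det3 x y z := by
  have := det3_map (A : R21 →ₗ[ℝ] R21) x y z
  rw [hA.det_eq_one, one_mul] at this
  exact this

theorem cross (hA : IsSO21o A) (x y : R21) :
    A (Margulis.cross x y) = Margulis.cross (A x) (A y) := by
  apply eq_of_lorentz
  intro z
  obtain ⟨w, rfl⟩ := A.surjective z
  rw [hA.isometry, lorentz_cross, lorentz_cross, hA.det3]

theorem isTF (hA : IsSO21o A) {x : R21} (hx : IsTF x) : IsTF (A x) :=
  ⟨by rw [hA.isometry]; exact hx.1, hA.time_orientation x hx.1 hx.2⟩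

theorem isNF (hA : IsSO21o A) {x : R21} (hx : IsNF x) : IsNF (A x) := by
  have h0 : lorentz (A x) (A x) = 0 := by rw [hA.isometry]; exact hx.1
  refine ⟨h0, ?_⟩
  have h1 := (hA.isTF isTF_bv).lorentz_neg (y := A x)
  have h2 : lorentz (A (bv 2)) (A x) < 0 := by
    rw [hA.isometry]; exact isTF_bv.lorentz_neg (Or.inr hx)
  by_contra hle
  rcases (not_lt.mp hle).eq_or_lt with h | h
  · have : A x = 0 := by
      simp only [lorentz, h] at h0
      apply ext3 <;> simp <;> nlinarith [sq_nonneg (A x 0), sq_nonneg (A x 1)]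
    rw [this] at h2; simp [lorentz] at h2
  · have := (hA.isTF isTF_bv).lorentz_neg (y := -(1:ℝ) • A x) (Or.inr ⟨by
      rw [lorentz_smul_left, lorentz_smul_right, h0]; simp, by simpa using h⟩)
    rw [lorentz_smul_right] at this; linarith

theorem axial_fixed (hA : IsSO21o A) : A (axial A) = axial (A : R21 →ₗ[ℝ] R21) := by
  have h : ∀ x y, Margulis.det3 (A (axial A)) x y = Margulis.det3 (axial (A : R21 →ₗ[ℝ] R21)) x y := by
    intro x y
    obtain ⟨x, rfl⟩ := A.surjective x
    obtain ⟨y, rfl⟩ := A.surjective y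
    rw [hA.det3, det3_axial, det3_axial]
    simp only [LinearEquiv.coe_coe]
    rw [hA.isometry, hA.isometry]
  apply eq_of_lorentz
  have h0 := h (bv 1) (bv 2); have h1 := h (bv 0) (bv 2); have h2 := h (bv 0) (bv 1)
  simp [Margulis.det3, bv] at h0 h1 h2
  intro x
  simp [lorentz, h0, h1, h2]

theorem kap_map (hA : IsSO21o A) (x : R21) : kap A (A x) = kap A x := by
  unfold kap
  conv_lhs => rw [← hA.axial_fixed]
  rw [hA.isometry]

theorem kap_symm (hA : IsSO21o A) (u : R21) :
    kap (A.symm : R21 →ₗ[ℝ] R21) u = -kap A u := by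
  have : -(1:ℝ) • axial (A : R21 →ₗ[ℝ] R21) = axial (A.symm : R21 →ₗ[ℝ] R21) := by
    apply axial_unique
    intro x y
    have e : Margulis.det3 (-(1:ℝ) • axial (A : R21 →ₗ[ℝ] R21)) x y =
      -Margulis.det3 (axial (A : R21 →ₗ[ℝ] R21)) x y := by simp [Margulis.det3]; ring
    rw [e, det3_axial]
    simp only [LinearEquiv.coe_coe]
    rw [hA.lorentz_symm, lorentz_comm x (A.symm y), hA.lorentz_symm, lorentz_comm y (A x)]
    ring
  unfold kap
  rw [← this, lorentz_smul_left]; ring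

/-- Conjugation invariance. -/
theorem kap_conj (hA : IsSO21o A) (T : R21 →ₗ[ℝ] R21) (u : R21) :
    kap ((A : R21 →ₗ[ℝ] R21) ∘ₗ T) (A u) = kap (T ∘ₗ (A : R21 →ₗ[ℝ] R21)) u := by
  have : A (axial (T ∘ₗ (A : R21 →ₗ[ℝ] R21))) = axial ((A : R21 →ₗ[ℝ] R21) ∘ₗ T) := by
    apply axial_unique
    intro x y
    obtain ⟨x, rfl⟩ := A.surjective x
    obtain ⟨y, rfl⟩ := A.surjective y
    rw [hA.det3, det3_axial]
    simp only [LinearMap.comp_apply, LinearEquiv.coe_coe]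
    rw [hA.isometry, hA.isometry]
  unfold kap
  rw [← this, hA.isometry]

end IsSO21o

/-- Rescaled limits of diverging isometries are of this rank one form, so this is what the invariant
becomes in the limit. -/
theorem kap_rankOne (q r u : R21) (T : R21 →ₗ[ℝ] R21) (hT : ∀ x, T x = -lorentz x r • q) :
    kap T u = det3 u r q := by
  simp only [kap, axial, lorentz, hT, det3]
  simp [bv]
  ring

/-! ### Hyperbolic isometries and their axes -/

/-- Expansion in the frame `cross y x`, `x`, `y`, obtained from a double cross product and kept free
of denominators. -/
theorem cross_decomp {x y : R21} (hx : lorentz x x = 0) (hy : lorentz y y = 0) (b : R21) :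
    lorentz x y ^ 2 • b = lorentz (cross y x) b • cross y x
      + (lorentz x y * lorentz b y) • x + (lorentz x y * lorentz b x) • y := by
  have h1 := cross_cross (cross y x) (cross y x) b
  have h2 : lorentz (cross y x) (cross y x) = lorentz x y ^ 2 := by
    rw [lorentz_cross_cross, hx, hy, lorentz_comm y x]; ring
  have h3 : cross (cross y x) b = lorentz b x • y - lorentz b y • x := by
    have : cross (cross y x) b = -cross b (cross y x) := by
      apply ext3 <;> simp <;> ring
    rw [this, cross_cross]; abel
  have h4 : cross (cross y x) y = lorentz x y • y := by
    have : cross (cross y x) y = -cross y (cross y x) := by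
      apply ext3 <;> simp <;> ring
    rw [this, cross_cross, hy, lorentz_comm y x]; simp
  have h5 : cross (cross y x) x = -(lorentz x y • x) := by
    have : cross (cross y x) x = -cross x (cross y x) := by
      apply ext3 <;> simp <;> ring
    rw [this, cross_cross, hx]; simp
  have h6 : cross (cross y x) (lorentz b x • y - lorentz b y • x)
      = lorentz b x • cross (cross y x) y - lorentz b y • cross (cross y x) x := by
    apply ext3 <;> simp <;> ring
  rw [h3, h6, h4, h5, h2] at h1
  have h7 := congrArg (fun z => z + lorentz (cross y x) b • cross y x) h1
  simp only [sub_add_cancel] at h7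
  rw [← h7]
  module

/-- Modulo `x`, the vector `cross y x` depends only on `lorentz y x`: the orthogonal of `x` modulo
`x` is a line. This compares the neutral direction of an axis with other directions in the same null
plane. -/
theorem cross_mod {x y z : R21} (hx : IsNF x) (hz : lorentz z x ≠ 0) :
    ∃ k : ℝ, cross y x = (lorentz y x / lorentz z x) • cross z x + k • x := by
  set w : R21 := y - (lorentz y x / lorentz z x) • z with hw
  have hwx : lorentz w x = 0 := by
    rw [hw, lorentz_sub_left, lorentz_smul_left]; field_simp; ring
  have h1 : lorentz (cross w x) (cross w x) = 0 := by
    rw [lorentz_cross_cross, hx.1, hwx]; ring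
  have h2 : lorentz (cross w x) x = 0 := by simp [lorentz]; ring
  refine ⟨cross w x 2 / x 2, ?_⟩
  rw [← eq_smul_of_null h1 hx h2, hw]
  apply ext3 <;> simp <;> ring

theorem exists_NF_of_null {x : R21} (hx : lorentz x x = 0) (h0 : x ≠ 0) :
    ∃ e : ℝ, e ≠ 0 ∧ IsNF (e • x) := by
  have h2 : x 2 ≠ 0 := by
    intro h
    simp only [lorentz, h] at hx
    apply h0
    apply ext3 <;> simp <;> nlinarith [sq_nonneg (x 0), sq_nonneg (x 1)]
  refine ⟨x 2, h2, ?_, ?_⟩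
  · rw [lorentz_smul_left, lorentz_smul_right, hx]; simp
  · simpa using h2

/-- A hyperbolic isometry has an expanding and a contracting null direction. -/
theorem IsSO21o.hyperbolic_data {A : R21 ≃ₗ[ℝ] R21} (hA : IsSO21o A) (h : IsHyperbolic A) :
    ∃ (l : ℝ) (xp xm : R21), 1 < l ∧ IsNF xp ∧ IsNF xm ∧ A xp = l • xp ∧ A xm = l⁻¹ • xm := by
  obtain ⟨c, hc, x, hx0, hx⟩ := h
  have null : ∀ z : R21, ∀ k : ℝ, 0 < k → k ≠ 1 → A z = k • z → lorentz z z = 0 := by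
    intro z k hk hk1 hz
    have := hA.isometry z z
    rw [hz, lorentz_smul_left, lorentz_smul_right] at this
    have h1 : (k * k - 1) * lorentz z z = 0 := by linarith
    rcases mul_eq_zero.mp h1 with h | h
    · exfalso; apply hk1; nlinarith
    · exact h
  obtain ⟨e, he, hxp⟩ := exists_NF_of_null (null x c (by linarith) hc.ne' hx) hx0
  set T : R21 →ₗ[ℝ] R21 := (A : R21 →ₗ[ℝ] R21) - c • LinearMap.id with hT
  have hninj : ¬ Function.Injective T := by
    intro hinj
    apply hx0
    apply hinj
    simp [hT, hx]
  -- A functional that kills the range of `A - c` is represented, through the form, by an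
  -- eigenvector of the adjoint `A.symm`. It is the contracting direction.
  have hnsurj : LinearMap.range T < ⊤ := by
    rw [lt_top_iff_ne_top]
    intro htop
    exact hninj (LinearMap.injective_iff_surjective.mpr (LinearMap.range_eq_top.mp htop))
  obtain ⟨f, hf0, hf⟩ := Submodule.exists_le_ker_of_lt_top _ hnsurj
  set y : R21 := ![f (bv 0), f (bv 1), -f (bv 2)] with hy
  have hfy : ∀ z, f z = lorentz y z := by
    intro z
    conv_lhs => rw [vec_eq z]
    simp [lorentz, hy]; ring
  have hy0 : y ≠ 0 := by
    intro h0
    refine hf0 (LinearMap.ext fun z => ?_)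
    rw [hfy, h0]; simp [lorentz]
  have hys : A.symm y = c • y := by
    apply eq_of_lorentz
    intro z
    have h1 : f (T z) = 0 := hf ⟨z, rfl⟩
    rw [hfy] at h1
    simp only [hT, LinearMap.sub_apply, LinearEquiv.coe_coe, LinearMap.smul_apply,
      LinearMap.id_apply, lorentz_sub_right, lorentz_smul_right] at h1
    rw [hA.lorentz_symm, lorentz_smul_left]; linarith
  have hAy : A y = c⁻¹ • y := by
    have := congrArg A hys
    rw [LinearEquiv.apply_symm_apply, map_smul] at this
    rw [this, smul_smul, inv_mul_cancel₀ (by linarith), one_smul]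
    rw [← this]
  have hci : c⁻¹ ≠ 1 := (inv_lt_one_of_one_lt₀ hc).ne
  obtain ⟨e', he', hxm⟩ := exists_NF_of_null (null y c⁻¹ (by positivity) hci hAy) hy0
  refine ⟨c, e • x, e' • y, hc, hxp, hxm, ?_, ?_⟩
  · rw [map_smul, hx, smul_comm]
  · rw [map_smul, hAy, smul_comm]

/-- An isometry of trace greater than three is hyperbolic. -/
theorem IsSO21o.hyperbolic_of_trace {A : R21 ≃ₗ[ℝ] R21} (hA : IsSO21o A)
    (h : 3 < tr3 A) : IsHyperbolic A := by
  set t := tr3 (A : R21 →ₗ[ℝ] R21) with ht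
  -- The characteristic polynomial is `(X - 1) * (X ^ 2 - (t - 1) * X + 1)`, and `l` is the larger
  -- root of the quadratic factor.
  set l : ℝ := ((t - 1) + √((t - 1) ^ 2 - 4)) / 2 with hl
  have hs := Real.sq_sqrt (show 0 ≤ (t - 1) ^ 2 - 4 by nlinarith)
  have hs0 := Real.sqrt_nonneg ((t - 1) ^ 2 - 4)
  have hl1 : 1 < l := by rw [hl]; linarith
  have hroot : l ^ 2 - (t - 1) * l + 1 = 0 := by rw [hl]; nlinarith
  set T : R21 →ₗ[ℝ] R21 := (A : R21 →ₗ[ℝ] R21) - l • LinearMap.id with hT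
  have hdet : LinearMap.det T = 0 := by
    have h1 := det3_map T (bv 0) (bv 1) (bv 2)
    have h2 : Margulis.det3 (bv 0) (bv 1) (bv 2) = 1 := by simp [Margulis.det3, bv]
    rw [h2, mul_one] at h1
    rw [← h1]
    have d := hA.det3 (bv 0) (bv 1) (bv 2)
    rw [h2] at d
    -- Compatibility with the cross product identifies principal minors with diagonal entries up to
    -- sign, so the second coefficient of the characteristic polynomial is also the trace.
    have c01 := congrFun (hA.cross (bv 0) (bv 1)) 2
    have c02 := congrFun (hA.cross (bv 0) (bv 2)) 1
    have c12 := congrFun (hA.cross (bv 1) (bv 2)) 0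
    have e01 : Margulis.cross (bv 0) (bv 1) = -bv 2 := by apply ext3 <;> simp [bv]
    have e02 : Margulis.cross (bv 0) (bv 2) = -bv 1 := by apply ext3 <;> simp [bv]
    have e12 : Margulis.cross (bv 1) (bv 2) = bv 0 := by apply ext3 <;> simp [bv]
    rw [e01] at c01; rw [e02] at c02; rw [e12] at c12
    simp only [map_neg, Pi.neg_apply, cross_zero, cross_one, cross_two] at c01 c02 c12
    simp only [Margulis.det3] at d
    simp only [tr3, LinearEquiv.coe_coe] at ht
    simp only [hT, Margulis.det3, LinearMap.sub_apply, LinearEquiv.coe_coe, LinearMap.smul_apply,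
      LinearMap.id_apply, Pi.sub_apply, Pi.smul_apply, smul_eq_mul]
    simp [bv] at d c01 c02 c12 ht ⊢
    clear_value l t
    linear_combination d + (1 - l) * hroot + l * c12 - l * c02 - l * c01 + (l - l ^ 2) * ht
  obtain ⟨x, hx, hx0⟩ := (Submodule.ne_bot_iff _).mp (LinearMap.bot_lt_ker_of_det_eq_zero hdet).ne'
  refine ⟨l, hl1, x, hx0, ?_⟩
  have : A x - l • x = 0 := hx
  exact sub_eq_zero.mp this

/-! ### Affine isometries and their normal form along an axis -/

theorem aff_apply_add (g : Aff) (x v : R21) : g (x + v) = g x + g.linear v := by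
  have := g.map_vadd x v
  simp only [vadd_eq_add] at this
  rw [add_comm x v, this, add_comm]

theorem aff_apply (g : Aff) (x : R21) : g x = g.linear x + g 0 := by
  have := aff_apply_add g 0 x
  rw [zero_add] at this
  rw [this, add_comm]

theorem linear_mul (g h : Aff) (x : R21) : (g * h).linear x = g.linear (h.linear x) := rfl
theorem linear_inv (g : Aff) (x : R21) : (g⁻¹).linear x = g.linear.symm x := rfl
theorem aff_mul (g h : Aff) (x : R21) : (g * h) x = g (h x) := rfl
theorem aff_inv (g : Aff) (x : R21) : g⁻¹ (g x) = x := g.symm_apply_apply x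
theorem aff_inv' (g : Aff) (x : R21) : g (g⁻¹ x) = x := g.apply_symm_apply x

/-- The Margulis invariant, up to a positive normalization. -/
def inv (g : Aff) : ℝ := kap (g.linear : R21 →ₗ[ℝ] R21) (g 0)

/-- The axial vector is fixed by the linear part, so moving the base point adds a term that it does
not see. -/
theorem inv_eq {g : Aff} (hg : IsSO21o g.linear) (x : R21) :
    kap (g.linear : R21 →ₗ[ℝ] R21) (g x - x) = inv g := by
  have h := hg.kap_map x
  rw [aff_apply g x, inv]
  simp only [kap, lorentz_sub_right, lorentz_add_right] at *
  linarith

/-- The normal form of an affine isometry with hyperbolic linear part. -/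
structure IsAxis (g : Aff) (l s : ℝ) (xp xm o : R21) : Prop where
  one_lt : 1 < l
  nfp : IsNF xp
  nfm : IsNF xm
  map_p : g.linear xp = l • xp
  map_m : g.linear xm = l⁻¹ • xm
  map_n : g.linear (cross xm xp) = cross xm xp
  map_o : g o = o + s • cross xm xp

theorem IsAxis.lorentz_ne {g : Aff} {l s : ℝ} {xp xm o : R21} (h : IsAxis g l s xp xm o) :
    lorentz xp xm ≠ 0 := by
  intro h0
  obtain ⟨c, hc, hcx⟩ := h.nfp.parallel h.nfm h0
  have h1 := h.map_p
  rw [hcx, map_smul, h.map_m, smul_comm c, smul_comm l] at h1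
  have h2 := congrFun h1 2
  simp only [Pi.smul_apply, smul_eq_mul] at h2
  have h3 := mul_pos hc h.nfm.2
  rw [← mul_assoc, mul_comm _ c, mul_assoc, ← mul_assoc c, mul_comm c, mul_assoc] at h2
  have : l⁻¹ < 1 := inv_lt_one_of_one_lt₀ h.one_lt
  nlinarith [h.one_lt]

/-- The translation length keeps its sign: the displacement is reversed, but so is the neutral
vector when the two null directions are exchanged. -/
theorem IsAxis.inv_apply {g : Aff} {l s : ℝ} {xp xm o : R21} (h : IsAxis g l s xp xm o) :
    IsAxis g⁻¹ l s xm xp o := by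
  have hl : l ≠ 0 := by linarith [h.one_lt]
  have hn : g.linear.symm (cross xm xp) = cross xm xp := by
    rw [LinearEquiv.symm_apply_eq, h.map_n]
  have hcr : cross xp xm = -cross xm xp := by apply ext3 <;> simp <;> ring
  refine ⟨h.one_lt, h.nfm, h.nfp, ?_, ?_, ?_, ?_⟩
  · rw [linear_inv, LinearEquiv.symm_apply_eq, map_smul, h.map_m, smul_smul, mul_inv_cancel₀ hl,
      one_smul]
  · rw [linear_inv, LinearEquiv.symm_apply_eq, map_smul, h.map_p, smul_smul, inv_mul_cancel₀ hl,
      one_smul]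
  · rw [hcr, map_neg, linear_inv, hn]
  · have h1 := aff_inv g o
    rw [h.map_o, aff_apply_add, linear_inv, map_smul, hn] at h1
    rw [hcr, eq_sub_of_add_eq h1]
    module

theorem IsAxis.pow_apply {g : Aff} {l s : ℝ} {xp xm o : R21} (h : IsAxis g l s xp xm o)
    (n : ℕ) (e f : ℝ) : (g ^ n) (o + e • cross xm xp + f • xm) =
      o + (e + n * s) • cross xm xp + (l⁻¹ ^ n * f) • xm := by
  induction n with
  | zero => simp
  | succ n ih =>
    rw [pow_succ', aff_mul, ih, aff_apply_add, aff_apply_add, h.map_o, map_smul, map_smul,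
      h.map_n, h.map_m]
    push_cast
    module

theorem IsAxis.pow_linear {g : Aff} {l s : ℝ} {xp xm o : R21} (h : IsAxis g l s xp xm o)
    (n : ℕ) : (g ^ n).linear xm = l⁻¹ ^ n • xm := by
  induction n with
  | zero => rw [pow_zero, pow_zero, one_smul]; rfl
  | succ n ih =>
    rw [pow_succ', linear_mul, ih, map_smul, h.map_m, smul_smul, pow_succ]

/-- Since `1 - l` and `1 - l⁻¹` are invertible, a change of origin removes the null components of
the translation; the neutral component remains. -/
theorem exists_axis {g : Aff} (hg : IsSO21o g.linear) (h : IsHyperbolic g.linear) :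
    ∃ (l s : ℝ) (xp xm o : R21), IsAxis g l s xp xm o ∧ ∃ k : ℝ, 0 < k ∧ inv g = k * s := by
  obtain ⟨l, xp, xm, hl, hp, hm, hAp, hAm⟩ := hg.hyperbolic_data h
  have hl0 : 0 < l := by linarith
  have hn : g.linear (cross xm xp) = cross xm xp := by
    rw [hg.cross, hAp, hAm]
    apply ext3 <;> simp <;> field_simp
  -- The linear part, viewed as an affine map fixing the origin, has an axis with `s = 0`; this
  -- gives the inequality before the axis of `g` is known.
  have hne : lorentz xp xm ≠ 0 := IsAxis.lorentz_ne (g := AffineEquiv.linear g |>.toAffineEquiv)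
    (o := 0) (s := 0) ⟨hl, hp, hm, hAp, hAm, hn, by simp⟩
  obtain ⟨a, b, s, hb⟩ : ∃ a b s : ℝ, g 0 = a • xp + b • xm + s • cross xm xp := by
    have h := cross_decomp hp.1 hm.1 (g 0)
    refine ⟨(lorentz xp xm ^ 2)⁻¹ * (lorentz xp xm * lorentz (g 0) xm),
      (lorentz xp xm ^ 2)⁻¹ * (lorentz xp xm * lorentz (g 0) xp),
      (lorentz xp xm ^ 2)⁻¹ * lorentz (cross xm xp) (g 0), ?_⟩
    have h' := congrArg (fun z => (lorentz xp xm ^ 2)⁻¹ • z) h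
    simp only [smul_smul, smul_add] at h'
    rw [inv_mul_cancel₀ (pow_ne_zero 2 hne), one_smul] at h'
    exact h'.trans (by abel)
  have hl1 : (1 - l) ≠ 0 := by linarith
  have hl2 : (1 - l⁻¹) ≠ 0 := by
    have : l⁻¹ < 1 := inv_lt_one_of_one_lt₀ hl
    linarith
  have hax : IsAxis g l s xp xm ((a / (1 - l)) • xp + (b / (1 - l⁻¹)) • xm) := by
    refine ⟨hl, hp, hm, hAp, hAm, hn, ?_⟩
    rw [aff_apply, map_add, map_smul, map_smul, hAp, hAm, hb, smul_smul, smul_smul]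
    have e1 : a = a / (1 - l) * (1 - l) := by field_simp
    have e2 : b = b / (1 - l⁻¹) * (1 - l⁻¹) := by rw [div_mul_cancel₀ _ hl2]
    nth_rw 2 [e1]; nth_rw 2 [e2]
    module
  refine ⟨l, s, xp, xm, _, hax, ?_⟩
  have hneg : lorentz xp xm < 0 := lt_of_le_of_ne (hp.lorentz_nonpos hm) hne
  refine ⟨-((l - l⁻¹) * lorentz xp xm), ?_, ?_⟩
  · have : l⁻¹ < 1 := inv_lt_one_of_one_lt₀ hl
    have : 0 < l - l⁻¹ := by linarith
    nlinarith
  · rw [← inv_eq hg ((a / (1 - l)) • xp + (b / (1 - l⁻¹)) • xm), hax.map_o, add_sub_cancel_left,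
      kap, lorentz_smul_right]
    have h1 := det3_axial (g.linear : R21 →ₗ[ℝ] R21) xp xm
    have h2 : lorentz (axial (g.linear : R21 →ₗ[ℝ] R21)) (cross xm xp) =
        -det3 (axial (g.linear : R21 →ₗ[ℝ] R21)) xp xm := by simp [lorentz, det3]; ring
    rw [h2, h1]
    simp only [LinearEquiv.coe_coe]
    rw [hAp, hAm, lorentz_smul_left, lorentz_smul_right]
    ring

/-! ### The opposite sign lemma -/

theorem exists_bound_geom {l : ℝ} (hl : 1 < l) (a b : ℝ) :
    ∃ M : ℝ, ∀ n : ℕ, l⁻¹ ^ n * (a + b * n) ≤ M := by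
  have hr : |l⁻¹| < 1 := by
    rw [abs_of_pos (by positivity)]; exact inv_lt_one_of_one_lt₀ hl
  have h1 := tendsto_pow_const_mul_const_pow_of_abs_lt_one 0 hr
  have h2 := tendsto_pow_const_mul_const_pow_of_abs_lt_one 1 hr
  have h3 := (h1.const_mul a).add (h2.const_mul b)
  obtain ⟨M, hM⟩ := h3.bddAbove_range
  refine ⟨M, fun n => le_trans (le_of_eq ?_) (hM ⟨n, rfl⟩)⟩
  simp; ring

theorem aff_pow_isometry {g : Aff} (h : IsSO21o g.linear) (n : ℕ) (x y : R21) :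
    lorentz ((g ^ n).linear x) ((g ^ n).linear y) = lorentz x y := by
  induction n with
  | zero => rfl
  | succ n ih => rw [pow_succ', linear_mul, linear_mul, h.isometry, ih]

theorem norm_three (o u v : R21) (e f : ℝ) :
    ‖o + e • u + f • v‖ ≤ ‖o‖ + |e| * ‖u‖ + |f| * ‖v‖ := by
  refine (norm_add_le _ _).trans (add_le_add ((norm_add_le _ _).trans (add_le_add le_rfl ?_)) ?_)
  · rw [norm_smul, Real.norm_eq_abs]
  · rw [norm_smul, Real.norm_eq_abs]

/-- Two elements of a properly discontinuous group whose axes have invariants of opposite signs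
have proportional contracting directions (the second element being inverted). -/
theorem opposite_sign_aux {Γ : Subgroup Aff} (hΓ : ActsProperlyDiscontinuously Γ)
    {a d : Aff} (ha : a ∈ Γ) (hd : d ∈ Γ) (hda : IsSO21o a.linear)
    {l s l' s' : ℝ} {y yp oa x xp od : R21} (haa : IsAxis a l s yp y oa)
    (had : IsAxis d l' s' xp x od) (hs : s < 0) (hs' : 0 < s') : lorentz x y = 0 := by
  by_contra hxy
  have hxy' : lorentz x y < 0 := lt_of_le_of_ne (had.nfm.lorentz_nonpos haa.nfm) hxy
  obtain ⟨q, hq⟩ := cross_mod (y := x) haa.nfm haa.lorentz_ne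
  obtain ⟨q', hq'⟩ := cross_mod (y := y) had.nfm had.lorentz_ne
  set k := lorentz x y / lorentz yp y with hk
  set k' := lorentz y x / lorentz xp x with hk'
  have hkpos : 0 < k := div_pos_of_neg_of_neg hxy'
    (lt_of_le_of_ne (haa.nfp.lorentz_nonpos haa.nfm) haa.lorentz_ne)
  have hkpos' : 0 < k' := div_pos_of_neg_of_neg (by rwa [lorentz_comm])
    (lt_of_le_of_ne (had.nfp.lorentz_nonpos had.nfm) had.lorentz_ne)
  have hswap : ∀ u v : R21, cross u v = -cross v u := fun u v => by
    apply ext3 <;> simp <;> ring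
  -- the line of intersection of the two null planes
  obtain ⟨e, f, e', f', o, ho, ho'⟩ : ∃ (e f e' f' : ℝ) (o : R21),
      o = oa + e • cross y yp + f • y ∧ o = od + e' • cross x xp + f' • x := by
    have h := cross_decomp had.nfm.1 haa.nfm.1 (od - oa)
    have h' := congrArg (fun z => (lorentz x y ^ 2)⁻¹ • z) h
    simp only [smul_smul, smul_add] at h'
    rw [inv_mul_cancel₀ (pow_ne_zero 2 hxy), one_smul] at h'
    set c1 := (lorentz x y ^ 2)⁻¹ * lorentz (cross y x) (od - oa)
    set c2 := (lorentz x y ^ 2)⁻¹ * (lorentz x y * lorentz (od - oa) y)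
    set c3 := (lorentz x y ^ 2)⁻¹ * (lorentz x y * lorentz (od - oa) x)
    have e1 : od = oa + (c1 • cross y x + c2 • x + c3 • y) := by rw [← h']; abel
    refine ⟨c1 * k, c3 - c1 * q, 0, -c2, od - c2 • x, ?_, by module⟩
    rw [e1, hswap y x, hq, hswap y yp]
    module
  have hlineA : ∀ r : ℝ, o + r • cross y x
      = oa + (e + r * k) • cross y yp + (f - r * q) • y := by
    intro r
    rw [ho, hswap y x, hq, hswap y yp]
    module
  have hlineD : ∀ r : ℝ, o + r • cross y x
      = od + (e' - r * k') • cross x xp + (f' + r * q') • x := by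
    intro r
    rw [ho', hq', hswap x xp]
    module
  -- `c` is the ratio at which the drifts of `a` and `d` along the common line compensate. The
  -- powers `d ^ n` and `a ^ m n` both bring `P n` back to a bounded set, because `s` and `s'` have
  -- opposite signs.
  set c := s' / k' * k / (-s) with hc
  have hcpos : 0 < c := by
    rw [hc]; exact div_pos (mul_pos (div_pos hs' hkpos') hkpos) (by linarith)
  set m : ℕ → ℕ := fun n => ⌊c * n⌋₊ with hm
  have hm1 : ∀ n, (m n : ℝ) ≤ c * n := fun n => Nat.floor_le (by positivity)
  have hm2 : ∀ n, c * n < m n + 1 := fun n => Nat.lt_floor_add_one _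
  set P : ℕ → R21 := fun n => o + (n * s' / k') • cross y x with hP
  have hPd : ∀ n : ℕ, (d ^ n) (P n) =
      od + e' • cross x xp + (l'⁻¹ ^ n * (f' + (n * s' / k') * q')) • x := by
    intro n
    rw [hP]
    simp only
    rw [hlineD, had.pow_apply]
    congr 3
    field_simp
    ring
  have hPa : ∀ n : ℕ, (a ^ m n) (P n) = oa + (e + (n * s' / k') * k + m n * s) • cross y yp
      + (l⁻¹ ^ m n * (f - (n * s' / k') * q)) • y := by
    intro n
    rw [hP]
    simp only
    rw [hlineA, haa.pow_apply]
  obtain ⟨M', hM'⟩ := exists_bound_geom had.one_lt (|f'|) (s' / k' * |q'|)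
  obtain ⟨M, hM⟩ := exists_bound_geom haa.one_lt (|f| + s' / k' * |q| / c) (s' / k' * |q| / c)
  set R := max (‖od‖ + |e'| * ‖cross x xp‖ + M' * ‖x‖)
    (‖oa‖ + (|e| + (-s)) * ‖cross y yp‖ + M * ‖y‖) with hR
  have hl'0 : 0 < l' := by linarith [had.one_lt]
  have hl0 : 0 < l := by linarith [haa.one_lt]
  have bd : ∀ n : ℕ, (d ^ n) (P n) ∈ Metric.closedBall (0 : R21) R := by
    intro n
    rw [mem_closedBall_zero_iff, hPd]
    refine (norm_three _ _ _ _ _).trans (le_trans ?_ (le_max_left _ _))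
    gcongr
    rw [abs_mul, abs_of_pos (by positivity : 0 < l'⁻¹ ^ n)]
    refine le_trans ?_ (hM' n)
    gcongr
    refine (abs_add_le _ _).trans (add_le_add le_rfl (le_of_eq ?_))
    rw [abs_mul, abs_of_nonneg (by positivity)]
    ring
  have ba : ∀ n : ℕ, (a ^ m n) (P n) ∈ Metric.closedBall (0 : R21) R := by
    intro n
    rw [mem_closedBall_zero_iff, hPa]
    refine (norm_three _ _ _ _ _).trans (le_trans ?_ (le_max_right _ _))
    have e1 : (n * s' / k') * k = c * n * (-s) := by
      have hs0 := hs.ne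
      rw [hc]; field_simp
    gcongr
    · rw [add_assoc]
      refine (abs_add_le _ _).trans (add_le_add le_rfl ?_)
      rw [e1, abs_le]
      constructor <;> nlinarith [hm1 n, hm2 n]
    · rw [abs_mul, abs_of_pos (by positivity : 0 < l⁻¹ ^ m n)]
      refine le_trans ?_ (hM (m n))
      gcongr
      refine (abs_sub _ _).trans ?_
      rw [add_assoc]
      refine add_le_add le_rfl ?_
      rw [abs_mul, abs_of_nonneg (by positivity)]
      have : (n : ℝ) ≤ (m n + 1) / c := by
        rw [le_div_iff₀ hcpos]; linarith [hm2 n]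
      calc (n : ℝ) * s' / k' * |q| = n * (s' / k' * |q|) := by ring
        _ ≤ ((m n + 1) / c) * (s' / k' * |q|) := by gcongr
        _ = _ := by ring
  have hfin := hΓ (Metric.closedBall (0 : R21) R) (isCompact_closedBall _ _)
  set g : ℕ → Aff := fun n => a ^ m n * (d ^ n)⁻¹ with hg
  have hmem : ∀ n, g n ∈ {g : Aff | g ∈ Γ ∧ (g '' Metric.closedBall (0 : R21) R ∩
      Metric.closedBall (0 : R21) R).Nonempty} := by
    intro n
    refine ⟨Γ.mul_mem (Γ.pow_mem ha _) (Γ.inv_mem (Γ.pow_mem hd _)), (a ^ m n) (P n),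
      ⟨(d ^ n) (P n), bd n, ?_⟩, ba n⟩
    rw [hg]
    simp only
    rw [aff_mul, aff_inv]
  -- The elements `g n` all return one ball to itself, hence form a finite set; this pairing is
  -- unbounded along them.
  have hval : ∀ n, lorentz ((g n).linear x) y = l ^ m n * l' ^ n * lorentz x y := by
    intro n
    have e1 : ((d ^ n)⁻¹).linear x = l' ^ n • x := by
      rw [linear_inv, LinearEquiv.symm_apply_eq, map_smul, had.pow_linear, smul_smul, ← mul_pow,
        mul_inv_cancel₀ hl'0.ne', one_pow, one_smul]
    have e2 : y = l ^ m n • (a ^ m n).linear y := by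
      rw [haa.pow_linear, smul_smul, ← mul_pow, mul_inv_cancel₀ hl0.ne', one_pow, one_smul]
    rw [hg]
    simp only
    rw [linear_mul, e1]
    conv_lhs => rw [e2]
    rw [lorentz_smul_right, map_smul, lorentz_smul_left, aff_pow_isometry hda]
    ring
  obtain ⟨B, hB⟩ := (hfin.image (fun g : Aff => lorentz (g.linear x) y)).bddBelow
  obtain ⟨n, hn⟩ := ((tendsto_pow_atTop_atTop_of_one_lt had.one_lt).eventually_gt_atTop
    (B / lorentz x y)).exists
  have h1 := hB ⟨g n, hmem n, rfl⟩
  simp only [hval] at h1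
  rw [div_lt_iff_of_neg hxy'] at hn
  have h2 : 1 ≤ l ^ m n := one_le_pow₀ haa.one_lt.le
  have h3 : l' ^ n * lorentz x y < 0 := mul_neg_of_pos_of_neg (by positivity) hxy'
  nlinarith

/-! ### The linear holonomy fixes no null line -/

/-- Two generators can be sent to a five-cycle and an adjacent transposition, so the group surjects
onto the symmetric group on five letters. -/
theorem not_isSolvable_freeGroup {n : ℕ} (hn : 2 ≤ n) : ¬ Group.IsSolvable (FreeGroup (Fin n)) := by
  intro h
  let σ : Equiv.Perm (Fin 5) := finRotate 5
  let f : FreeGroup (Fin n) →* Equiv.Perm (Fin 5) :=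
    FreeGroup.lift fun i => if (i : ℕ) = 0 then σ else Equiv.swap 0 (σ 0)
  have hf : Function.Surjective f := by
    rw [← MonoidHom.range_eq_top, eq_top_iff,
      ← Equiv.Perm.closure_cycle_adjacent_swap (σ := σ) isCycle_finRotate support_finRotate 0,
      Subgroup.closure_le]
    rintro x (rfl | rfl)
    · exact ⟨FreeGroup.of ⟨0, by omega⟩, by simp [f]⟩
    · exact ⟨FreeGroup.of ⟨1, by omega⟩, by simp [f]⟩
  have := Group.isSolvable_of_surjective hf
  exact Equiv.Perm.not_isSolvable (Fin 5) (by simp) this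

theorem exists_NF_not_parallel {x : R21} (hx : IsNF x) : ∃ y, IsNF y ∧ lorentz x y ≠ 0 := by
  refine ⟨![-x 0, -x 1, x 2], ⟨?_, hx.2⟩, ?_⟩
  · have := hx.1
    simp only [lorentz] at this ⊢
    simp; linarith
  · have h1 := hx.1
    have h2 := hx.2
    simp only [lorentz] at h1 ⊢
    simp
    nlinarith

/-- A group of isometries that preserves a null line is solvable. -/
theorem isSolvable_of_fixed_line {Γ : Subgroup Aff} (hΓ : ∀ g ∈ Γ, IsSO21o g.linear)
    {x : R21} (hx : IsNF x) (h : ∀ g ∈ Γ, lorentz (g.linear x) x = 0) : Group.IsSolvable Γ := by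
  have hpar : ∀ g : Γ, ∃ c : ℝ, 0 < c ∧ (g : Aff).linear x = c • x := fun g =>
    ((hΓ g g.2).isNF hx).parallel hx (h g g.2)
  choose χ hχ0 hχ using hpar
  have hinj : ∀ a b : ℝ, a • x = b • x → a = b := fun a b hab =>
    smul_left_injective ℝ hx.ne_zero hab
  let χ' : Γ →* ℝˣ :=
    { toFun := fun g => Units.mk0 (χ g) (hχ0 g).ne'
      map_one' := by
        ext
        apply hinj
        simp only [Units.val_mk0, Units.val_one, one_smul]
        exact (hχ 1).symm
      map_mul' := by
        intro g g'
        ext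
        apply hinj
        simp only [Units.val_mk0, Units.val_mul]
        rw [← hχ, Subgroup.coe_mul, linear_mul, hχ, map_smul, hχ, smul_smul, mul_comm] }
  obtain ⟨y, hy, hxy⟩ := exists_NF_not_parallel hx
  have hfix : ∀ g : χ'.ker, ((g : Γ) : Aff).linear x = x := by
    intro g
    have := g.2
    rw [MonoidHom.mem_ker] at this
    have h1 : χ g = 1 := congrArg Units.val this
    rw [hχ, h1, one_smul]
  have hB : ∀ (g : χ'.ker) (z : R21), lorentz x (((g : Γ) : Aff).linear z) = lorentz x z := by
    intro g z
    conv_lhs => rw [← hfix g]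
    exact (hΓ _ (g : Γ).2).isometry x z
  -- the translation number along the horocycles
  let τ : χ'.ker →* Multiplicative ℝ :=
    { toFun := fun g => Multiplicative.ofAdd (det3 x (((g : Γ) : Aff).linear y) y / lorentz x y)
      map_one' := by
        have : det3 x y y = 0 := by simp [det3]; ring
        change Multiplicative.ofAdd (det3 x y y / lorentz x y) = 1
        rw [this, zero_div, ofAdd_zero]
      map_mul' := by
        intro g g'
        rw [← ofAdd_add]
        congr 1
        have e1 : det3 x ((((g * g' : χ'.ker) : Γ) : Aff).linear y) y
          = det3 x (((g : Γ) : Aff).linear (((g' : Γ) : Aff).linear y)) y := rfl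
        rw [e1]
        set G := ((g : Γ) : Aff).linear with hG
        set G' := ((g' : Γ) : Aff).linear
        have p := plucker hx.1 (G (G' y)) (G y) y
        have e2 : det3 x (G (G' y)) (G y) = det3 x (G' y) y := by
          conv_lhs => rw [← hfix g]
          exact (hΓ _ (g : Γ).2).det3 x (G' y) y
        rw [hB, hB, hB, e2] at p
        field_simp
        field_simp at p
        linarith }
  -- What is left after the multiplier and the horocyclic translation number consists of pure
  -- translations.
  have hcomm : ∀ a b : τ.ker, a * b = b * a := by
    have hlin : ∀ a : τ.ker, ∀ z, (((a : χ'.ker) : Γ) : Aff).linear z = z := by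
      intro a
      set A := (((a : χ'.ker) : Γ) : Aff).linear with hA
      have hAs : IsSO21o A := hΓ _ ((a : χ'.ker) : Γ).2
      have h1 := a.2
      rw [MonoidHom.mem_ker] at h1
      have h2 : det3 x (A y) y / lorentz x y = 0 := h1
      have h3 : det3 x (A y) y = 0 := by
        rcases div_eq_zero_iff.mp h2 with h | h
        · exact h
        · exact absurd h hxy
      have hyA : lorentz (A y) y = 0 := by
        by_contra hne
        exact hx.det3_ne_zero (hAs.isNF hy) hy (by rw [hB]; exact hxy) hne hxy h3
      obtain ⟨c, hc, hcy⟩ := (hAs.isNF hy).parallel hy hyA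
      have hc1 : c = 1 := by
        have := hB a y
        rw [← hA, hcy, lorentz_smul_right] at this
        exact mul_right_cancel₀ hxy (by rw [this, one_mul])
      rw [hc1, one_smul] at hcy
      have hAx : A x = x := hfix a
      have hAn : A (cross y x) = cross y x := by rw [hAs.cross, hcy, hAx]
      intro z
      have hd := cross_decomp hx.1 hy.1 z
      have := congrArg A hd
      rw [map_smul, map_add, map_add, map_smul, map_smul, map_smul, hAn, hAx, hcy, ← hd] at this
      exact smul_right_injective _ (pow_ne_zero 2 hxy) this
    intro a b
    apply Subtype.ext; apply Subtype.ext; apply Subtype.ext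
    apply AffineEquiv.ext
    intro z
    change (((a : χ'.ker) : Γ) : Aff) ((((b : χ'.ker) : Γ) : Aff) z)
      = (((b : χ'.ker) : Γ) : Aff) ((((a : χ'.ker) : Γ) : Aff) z)
    rw [aff_apply _ z, aff_apply (((a : χ'.ker) : Γ) : Aff) z, hlin, hlin, aff_apply_add,
      aff_apply_add, hlin, hlin, aff_apply _ z, aff_apply _ z, hlin, hlin]
    abel
  have s2 : Group.IsSolvable τ.ker := Group.isSolvable_of_comm hcomm
  have s1 : Group.IsSolvable χ'.ker :=
    Group.isSolvable_of_ker_le_range τ.ker.subtype τ (by rw [Subgroup.range_subtype])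
  exact Group.isSolvable_of_ker_le_range χ'.ker.subtype χ' (by rw [Subgroup.range_subtype])

/-- The linear holonomy of a Margulis space-time fixes no null line. -/
theorem IsMargulisHolonomy.exists_moved {Γ : Subgroup Aff} (h : IsMargulisHolonomy Γ)
    {x : R21} (hx : IsNF x) : ∃ g ∈ Γ, lorentz (g.linear x) x ≠ 0 := by
  by_contra! hall
  have hs := isSolvable_of_fixed_line h.linear_mem hx hall
  obtain ⟨n, hn, ⟨e⟩⟩ := h.free
  exact not_isSolvable_freeGroup hn (Group.isSolvable_of_surjective (f := e.toMonoidHom) e.surjective)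

theorem IsAxis.conj {g : Aff} {l s : ℝ} {xp xm o : R21} (ha : IsAxis g l s xp xm o) {h : Aff}
    (hh : IsSO21o h.linear) :
    IsAxis (h * g * h⁻¹) l s (h.linear xp) (h.linear xm) (h o) := by
  have hl : ∀ x, (h * g * h⁻¹).linear (h.linear x) = h.linear (g.linear x) := by
    intro x
    rw [linear_mul, linear_mul, linear_inv, LinearEquiv.symm_apply_apply]
  refine ⟨ha.one_lt, hh.isNF ha.nfp, hh.isNF ha.nfm, ?_, ?_, ?_, ?_⟩
  · rw [hl, ha.map_p, map_smul]
  · rw [hl, ha.map_m, map_smul]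
  · rw [← hh.cross, hl, ha.map_n]
  · rw [aff_mul, aff_mul, aff_inv, ha.map_o, aff_apply_add, map_smul, hh.cross]

/-- Margulis's opposite sign lemma. -/
theorem IsMargulisHolonomy.inv_nonneg {Γ : Subgroup Aff} (h : IsMargulisHolonomy Γ)
    {c : Aff} (hc : c ∈ Γ) (hch : IsHyperbolic c.linear) (hcp : 0 < inv c)
    {a : Aff} (ha : a ∈ Γ) (hah : IsHyperbolic a.linear) : 0 ≤ inv a := by
  by_contra hneg
  obtain ⟨l, s, yp, y, oa, haa, k, hk, hka⟩ := exists_axis (h.linear_mem a ha) hah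
  obtain ⟨l', s', xp, x, oc, hac, k', hk', hkc⟩ := exists_axis (h.linear_mem c hc) hch
  have hs : s < 0 := by
    by_contra h1
    apply hneg; rw [hka]; exact mul_nonneg hk.le (not_lt.mp h1)
  have hs' : 0 < s' := by
    by_contra h1
    rw [hkc] at hcp
    nlinarith [not_lt.mp h1]
  have key : ∀ g ∈ Γ, lorentz (g.linear xp) y = 0 := by
    intro g hg
    have hax := (hac.conj (h.linear_mem g hg)).inv_apply
    exact opposite_sign_aux h.proper ha (Γ.inv_mem (Γ.mul_mem (Γ.mul_mem hg hc) (Γ.inv_mem hg)))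
      (h.linear_mem a ha) haa hax hs hs'
  obtain ⟨e, he, hxe⟩ := hac.nfp.parallel haa.nfm (key 1 Γ.one_mem)
  have hxe' : xp = e • y := hxe
  obtain ⟨g, hg, hgy⟩ := h.exists_moved haa.nfm
  apply hgy
  have := key g hg
  rw [hxe', map_smul, lorentz_smul_left] at this
  exact (mul_eq_zero.mp this).resolve_left he.ne'

/-! ### Positivity of the invariant, and parabolic elements -/

theorem exists_smul_of_cross_eq_zero {a v : R21} (hv : v ≠ 0) (h : cross a v = 0) :
    ∃ k : ℝ, a = k • v := by
  have h0 := congrFun h 0; have h1 := congrFun h 1; have h2 := congrFun h 2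
  simp only [cross_zero, cross_one, cross_two, Pi.zero_apply] at h0 h1 h2
  obtain ⟨i, hi⟩ := Function.ne_iff.mp hv
  refine ⟨a i / v i, ?_⟩
  rw [Pi.zero_apply] at hi
  fin_cases i <;> simp only [Fin.zero_eta, Fin.mk_one, Fin.reduceFinMk] at hi ⊢ <;>
    apply ext3 <;> simp only [Pi.smul_apply, smul_eq_mul] <;> field_simp <;> linarith

/-- The adjoint of an isometry is its inverse, so its skew part is `A - A.symm`. -/
theorem IsSO21o.cross_axial {A : R21 ≃ₗ[ℝ] R21} (hA : IsSO21o A) (x : R21) :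
    Margulis.cross (axial (A : R21 →ₗ[ℝ] R21)) x = A x - A.symm x := by
  apply eq_of_lorentz
  intro y
  rw [lorentz_cross, det3_axial, lorentz_sub_left, hA.lorentz_symm]
  rfl

/-- The unipotent isometries, in terms of their axial vector. -/
theorem IsSO21o.parabolic_form {A : R21 ≃ₗ[ℝ] R21} (hA : IsSO21o A) (h : IsParabolic A) :
    ∃ p : R21, p ≠ 0 ∧ lorentz p p = 0 ∧ (2 : ℝ) • p = axial (A : R21 →ₗ[ℝ] R21) ∧
      ∀ x, A x = x + Margulis.cross p x - (lorentz p x / 2) • p := by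
  set p : R21 := (1 / 2 : ℝ) • axial (A : R21 →ₗ[ℝ] R21) with hp
  obtain ⟨⟨x₀, hx₀⟩, h3⟩ := h
  have hU : ∀ x, A (A (A x)) = (3 : ℝ) • A (A x) - (3 : ℝ) • A x + x := by
    intro x
    have := LinearMap.congr_fun h3 x
    simp only [pow_succ, pow_zero, one_mul, Module.End.mul_apply, LinearMap.sub_apply,
      LinearEquiv.coe_coe, LinearMap.id_apply, LinearMap.zero_apply, map_sub] at this
    rw [← sub_eq_zero, ← this]
    module
  have hsymm : ∀ x, A.symm x = A (A x) - (3 : ℝ) • A x + (3 : ℝ) • x := by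
    intro x
    rw [LinearEquiv.symm_apply_eq]
    simp only [map_add, map_sub, map_smul]
    rw [hU]; module
  -- The right side is the logarithm of `A`: for unipotent `A` of this order, half of `A - A.symm`
  -- is already the logarithm. So `A` is the exponential of `cross p`.
  have hN : ∀ x, Margulis.cross p x = (2 : ℝ) • A x - (1 / 2 : ℝ) • A (A x) - (3 / 2 : ℝ) • x := by
    intro x
    have e : Margulis.cross p x = (1 / 2 : ℝ) • Margulis.cross (axial (A : R21 →ₗ[ℝ] R21)) x := by
      apply ext3 <;> simp [hp] <;> ring
    rw [e, hA.cross_axial, hsymm]; module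
  have hNN : ∀ x, Margulis.cross p (Margulis.cross p x) = A (A x) - (2 : ℝ) • A x + x := by
    intro x
    rw [hN (Margulis.cross p x), hN x]
    simp only [map_sub, map_smul]
    rw [hU x]
    simp only [map_sub, map_smul, map_add]
    rw [hU x]
    module
  have hA' : ∀ x, A x = x + Margulis.cross p x
      + (1 / 2 : ℝ) • Margulis.cross p (Margulis.cross p x) := by
    intro x
    rw [hNN, hN]; module
  -- The cube of `cross p` vanishes, but it equals `lorentz p p` times `cross p`; if `p` were not
  -- null, `A` would be the identity.
  have hnull : lorentz p p = 0 := by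
    by_contra hne
    apply hx₀
    have e1 : Margulis.cross p (Margulis.cross p (Margulis.cross p x₀)) = 0 := by
      rw [hNN x₀, hN]
      simp only [map_sub, map_smul, map_add]
      rw [hU x₀]
      simp only [map_sub, map_smul, map_add]
      rw [hU x₀]
      module
    have e2 : Margulis.cross p p = 0 := by apply ext3 <;> simp <;> ring
    have e3 : Margulis.cross p x₀ = 0 := by
      rw [cross_cross] at e1
      have e4 : lorentz p (Margulis.cross p x₀) = 0 := by simp [lorentz]; ring
      rw [e4, zero_smul, sub_zero] at e1
      exact (smul_eq_zero.mp e1).resolve_left hne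
    rw [hA', e3]
    have : Margulis.cross p 0 = 0 := by apply ext3 <;> simp
    rw [this]; simp
  refine ⟨p, ?_, hnull, ?_, ?_⟩
  · intro h0
    apply hx₀
    rw [hA', h0]
    apply ext3 <;> simp
  · rw [hp, smul_smul]; norm_num
  · intro x
    rw [hA', cross_cross, hnull]; module

theorem not_involutive_of_hyperbolic_or_parabolic {A : R21 ≃ₗ[ℝ] R21}
    (h : IsHyperbolic A ∨ IsParabolic A) (hinv : ∀ x, A (A x) = x) : False := by
  rcases h with ⟨c, hc, x, hx0, hx⟩ | ⟨⟨x, hx⟩, h3⟩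
  · have := hinv x
    rw [hx, map_smul, hx, smul_smul] at this
    have h1 : (c * c - 1) • x = 0 := by rw [sub_smul, this, one_smul, sub_self]
    rcases smul_eq_zero.mp h1 with h | h
    · nlinarith
    · exact hx0 h
  · have := LinearMap.congr_fun h3 x
    simp only [pow_succ, pow_zero, one_mul, Module.End.mul_apply, LinearMap.sub_apply,
      LinearEquiv.coe_coe, LinearMap.id_apply, LinearMap.zero_apply, map_sub, hinv] at this
    apply hx
    have h4 : (4 : ℝ) • (A x - x) = 0 := by rw [← this]; module
    exact sub_eq_zero.mp ((smul_eq_zero.mp h4).resolve_left (by norm_num))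

theorem IsSO21o.eq_of_eigen {A : R21 ≃ₗ[ℝ] R21} (hA : IsSO21o A) {x : R21} (hx : IsTF x)
    (h : ∃ c : ℝ, A x = c • x) : A x = x := by
  obtain ⟨c, hc⟩ := h
  have h1 := hA.isometry x x
  rw [hc, lorentz_smul_left, lorentz_smul_right] at h1
  have h2 := (hA.isTF hx).2
  rw [hc, Pi.smul_apply, smul_eq_mul] at h2
  have h3 : 0 < c := by
    by_contra h; nlinarith [hx.2, not_lt.mp h]
  have h4 : (c * c - 1) * lorentz x x = 0 := by linarith
  have h5 : c * c - 1 = 0 := (mul_eq_zero.mp h4).resolve_right hx.1.ne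
  have h6 : c = 1 := by nlinarith
  rw [hc, h6, one_smul]

/-- The axial vector is a multiple of the positive fixed vector. The factor is positive because
`det3 (axial A) x (A x)` is nonnegative on time-like vectors, by the reverse Cauchy–Schwarz
inequality for `x` and `A (A x)`. -/
theorem inv_pos_of_hasPositiveInvariant {g : Aff} (hg : IsSO21o g.linear)
    (h : HasPositiveInvariant g) : 0 < inv g := by
  obtain ⟨hty, v, ⟨hv0, hvf, hv⟩, hpos⟩ := h
  set A := g.linear with hA
  set a := axial (A : R21 →ₗ[ℝ] R21) with ha
  have hcr : cross a v = 0 := by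
    rw [hg.cross_axial, hvf]
    have : A.symm v = v := by rw [LinearEquiv.symm_apply_eq, hvf]
    rw [this, sub_self]
  obtain ⟨k, hk⟩ := exists_smul_of_cross_eq_zero hv0 hcr
  have ha0 : a ≠ 0 := by
    intro h0
    apply not_involutive_of_hyperbolic_or_parabolic hty
    intro x
    have := hg.cross_axial x
    rw [← ha, h0] at this
    have hz : cross 0 x = 0 := by apply ext3 <;> simp
    rw [hz] at this
    rw [sub_eq_zero.mp this.symm, LinearEquiv.apply_symm_apply]
  obtain ⟨x, hx, hxe⟩ : ∃ x, IsTF x ∧ ¬ ∃ c : ℝ, A x = c • x := by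
    by_contra! hall
    have h2 := hg.eq_of_eigen isTF_bv (hall _ isTF_bv)
    have t0 : IsTF (bv 2 + (1 / 2 : ℝ) • bv 0) := by
      constructor <;> simp [lorentz, bv]; norm_num
    have t1 : IsTF (bv 2 + (1 / 2 : ℝ) • bv 1) := by
      constructor <;> simp [lorentz, bv]; norm_num
    have h0 := hg.eq_of_eigen t0 (hall _ t0)
    have h1 := hg.eq_of_eigen t1 (hall _ t1)
    rw [map_add, map_smul, h2] at h0 h1
    have h0' := smul_right_injective R21 (by norm_num : (1 / 2 : ℝ) ≠ 0) (add_left_cancel h0)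
    have h1' := smul_right_injective R21 (by norm_num : (1 / 2 : ℝ) ≠ 0) (add_left_cancel h1)
    apply ha0
    rw [ha]
    apply ext3 <;> simp [axial, h0', h1', h2] <;> simp [bv]
  have h1 : 0 ≤ det3 a x (A x) := by
    rw [ha, det3_axial]
    simp only [LinearEquiv.coe_coe]
    rw [hg.isometry]
    have := hx.lorentz_le (hg.isTF (hg.isTF hx)) (by rw [hg.isometry, hg.isometry])
    linarith
  have h2 := hv x hx.1.le hxe
  rw [det_of] at h2
  have h3 : det3 a x (A x) = k * det3 v x (A x) := by rw [hk]; simp [det3]; ring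
  rw [h3] at h1
  have hk0 : 0 ≤ k := by
    by_contra hneg
    nlinarith [not_le.mp hneg]
  have hk1 : k ≠ 0 := by
    rintro rfl
    exact ha0 (by rw [hk, zero_smul])
  have h4 := hpos 0
  rw [sub_zero, lorentz_comm] at h4
  have : inv g = k * lorentz v (g 0) := by
    rw [inv, kap, ← hA, ← ha, hk, lorentz_smul_left]
  rw [this]
  exact mul_pos (lt_of_le_of_ne hk0 (Ne.symm hk1)) h4

/-! ### Products with large powers of a parabolic element -/

theorem eventually_quartic_pos {c4 : ℝ} (h : 0 < c4) (c3 c2 c1 c0 : ℝ) :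
    ∀ᶠ n : ℕ in atTop,
      0 < c4 * (n : ℝ) ^ 4 + c3 * (n : ℝ) ^ 3 + c2 * (n : ℝ) ^ 2 + c1 * n + c0 := by
  filter_upwards [eventually_ge_atTop 1, eventually_gt_atTop
    ⌈(|c3| + |c2| + |c1| + |c0|) / c4⌉₊] with n h1 h2
  have hn : (1 : ℝ) ≤ n := by exact_mod_cast h1
  have h3 : (|c3| + |c2| + |c1| + |c0|) / c4 < n := lt_of_le_of_lt (Nat.le_ceil _)
    (by exact_mod_cast h2)
  rw [div_lt_iff₀ h] at h3
  have p3 : (1 : ℝ) ≤ (n : ℝ) ^ 3 := one_le_pow₀ hn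
  have p2 : (n : ℝ) ^ 2 ≤ (n : ℝ) ^ 3 := pow_le_pow_right₀ hn (by norm_num)
  have p1 : (n : ℝ) ≤ (n : ℝ) ^ 3 := le_self_pow₀ hn (by norm_num)
  have q3 : -|c3| * (n : ℝ) ^ 3 ≤ c3 * (n : ℝ) ^ 3 := by
    gcongr; exact neg_abs_le c3
  have q2 : -|c2| * (n : ℝ) ^ 3 ≤ c2 * (n : ℝ) ^ 2 := by
    nlinarith [neg_abs_le c2, abs_nonneg c2, sq_nonneg (n : ℝ)]
  have q1 : -|c1| * (n : ℝ) ^ 3 ≤ c1 * (n : ℝ) := by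
    nlinarith [neg_abs_le c1, abs_nonneg c1]
  have q0 : -|c0| * (n : ℝ) ^ 3 ≤ c0 := by
    nlinarith [neg_abs_le c0, abs_nonneg c0]
  have : (|c3| + |c2| + |c1| + |c0|) * (n : ℝ) ^ 3 < (n * c4) * (n : ℝ) ^ 3 := by
    gcongr
  nlinarith

theorem pow_linear_parabolic {c : Aff} {p : R21} (hp : lorentz p p = 0)
    (hc : ∀ x, c.linear x = x + cross p x - (lorentz p x / 2) • p) (n : ℕ) (x : R21) :
    (c ^ n).linear x = x + (n : ℝ) • cross p x - ((n : ℝ) ^ 2 / 2 * lorentz p x) • p := by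
  induction n with
  | zero => simp; rfl
  | succ n ih =>
    have hpp : c.linear p = p := by
      rw [hc, hp]
      have : cross p p = 0 := by apply ext3 <;> simp <;> ring
      rw [this]; simp
    have h1 : c.linear (cross p x) = cross p x - lorentz p x • p := by
      rw [hc, cross_cross, hp]
      have : lorentz p (cross p x) = 0 := by simp [lorentz]; ring
      rw [this]; module
    rw [pow_succ', linear_mul, ih, map_sub, map_add, map_smul, map_smul, hpp, h1, hc x]
    push_cast
    module

/-- `c` is the time one map of the affine vector field `x ↦ cross p x + b`. The formula for `b`
inverts `(exp N - 1) / N` on `c 0`, where `N` is `cross p`; the coefficients 1/2 and 1/12 are those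
of that series. -/
theorem pow_zero_parabolic {c : Aff} {p : R21} (hp : lorentz p p = 0)
    (hc : ∀ x, c.linear x = x + cross p x - (lorentz p x / 2) • p) {b : R21}
    (hb : b = c 0 - (1 / 2 : ℝ) • cross p (c 0) - (lorentz p (c 0) / 12) • p) (n : ℕ) :
    (c ^ n) 0 = (n : ℝ) • b + ((n : ℝ) ^ 2 / 2) • cross p b
      - ((n : ℝ) ^ 3 / 6 * lorentz p b) • p := by
  have hpp : cross p p = 0 := by apply ext3 <;> simp <;> ring
  have hpc : lorentz p (cross p (c 0)) = 0 := by simp [lorentz]; ring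
  have hpb : lorentz p b = lorentz p (c 0) := by
    rw [hb]; simp only [lorentz_sub_right, lorentz_smul_right, hp, hpc]; ring
  have hcb : cross p b = cross p (c 0) + (lorentz p (c 0) / 2) • p := by
    have e : cross p b = cross p (c 0) - (1 / 2 : ℝ) • cross p (cross p (c 0))
      - (lorentz p (c 0) / 12) • cross p p := by
      rw [hb]; apply ext3 <;> simp <;> ring
    rw [e, hpp, cross_cross, hp]; module
  have hb' : c 0 = b + (1 / 2 : ℝ) • cross p b - (lorentz p b / 6) • p := by
    rw [hcb, hpb, hb]; module
  have hlp : c.linear p = p := by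
    rw [hc, hp, hpp]; simp
  have h1 : c.linear (cross p b) = cross p b - lorentz p b • p := by
    rw [hc, cross_cross, hp]
    have : lorentz p (cross p b) = 0 := by simp [lorentz]; ring
    rw [this]; module
  induction n with
  | zero => simp
  | succ n ih =>
    rw [pow_succ', aff_mul, ih, aff_apply, map_sub, map_add, map_smul, map_smul, map_smul, hlp, h1,
      hc b, hb']
    push_cast
    module

theorem kap_add_left (S T : R21 →ₗ[ℝ] R21) (u : R21) : kap (S + T) u = kap S u + kap T u := by
  simp [kap, axial, lorentz]; ring
theorem kap_smul_left (t : ℝ) (T : R21 →ₗ[ℝ] R21) (u : R21) : kap (t • T) u = t * kap T u := by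
  simp [kap, axial, lorentz]; ring
theorem kap_add_right (T : R21 →ₗ[ℝ] R21) (u v : R21) : kap T (u + v) = kap T u + kap T v :=
  lorentz_add_right _ _ _
theorem kap_smul_right (t : ℝ) (T : R21 →ₗ[ℝ] R21) (u : R21) : kap T (t • u) = t * kap T u :=
  lorentz_smul_right _ _ _

/-- The cross product by a vector, as a linear map. -/
def crossL (p : R21) : R21 →ₗ[ℝ] R21 where
  toFun := cross p
  map_add' x y := by apply ext3 <;> simp <;> ring
  map_smul' t x := by apply ext3 <;> simp <;> ring

/-- The rank one map `x ↦ lorentz x r • q`. -/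
def rankOne (q r : R21) : R21 →ₗ[ℝ] R21 where
  toFun x := lorentz x r • q
  map_add' x y := by rw [lorentz_add_left, add_smul]
  map_smul' t x := by rw [lorentz_smul_left, mul_smul]; rfl

theorem kap_crossL_comp {p : R21} (hp : lorentz p p = 0) (T : R21 →ₗ[ℝ] R21) :
    kap (crossL p ∘ₗ T) p = -lorentz p (T p) := by
  simp only [lorentz] at hp
  simp only [kap, axial, lorentz, crossL, LinearMap.comp_apply, LinearMap.coe_mk, AddHom.coe_mk,
    map_apply3 T p, cross_zero, cross_one, cross_two, Matrix.cons_val_zero, Matrix.cons_val_one,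
    Matrix.cons_val]
  linear_combination (T (bv 0) 0 + T (bv 1) 1 + T (bv 2) 2) * hp

/-- If `c` is parabolic with positive invariant and `h` moves its fixed line, then `h c ^ n` is
hyperbolic with positive invariant for `n` large. -/
theorem exists_hyperbolic_pos_of_parabolic {Γ : Subgroup Aff} (hΓ : IsMargulisHolonomy Γ)
    {c : Aff} (hc : c ∈ Γ) (hcp : IsParabolic c.linear) (hpos : 0 < inv c) :
    ∃ g ∈ Γ, IsHyperbolic g.linear ∧ 0 < inv g := by
  obtain ⟨p, hp0, hp, hpa, hA⟩ := (hΓ.linear_mem c hc).parabolic_form hcp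
  obtain ⟨e, he, hnf⟩ := exists_NF_of_null hp hp0
  obtain ⟨h, hh, hmv⟩ := hΓ.exists_moved hnf
  have hH := hΓ.linear_mem h hh
  set H := h.linear with hHdef
  have hneg : lorentz p (H p) < 0 := by
    have h1 := (hH.isNF hnf).lorentz_nonpos hnf
    have h2 := lt_of_le_of_ne h1 hmv
    rw [map_smul, lorentz_smul_left, lorentz_smul_right, lorentz_comm] at h2
    by_contra h3
    nlinarith [mul_nonneg (mul_self_nonneg e) (not_lt.mp h3)]
  set β := lorentz p (c 0) with hβ
  have hβpos : 0 < β := by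
    rw [inv, kap, ← hpa, lorentz_smul_left] at hpos
    linarith
  set b := c 0 - (1 / 2 : ℝ) • cross p (c 0) - (lorentz p (c 0) / 12) • p with hb
  have hpb : lorentz p b = β := by
    have hpc : lorentz p (cross p (c 0)) = 0 := by simp [lorentz]; ring
    rw [hb]; simp only [lorentz_sub_right, lorentz_smul_right, hp, hpc]; ring
  set r := H.symm p with hr
  have hpr : lorentz p r = lorentz p (H p) := by
    rw [hr, lorentz_comm, hH.lorentz_symm]
  have hlin : ∀ n : ℕ, ((c ^ n).linear : R21 →ₗ[ℝ] R21) =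
      LinearMap.id + (n : ℝ) • crossL p + (-((n : ℝ) ^ 2 / 2)) • rankOne p p := by
    intro n
    ext1 x
    ext1
    simp only [LinearMap.comp_apply, LinearEquiv.coe_coe]
    rw [pow_linear_parabolic hp hA]
    simp only [LinearMap.add_apply, LinearMap.id_apply, LinearMap.smul_apply, crossL, rankOne,
      LinearMap.coe_mk, AddHom.coe_mk, lorentz_comm p]
    module
  have hinv : ∀ n : ℕ, inv (h * c ^ n) = kap ((H : R21 →ₗ[ℝ] R21)
      + (n : ℝ) • (crossL p ∘ₗ (H : R21 →ₗ[ℝ] R21))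
      + (-((n : ℝ) ^ 2 / 2)) • (rankOne p p ∘ₗ (H : R21 →ₗ[ℝ] R21)))
      ((n : ℝ) • b + ((n : ℝ) ^ 2 / 2) • cross p b + (-((n : ℝ) ^ 3 / 6 * β)) • p
        + H.symm (h 0)) := by
    intro n
    have e1 : (h * c ^ n) 0 = H ((c ^ n) 0 + H.symm (h 0)) := by
      rw [aff_mul, aff_apply h, map_add, LinearEquiv.apply_symm_apply]
    have e2 : ((h * c ^ n).linear : R21 →ₗ[ℝ] R21) =
      (H : R21 →ₗ[ℝ] R21) ∘ₗ ((c ^ n).linear : R21 →ₗ[ℝ] R21) := rfl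
    rw [inv, e1, e2, hH.kap_conj, hlin, pow_zero_parabolic hp hA hb, hpb]
    congr 1
    module
  have hk2 : ∀ u, kap (rankOne p p ∘ₗ (H : R21 →ₗ[ℝ] R21)) u = -det3 u r p := by
    intro u
    rw [kap_rankOne (-p) r u]
    · simp [det3]; ring
    · intro x
      change lorentz (H x) p • p = _
      rw [hr, lorentz_comm x, hH.lorentz_symm, lorentz_comm p]; module
  have hk3 : det3 (cross p b) r p = -(lorentz p (H p) * β) := by
    have : det3 (cross p b) r p = lorentz (cross p b) (cross r p) := by simp [lorentz, det3]; ring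
    rw [this, lorentz_cross_cross, hp, hpr, lorentz_comm b p, hpb]; ring
  have hk4 : det3 p r p = 0 := by simp [det3]; ring
  have htr : ∀ n : ℕ, tr3 ((h * c ^ n).linear : R21 →ₗ[ℝ] R21) =
      (-(lorentz p (H p)) / 2) * (n : ℝ) ^ 2 + tr3 ((H : R21 →ₗ[ℝ] R21) ∘ₗ crossL p) * n
        + tr3 (H : R21 →ₗ[ℝ] R21) := by
    intro n
    have e2 : ((h * c ^ n).linear : R21 →ₗ[ℝ] R21) =
      (H : R21 →ₗ[ℝ] R21) ∘ₗ ((c ^ n).linear : R21 →ₗ[ℝ] R21) := rfl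
    have e3 := map_apply3 (H : R21 →ₗ[ℝ] R21) p
    simp only [LinearEquiv.coe_coe] at e3
    rw [e2, hlin]
    simp only [tr3, LinearMap.comp_apply, LinearMap.add_apply, LinearMap.smul_apply, map_add,
      map_smul, Pi.add_apply, Pi.smul_apply, smul_eq_mul, LinearEquiv.coe_coe,
      LinearMap.id_apply, rankOne, LinearMap.coe_mk, AddHom.coe_mk]
    simp only [lorentz, e3]
    simp [bv]
    ring
  -- The degree five term vanishes since `det3 p r p = 0`. In degree four the quadratic part of `c ^
  -- n` contributes -1/4 and the linear part +1/6, whence -1/12.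
  have ev1 := eventually_quartic_pos (c4 := -(β * lorentz p (H p)) / 12)
    (by have := mul_neg_of_pos_of_neg hβpos hneg; linarith)
    (kap (crossL p ∘ₗ (H : R21 →ₗ[ℝ] R21)) (cross p b) / 2 + det3 b r p / 2
      - β / 6 * kap (H : R21 →ₗ[ℝ] R21) p)
    (kap (crossL p ∘ₗ (H : R21 →ₗ[ℝ] R21)) b + kap (H : R21 →ₗ[ℝ] R21) (cross p b) / 2
      + det3 (H.symm (h 0)) r p / 2)
    (kap (H : R21 →ₗ[ℝ] R21) b + kap (crossL p ∘ₗ (H : R21 →ₗ[ℝ] R21)) (H.symm (h 0)))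
    (kap (H : R21 →ₗ[ℝ] R21) (H.symm (h 0)))
  have ev2 : ∀ᶠ n : ℕ in atTop, 3 < tr3 ((h * c ^ n).linear : R21 →ₗ[ℝ] R21) := by
    have hpos2 : 0 < -(lorentz p (H p)) / 2 := by linarith
    set t1 := tr3 ((H : R21 →ₗ[ℝ] R21) ∘ₗ crossL p)
    set t0 := tr3 (H : R21 →ₗ[ℝ] R21)
    filter_upwards [eventually_quartic_pos hpos2 t1 (t0 - 3) 0 0, eventually_ge_atTop 1]
      with n h4 h1
    have hn : (0 : ℝ) < (n : ℝ) ^ 2 := by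
      have : (1 : ℝ) ≤ n := by exact_mod_cast h1
      positivity
    rw [htr]
    by_contra hle
    have := mul_nonneg hn.le (sub_nonneg.mpr (not_lt.mp hle))
    nlinarith
  obtain ⟨n, h1, h2⟩ := (ev1.and ev2).exists
  have hmem : h * c ^ n ∈ Γ := Γ.mul_mem hh (Γ.pow_mem hc n)
  refine ⟨h * c ^ n, hmem, (hΓ.linear_mem _ hmem).hyperbolic_of_trace h2, ?_⟩
  rw [hinv]
  simp only [kap_add_left, kap_smul_left, kap_add_right, kap_smul_right, hk2, hk3, hk4,
    kap_crossL_comp hp]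
  simp only [LinearEquiv.coe_coe]
  refine lt_of_lt_of_eq h1 ?_
  ring

/-- The sign normalization: hyperbolic elements have nonnegative invariant. -/
theorem IsMargulisHolonomy.inv_nonneg_of_hyperbolic {Γ : Subgroup Aff} (hΓ : IsMargulisHolonomy Γ)
    (hpos : ∃ g ∈ Γ, HasPositiveInvariant g) {a : Aff} (ha : a ∈ Γ)
    (hah : IsHyperbolic a.linear) : 0 ≤ inv a := by
  obtain ⟨c, hc, hcp⟩ := hpos
  have h1 := inv_pos_of_hasPositiveInvariant (hΓ.linear_mem c hc) hcp
  rcases hcp.1 with h | h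
  · exact hΓ.inv_nonneg hc h h1 ha hah
  · obtain ⟨g, hg, hgh, hgp⟩ := exists_hyperbolic_pos_of_parabolic hΓ hc h h1
    exact hΓ.inv_nonneg hg hgh hgp ha hah

/-! ### Group actions on cyclically ordered sets -/

/-- A cyclically ordered set with an action of a group, and two points `z'` and `z` that are
consecutive among the points of their orbits. -/
structure CyclicAction {G P : Type*} [Group G] [MulAction G P] (cyc : P → P → P → Prop)
    (z z' : P) : Prop where
  rot : ∀ {a b c}, cyc a b c → cyc b c a
  asymm : ∀ {a b c}, cyc a b c → ¬ cyc a c b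
  trans : ∀ {a b c d}, cyc a b c → cyc a c d → cyc a b d
  smul : ∀ (g : G) {a b c}, cyc a b c → cyc (g • a) (g • b) (g • c)
  total : ∀ {a b c}, (∃ g : G, a = g • z ∨ a = g • z') → (∃ g : G, b = g • z ∨ b = g • z') →
    (∃ g : G, c = g • z ∨ c = g • z') → a ≠ b → b ≠ c → a ≠ c → cyc a b c ∨ cyc a c b
  inj : ∀ g : G, g • z = z → g = 1
  inj' : ∀ g : G, g • z' = z' → g = 1
  ne : ∀ g : G, g • z ≠ z'
  adj : ∀ g : G, g ≠ 1 → cyc z' z (g • z) ∧ cyc z' z (g • z')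

namespace CyclicAction

variable {G P : Type*} [Group G] [MulAction G P] {cyc : P → P → P → Prop} {z z' : P}

theorem irrefl_right (C : CyclicAction (G := G) cyc z z') {a b : P} : ¬ cyc a b b :=
  fun h => C.asymm h h

theorem irrefl_mid (C : CyclicAction (G := G) cyc z z') {a b : P} : ¬ cyc a b a :=
  fun h => C.irrefl_right (C.rot h)

theorem rot' (C : CyclicAction (G := G) cyc z z') {a b c : P} (h : cyc a b c) : cyc c a b :=
  C.rot (C.rot h)

theorem tail (C : CyclicAction (G := G) cyc z z') {a b c d : P} (h : cyc a b c)
    (h' : cyc a c d) : cyc b c d :=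
  C.rot (C.rot (C.trans (C.rot h') (C.rot' h)))

theorem insert_left (C : CyclicAction (G := G) cyc z z') {a b c d : P} (h : cyc a b d)
    (h' : cyc b c d) : cyc a b c :=
  C.rot' (C.trans h' (C.rot h))

theorem insert_right (C : CyclicAction (G := G) cyc z z') {a b c d : P} (h : cyc a b d)
    (h' : cyc b c d) : cyc a c d :=
  C.rot (C.trans (C.rot' h) (C.rot' h'))

theorem eq_of_smul_eq (C : CyclicAction (G := G) cyc z z') {g h : G} (e : g • z = h • z) :
    g = h := by
  have : (h⁻¹ * g) • z = z := by rw [mul_smul, e, inv_smul_smul]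
  exact (inv_mul_eq_one.mp (C.inj _ this)).symm

theorem eq_of_smul_eq' (C : CyclicAction (G := G) cyc z z') {g h : G} (e : g • z' = h • z') :
    g = h := by
  have : (h⁻¹ * g) • z' = z' := by rw [mul_smul, e, inv_smul_smul]
  exact (inv_mul_eq_one.mp (C.inj' _ this)).symm

theorem smul_ne (C : CyclicAction (G := G) cyc z z') (g h : G) : g • z ≠ h • z' := by
  intro e
  apply C.ne (h⁻¹ * g)
  rw [mul_smul, e, inv_smul_smul]

/-- An edge `(1, s)` of the Cayley graph that is outermost as seen from `g⁻¹ • z'`. -/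
def Outermost (cyc : P → P → P → Prop) (z z' : P) (S : Finset G) (g s : G) : Prop :=
  cyc (g⁻¹ • z') z (s • z) ∧ ∀ k : G, ∀ t ∈ S, (k = 1 ∨ cyc (g⁻¹ • z') (k • z) z) →
    (k * t = s ∨ cyc (g⁻¹ • z') (s • z) ((k * t) • z)) → k = 1 ∧ k * t = s

/-- Cut the circle at `z'`. By connectedness of the Cayley graph some edge passes over `h • z'`, and
finitely many do. Among these take the one that starts first, then ends last, and translate its
origin to `1`. -/
theorem exists_outermost (C : CyclicAction (G := G) cyc z z') {S : Finset G}
    (gen : ∀ W : Set G, W.Nonempty → (∀ k ∈ W, ∀ t ∈ S, k * t ∈ W) → W = Set.univ)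
    (fin : ∀ c d : P, (∃ g : G, c = g • z ∨ c = g • z') → (∃ g : G, d = g • z ∨ d = g • z') →
      ∀ s ∈ S, {g : G | cyc c (g • z) d ∧ cyc d ((g * s) • z) c}.Finite)
    {h : G} (hh : h ≠ 1) :
    ∃ g, ∃ s ∈ S, cyc z' (h • z') ((g * s) • z) ∧ Outermost cyc z z' S g s := by
  have hz' : ∃ g : G, z' = g • z ∨ z' = g • z' := ⟨1, Or.inr (one_smul _ _).symm⟩
  set E : Set (G × G) := {e | e.2 ∈ S ∧ cyc z' (e.1 • z) (h • z') ∧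
    cyc z' (h • z') ((e.1 * e.2) • z)} with hE
  have hEfin : E.Finite := by
    have : E ⊆ ⋃ s ∈ S, (fun g => (g, s)) ''
        {g : G | cyc z' (g • z) (h • z') ∧ cyc (h • z') ((g * s) • z) z'} := by
      rintro ⟨g, s⟩ ⟨h1, h2, h3⟩
      simp only [Set.mem_iUnion]
      exact ⟨s, h1, g, ⟨h2, C.rot h3⟩, rfl⟩
    refine Set.Finite.subset (Set.Finite.biUnion S.finite_toSet fun s hs => ?_) this
    exact (fin z' (h • z') hz' ⟨h, Or.inr rfl⟩ s hs).image _
  have hEne : E.Nonempty := by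
    by_contra hemp
    -- If no edge crossed, the vertices before `h • z'` would be all of `G`; but `h • z` comes right
    -- after `h • z'`.
    have hW := gen {g | cyc z' (g • z) (h • z')} ⟨1, by
      simp only [Set.mem_ofPred_eq, one_smul]; exact (C.adj h hh).2⟩ (by
      intro k hk t ht
      by_contra hkt
      apply hemp
      refine ⟨(k, t), ht, hk, ?_⟩
      rcases C.total (a := z') (b := h • z') (c := (k * t) • z) hz' ⟨h, Or.inr rfl⟩
        ⟨k * t, Or.inl rfl⟩ (fun e => hh (C.inj' h e.symm)) (C.smul_ne _ _).symm
        (C.ne _).symm with h1 | h1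
      · exact h1
      · exact absurd h1 hkt)
    have h1 : cyc z' (h • z) (h • z') := by
      have : h ∈ {g | cyc z' (g • z) (h • z')} := by rw [hW]; trivial
      exact this
    have h2 := C.smul h (C.adj h⁻¹ (inv_ne_one.mpr hh)).2
    rw [smul_inv_smul] at h2
    exact C.asymm h1 (C.rot' h2)
  let R : E → E → Prop := fun e e' => cyc z' (e.1.1 • z) (e'.1.1 • z) ∨
    (e.1.1 = e'.1.1 ∧ cyc z' ((e'.1.1 * e'.1.2) • z) ((e.1.1 * e.1.2) • z))
  have hFin : Finite E := hEfin
  have : IsTrans E R := ⟨by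
    rintro a b c (h1 | ⟨h1, h1'⟩) (h2 | ⟨h2, h2'⟩)
    · exact Or.inl (C.trans h1 h2)
    · exact Or.inl (h2 ▸ h1)
    · exact Or.inl (h1 ▸ h2)
    · exact Or.inr ⟨h1.trans h2, C.trans h2' h1'⟩⟩
  have : Std.Irrefl R := ⟨by
    rintro a (h1 | ⟨_, h1⟩)
    · exact C.irrefl_right h1
    · exact C.irrefl_right h1⟩
  have hwf : WellFounded R := Finite.wellFounded_of_trans_of_irrefl R
  obtain ⟨⟨⟨g, s⟩, hs, h1, h2⟩, -, hmin⟩ := hwf.has_min Set.univ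
    ⟨⟨hEne.some, hEne.some_mem⟩, trivial⟩
  simp only at hs h1 h2
  refine ⟨g, s, hs, h2, ?_, ?_⟩
  · have := C.smul g⁻¹ (C.trans h1 h2)
    rwa [inv_smul_smul, mul_smul, inv_smul_smul] at this
  · intro k t ht hk hkt
    have hk' : g * k = g ∨ cyc z' ((g * k) • z) (g • z) := by
      rcases hk with rfl | hk
      · left; simp
      · right
        have := C.smul g hk
        rwa [smul_inv_smul, smul_smul] at this
    have hkt' : (g * k) * t = g * s ∨ cyc z' ((g * s) • z) ((g * k * t) • z) := by
      rcases hkt with hkt | hkt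
      · left; rw [mul_assoc, hkt]
      · right
        have := C.smul g hkt
        rwa [smul_inv_smul, smul_smul, smul_smul, ← mul_assoc] at this
    have hmem : (g * k, t) ∈ E := by
      refine ⟨ht, ?_, ?_⟩
      · rcases hk' with hk' | hk'
        · simp only [hk']; exact h1
        · exact C.trans hk' h1
      · rcases hkt' with hkt' | hkt'
        · simp only [hkt']; exact h2
        · exact C.trans h2 hkt'
    have hnot := hmin ⟨(g * k, t), hmem⟩ trivial
    simp only [R, not_or, not_and] at hnot
    have e1 : g * k = g := hk'.resolve_right hnot.1
    have e2 : g * k * t = g * s := hkt'.resolve_right (hnot.2 e1)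
    have e3 : k = 1 := by simpa using e1
    refine ⟨e3, ?_⟩
    rw [mul_assoc] at e2
    exact mul_left_cancel e2

/-- A finitely generated group cannot act in such a way that the edges of its Cayley graph,
realized as chords, cross locally finitely, while infinitely many translates of `z'` accumulate
at the end of the cyclic order cut at `z'`. -/
theorem false_of_accumulation (C : CyclicAction (G := G) cyc z z') {S : Finset G}
    (symm : ∀ s ∈ S, s⁻¹ ∈ S)
    (gen : ∀ W : Set G, W.Nonempty → (∀ k ∈ W, ∀ t ∈ S, k * t ∈ W) → W = Set.univ)
    (fin : ∀ c d : P, (∃ g : G, c = g • z ∨ c = g • z') → (∃ g : G, d = g • z ∨ d = g • z') →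
      ∀ s ∈ S, {g : G | cyc c (g • z) d ∧ cyc d ((g * s) • z) c}.Finite)
    {H : Set G} (hH : H.Infinite)
    (acc : ∀ g : G, {h : G | h ∈ H ∧ cyc z' (h • z') (g • z)}.Finite) : False := by
  -- Each outermost edge passes over only finitely many of the accumulating points, so infinitely
  -- many are needed to cover `H`.
  have hQ : {e : G × G | e.2 ∈ S ∧ Outermost cyc z z' S e.1 e.2}.Infinite := by
    intro hfin
    apply hH
    have hsub : H ⊆ {1} ∪ ⋃ e ∈ {e : G × G | e.2 ∈ S ∧ Outermost cyc z z' S e.1 e.2},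
        {h : G | h ∈ H ∧ cyc z' (h • z') ((e.1 * e.2) • z)} := by
      intro h hh
      by_cases h1 : h = 1
      · exact Or.inl h1
      · right
        obtain ⟨g, s, hs, h2, h3⟩ := C.exists_outermost gen fin h1
        simp only [Set.mem_iUnion]
        exact ⟨(g, s), ⟨hs, h3⟩, hh, h2⟩
    refine Set.Finite.subset ((Set.finite_singleton _).union (hfin.biUnion fun e _ => ?_)) hsub
    exact acc _
  obtain ⟨s, hs, hG⟩ : ∃ s ∈ S, {g : G | Outermost cyc z z' S g s}.Infinite := by
    by_contra! hall
    apply hQ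
    have hsub : {e : G × G | e.2 ∈ S ∧ Outermost cyc z z' S e.1 e.2} ⊆
        ⋃ s ∈ S, (fun g => (g, s)) '' {g : G | Outermost cyc z z' S g s} := by
      rintro ⟨g, s⟩ ⟨h1, h2⟩
      simp only [Set.mem_iUnion]
      exact ⟨s, h1, g, h2, rfl⟩
    refine Set.Finite.subset (Set.Finite.biUnion S.finite_toSet fun s hs => ?_) hsub
    exact (hall s hs).image _
  set F : Set G := {k | ∃ t ∈ S, cyc (s • z) (k • z) z ∧ cyc z ((k * t) • z) (s • z)} with hF
  have hFfin : F.Finite := by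
    have hsub : F ⊆ ⋃ t ∈ S, {k : G | cyc (s • z) (k • z) z ∧ cyc z ((k * t) • z) (s • z)} := by
      rintro k ⟨t, ht, h⟩
      simp only [Set.mem_iUnion]
      exact ⟨t, ht, h⟩
    refine Set.Finite.subset (Set.Finite.biUnion S.finite_toSet fun t ht => ?_) hsub
    exact fin _ _ ⟨s, Or.inl rfl⟩ ⟨1, Or.inl (one_smul _ _).symm⟩ t ht
  -- Pigeonhole: two viewpoints `g⁻¹ • z'` and `g'⁻¹ • z'` see the same splitting of the finitely
  -- many edges that cross the chord from `z` to `s • z`.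
  obtain ⟨g, hg, g', hg', hne, hφ⟩ := hG.exists_ne_map_eq_of_mapsTo
    (f := fun g => {k | k ∈ F ∧ cyc (s • z) (k • z) (g⁻¹ • z')}) (t := 𝒫 F)
    (fun g _ k hk => hk.1) hFfin.powerset
  -- the essential case
  have main : ∀ g g' : G, Outermost cyc z z' S g s → Outermost cyc z z' S g' s → g ≠ g' →
      (∀ k ∈ F, cyc (s • z) (k • z) (g'⁻¹ • z') → cyc (s • z) (k • z) (g⁻¹ • z')) →
      cyc (s • z) (g⁻¹ • z') (g'⁻¹ • z') → False := by
    intro g g' ⟨hv, hM⟩ ⟨hv', hM'⟩ hne hφ hlt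
    set v := g⁻¹ • z' with hvdef
    set v' := g'⁻¹ • z' with hvdef'
    have hvz := C.rot' hv
    have hvz' := C.rot' hv'
    have h1W : ¬ cyc v ((1 : G) • z) v' := by
      rw [one_smul]
      exact C.asymm (C.tail hlt hvz')
    have hsz : s • z ≠ z := fun e => C.irrefl_right (e ▸ hv)
    -- The vertices between the two viewpoints are closed under edges: an edge leaving this interval
    -- would cross the chord, which the common splitting excludes, or would contradict outermostness
    -- seen from `v`, or, when reversed, from `v'`. Hence they are all of `G`, although `1` is not
    -- among them.
    have hW := gen {k | cyc v (k • z) v'} ⟨g⁻¹, by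
      have h1 := C.smul g⁻¹ (C.adj (g * g'⁻¹) (fun e => hne (mul_inv_eq_one.mp e))).2
      rwa [smul_smul, inv_mul_cancel_left] at h1⟩ (by
      intro k hk t ht
      simp only [Set.mem_ofPred_eq] at hk ⊢
      have k1 : cyc (s • z) v (k • z) := C.insert_left hlt hk
      have k2 : cyc (s • z) (k • z) v' := C.insert_right hlt hk
      have k3 : cyc (s • z) (k • z) z := C.trans k2 hvz'
      have k4 : cyc v (k • z) z := C.tail k1 k3
      have k5 : cyc v' (s • z) (k • z) := C.rot' k2
      have hkF : k ∉ F := fun hkF => C.asymm k1 (hφ k hkF k2)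
      have hk1 : k ≠ 1 := fun e => h1W (e ▸ hk)
      have hks : k ≠ s := fun e => C.irrefl_mid (e ▸ k1)
      have hcross : ¬ cyc z ((k * t) • z) (s • z) := fun hc => hkF ⟨t, ht, k3, hc⟩
      have hkts : k * t ≠ s := fun e => hk1 (hM k t ht (Or.inr k4) (Or.inl e)).1
      have hkt1 : k * t ≠ 1 := fun e => hks (by
        have := (hM' (k * t) t⁻¹ (symm t ht) (Or.inl e)
          (Or.inr (by rwa [mul_inv_cancel_right]))).2
        rwa [mul_inv_cancel_right] at this)
      have hyz : z ≠ (k * t) • z := fun e => hkt1 (C.inj _ e.symm)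
      have hys : (k * t) • z ≠ s • z := fun e => hkts (C.eq_of_smul_eq e)
      have hz : ∃ g : G, z = g • z ∨ z = g • z' := ⟨1, Or.inl (one_smul _ _).symm⟩
      have y1 : cyc (s • z) ((k * t) • z) z := by
        rcases C.total hz ⟨k * t, Or.inl rfl⟩ ⟨s, Or.inl rfl⟩ hyz hys hsz.symm with h | h
        · exact absurd h hcross
        · exact C.rot h
      have y2 : cyc (s • z) v ((k * t) • z) := by
        rcases C.total (a := s • z) (b := (k * t) • z) (c := v) ⟨s, Or.inl rfl⟩
          ⟨k * t, Or.inl rfl⟩ ⟨g⁻¹, Or.inr rfl⟩ hys.symm (C.smul_ne _ _) (C.smul_ne _ _)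
          with h | h
        · exact absurd (hM k t ht (Or.inr k4) (Or.inr (C.rot' h))).1 hk1
        · exact h
      have y3 : cyc (s • z) ((k * t) • z) v' := by
        rcases C.total (a := s • z) (b := (k * t) • z) (c := v') ⟨s, Or.inl rfl⟩
          ⟨k * t, Or.inl rfl⟩ ⟨g'⁻¹, Or.inr rfl⟩ hys.symm (C.smul_ne _ _) (C.smul_ne _ _)
          with h | h
        · exact h
        · exact absurd (hM' (k * t) t⁻¹ (symm t ht) (Or.inr (C.tail h y1))
            (Or.inr (by rwa [mul_inv_cancel_right]))).1 hkt1
      exact C.tail y2 y3)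
    apply h1W
    have : (1 : G) ∈ {k | cyc v (k • z) v'} := by rw [hW]; trivial
    exact this
  have hset : ∀ k, (k ∈ F ∧ cyc (s • z) (k • z) (g⁻¹ • z')) ↔
      (k ∈ F ∧ cyc (s • z) (k • z) (g'⁻¹ • z')) := fun k => Set.ext_iff.mp hφ k
  have hne' : g⁻¹ • z' ≠ g'⁻¹ • z' := fun e => hne (inv_injective (C.eq_of_smul_eq' e))
  rcases C.total (a := s • z) ⟨s, Or.inl rfl⟩ ⟨g⁻¹, Or.inr rfl⟩ ⟨g'⁻¹, Or.inr rfl⟩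
    (C.smul_ne _ _) hne' (C.smul_ne _ _) with h | h
  · exact main g g' hg hg' hne (fun k hk h' => ((hset k).mpr ⟨hk, h'⟩).2) h
  · exact main g' g hg' hg hne.symm (fun k hk h' => ((hset k).mp ⟨hk, h'⟩).2) h

end CyclicAction

/-! ### Limits of sequences of isometries -/

/-- The hyperbolic cosine of the displacement of the base point. -/
def tau (A : R21 ≃ₗ[ℝ] R21) : ℝ := A (bv 2) 2

theorem IsSO21o.lorentz_symm_symm {A : R21 ≃ₗ[ℝ] R21} (hA : IsSO21o A) (x y : R21) :
    lorentz (A.symm x) (A.symm y) = lorentz x y := by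
  rw [hA.lorentz_symm, LinearEquiv.apply_symm_apply]

theorem IsSO21o.row_sq {A : R21 ≃ₗ[ℝ] R21} (hA : IsSO21o A) :
    A (bv 0) 2 ^ 2 + A (bv 1) 2 ^ 2 - A (bv 2) 2 ^ 2 = -1 := by
  have h := hA.lorentz_symm_symm (bv 2) (bv 2)
  have h0 := hA.lorentz_symm (bv 2) (bv 0)
  have h1 := hA.lorentz_symm (bv 2) (bv 1)
  have h2 := hA.lorentz_symm (bv 2) (bv 2)
  simp only [lorentz] at h h0 h1 h2
  simp [bv] at h h0 h1 h2
  simp only [bv]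
  rw [h0, h1, h2] at h
  linarith

theorem IsSO21o.one_le_tau {A : R21 ≃ₗ[ℝ] R21} (hA : IsSO21o A) : 1 ≤ tau A := by
  have h := hA.row_sq
  have h1 := (hA.isTF isTF_bv).2
  unfold tau
  nlinarith [sq_nonneg (A (bv 0) 2), sq_nonneg (A (bv 1) 2)]

/-- The last row and the columns have Lorentzian square ±1, so the corner entry dominates all
others. -/
theorem IsSO21o.abs_entry_le {A : R21 ≃ₗ[ℝ] R21} (hA : IsSO21o A) (j i : Fin 3) :
    |A (bv j) i| ≤ tau A := by
  have hr := hA.row_sq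
  have ht := hA.one_le_tau
  have c0 := hA.isometry (bv 0) (bv 0)
  have c1 := hA.isometry (bv 1) (bv 1)
  have c2 := hA.isometry (bv 2) (bv 2)
  have e0 : lorentz (bv 0) (bv 0) = 1 := by simp [lorentz, bv]
  have e1 : lorentz (bv 1) (bv 1) = 1 := by simp [lorentz, bv]
  have e2 : lorentz (bv 2) (bv 2) = -1 := by simp [lorentz, bv]
  rw [e0] at c0; rw [e1] at c1; rw [e2] at c2
  simp only [lorentz, ← sq] at c0 c1 c2
  apply abs_le_of_sq_le_sq _ (by linarith)
  unfold tau at ht ⊢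
  have s := fun j i => sq_nonneg (A (bv j) i)
  have s00 := s 0 0; have s01 := s 0 1; have s02 := s 0 2
  have s10 := s 1 0; have s11 := s 1 1; have s12 := s 1 2
  have s20 := s 2 0; have s21 := s 2 1
  clear s
  fin_cases j <;> fin_cases i <;> simp only [Fin.zero_eta, Fin.mk_one, Fin.reduceFinMk] <;>
    linarith

theorem continuous_aff (g : Aff) : Continuous g := by
  have : (g : R21 → R21) = fun x => g.linear x + g 0 := funext (aff_apply g)
  rw [this]
  exact ((g.linear : R21 →ₗ[ℝ] R21).continuous_of_finiteDimensional).add continuous_const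

theorem continuous_lin (A : R21 ≃ₗ[ℝ] R21) : Continuous A :=
  (A : R21 →ₗ[ℝ] R21).continuous_of_finiteDimensional

theorem tendsto_lorentz {α : Type*} {l : Filter α} {f g : α → R21} {a b : R21}
    (hf : Tendsto f l (𝓝 a)) (hg : Tendsto g l (𝓝 b)) :
    Tendsto (fun n => lorentz (f n) (g n)) l (𝓝 (lorentz a b)) := by
  have hf' := tendsto_pi_nhds.mp hf
  have hg' := tendsto_pi_nhds.mp hg
  exact (((hf' 0).mul (hg' 0)).add ((hf' 1).mul (hg' 1))).sub ((hf' 2).mul (hg' 2))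

theorem tendsto_cross {α : Type*} {l : Filter α} {f g : α → R21} {a b : R21}
    (hf : Tendsto f l (𝓝 a)) (hg : Tendsto g l (𝓝 b)) :
    Tendsto (fun n => cross (f n) (g n)) l (𝓝 (cross a b)) := by
  have hf' := tendsto_pi_nhds.mp hf
  have hg' := tendsto_pi_nhds.mp hg
  rw [tendsto_pi_nhds]
  intro i
  fin_cases i
  · exact ((hf' 1).mul (hg' 2)).sub ((hf' 2).mul (hg' 1))
  · exact ((hf' 2).mul (hg' 0)).sub ((hf' 0).mul (hg' 2))
  · exact (((hf' 0).mul (hg' 1)).sub ((hf' 1).mul (hg' 0))).neg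

theorem tendsto_det3 {α : Type*} {l : Filter α} {f g h : α → R21} {a b c : R21}
    (hf : Tendsto f l (𝓝 a)) (hg : Tendsto g l (𝓝 b)) (hh : Tendsto h l (𝓝 c)) :
    Tendsto (fun n => det3 (f n) (g n) (h n)) l (𝓝 (det3 a b c)) := by
  simp only [← lorentz_cross]
  exact tendsto_lorentz (tendsto_cross hf hg) hh

theorem tendsto_kap {α : Type*} {l : Filter α} {S : α → R21 →ₗ[ℝ] R21} {T : R21 →ₗ[ℝ] R21}
    {v : α → R21} {u : R21} (hS : ∀ x, Tendsto (fun n => S n x) l (𝓝 (T x)))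
    (hv : Tendsto v l (𝓝 u)) : Tendsto (fun n => kap (S n) (v n)) l (𝓝 (kap T u)) := by
  refine tendsto_lorentz ?_ hv
  have h := fun j => tendsto_pi_nhds.mp (hS (bv j))
  rw [tendsto_pi_nhds]
  intro i
  fin_cases i
  · exact ((h 2 1).add (h 1 2)).neg
  · exact (h 2 0).add (h 0 2)
  · exact (h 0 1).sub (h 1 0)

theorem tendsto_tr3 {α : Type*} {l : Filter α} {S : α → R21 →ₗ[ℝ] R21} {T : R21 →ₗ[ℝ] R21}
    (hS : ∀ x, Tendsto (fun n => S n x) l (𝓝 (T x))) :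
    Tendsto (fun n => tr3 (S n)) l (𝓝 (tr3 T)) := by
  have h := fun j => tendsto_pi_nhds.mp (hS (bv j))
  exact ((h 0 0).add (h 1 1)).add (h 2 2)

/-- Bounded sequences of linear maps have convergent subsequences. -/
theorem exists_subseq_linear {S : ℕ → R21 →ₗ[ℝ] R21} {R : ℝ} (h : ∀ n j i, |S n (bv j) i| ≤ R) :
    ∃ (T : R21 →ₗ[ℝ] R21) (φ : ℕ → ℕ), StrictMono φ ∧
      ∀ x, Tendsto (fun n => S (φ n) x) atTop (𝓝 (T x)) := by
  let f : ℕ → Fin 3 → Fin 3 → ℝ := fun n j i => S n (bv j) i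
  have hmem : ∀ n, f n ∈ Set.Icc (fun _ _ => -R : Fin 3 → Fin 3 → ℝ) (fun _ _ => R) := by
    intro n
    exact ⟨fun j i => (abs_le.mp (h n j i)).1, fun j i => (abs_le.mp (h n j i)).2⟩
  obtain ⟨a, -, φ, hφ, ha⟩ := isCompact_Icc.tendsto_subseq hmem
  have hc : ∀ j i, Tendsto (fun n => S (φ n) (bv j) i) atTop (𝓝 (a j i)) := fun j i =>
    tendsto_pi_nhds.mp (tendsto_pi_nhds.mp ha j) i
  let T : R21 →ₗ[ℝ] R21 :=
    { toFun := fun x => x 0 • a 0 + x 1 • a 1 + x 2 • a 2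
      map_add' := by intro x y; simp only [Pi.add_apply]; module
      map_smul' := by intro t x; simp only [Pi.smul_apply, smul_eq_mul, RingHom.id_apply]; module }
  refine ⟨T, φ, hφ, fun x => ?_⟩
  rw [tendsto_pi_nhds]
  intro i
  have e : ∀ n, S (φ n) x i = x 0 * S (φ n) (bv 0) i + x 1 * S (φ n) (bv 1) i
    + x 2 * S (φ n) (bv 2) i := fun n => map_apply3 _ x i
  simp only [e]
  exact (((hc 0 i).const_mul _).add ((hc 1 i).const_mul _)).add ((hc 2 i).const_mul _)

/-- A divergent sequence of isometries, with attracting direction `p` and repelling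
direction `r`. -/
structure Diverges (A : ℕ → R21 ≃ₗ[ℝ] R21) (p r : R21) : Prop where
  nfp : IsNF p
  nfr : IsNF r
  tau : Tendsto (fun n => tau (A n)) atTop atTop
  lim : ∀ x, Tendsto (fun n => (Margulis.tau (A n))⁻¹ • A n x) atTop (𝓝 (-lorentz x r • p))

/-- A limit `T` of `A n / tau (A n)` has totally isotropic image, because the form is rescaled to
zero. So its rank is one, and its last row gives `r`. -/
theorem exists_diverges {A : ℕ → R21 ≃ₗ[ℝ] R21} (hA : ∀ n, IsSO21o (A n))
    (ht : Tendsto (fun n => tau (A n)) atTop atTop) :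
    ∃ (p r : R21) (φ : ℕ → ℕ), StrictMono φ ∧ Diverges (fun n => A (φ n)) p r := by
  have hpos : ∀ n, 0 < tau (A n) := fun n => by linarith [(hA n).one_le_tau]
  obtain ⟨T, φ, hφ, hT⟩ := exists_subseq_linear (R := 1)
    (S := fun n => (tau (A n))⁻¹ • (A n : R21 →ₗ[ℝ] R21)) (by
      intro n j i
      simp only [LinearMap.smul_apply, LinearEquiv.coe_coe, Pi.smul_apply, smul_eq_mul]
      rw [abs_mul, abs_of_pos (inv_pos.mpr (hpos n)), inv_mul_le_iff₀ (hpos n), mul_one]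
      exact (hA n).abs_entry_le j i)
  simp only [LinearMap.smul_apply, LinearEquiv.coe_coe] at hT
  have ht' := ht.comp hφ.tendsto_atTop
  have hi : Tendsto (fun n => (tau (A (φ n)))⁻¹) atTop (𝓝 0) := tendsto_inv_atTop_zero.comp ht'
  have hort : ∀ x y, lorentz (T x) (T y) = 0 := by
    intro x y
    have h1 := tendsto_lorentz (hT x) (hT y)
    have h2 : Tendsto (fun n => (tau (A (φ n)))⁻¹ * ((tau (A (φ n)))⁻¹ * lorentz x y)) atTop
        (𝓝 (0 * (0 * lorentz x y))) := hi.mul (hi.mul_const _)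
    simp only [zero_mul] at h2
    refine tendsto_nhds_unique h1 (h2.congr fun n => ?_)
    rw [lorentz_smul_left, lorentz_smul_right, (hA _).isometry]
  have h22 : T (bv 2) 2 = 1 := by
    have h1 := tendsto_pi_nhds.mp (hT (bv 2)) 2
    refine tendsto_nhds_unique h1 ?_
    have : ∀ n, ((tau (A (φ n)))⁻¹ • (A (φ n)) (bv 2)) 2 = 1 := by
      intro n
      rw [Pi.smul_apply, smul_eq_mul]
      exact inv_mul_cancel₀ (hpos _).ne'
    simp only [this]
    exact tendsto_const_nhds
  have hp : IsNF (T (bv 2)) := ⟨hort _ _, by rw [h22]; norm_num⟩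
  set r : R21 := ![-T (bv 0) 2, -T (bv 1) 2, 1] with hr
  have hTr : ∀ x, T x = -lorentz x r • T (bv 2) := by
    intro x
    have h1 := eq_smul_of_null (hort x x) hp (hort x (bv 2))
    rw [h22, div_one] at h1
    rw [h1, map_apply3 T x 2, h22]
    congr 1
    simp [lorentz, hr]; ring
  have hrn : IsNF r := by
    refine ⟨?_, by simp [hr]⟩
    have h0 := tendsto_pi_nhds.mp (hT (bv 0)) 2
    have h1 := tendsto_pi_nhds.mp (hT (bv 1)) 2
    have h2 := tendsto_pi_nhds.mp (hT (bv 2)) 2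
    have h3 := ((h0.mul h0).add (h1.mul h1)).sub (h2.mul h2)
    have h4 : Tendsto (fun n => (tau (A (φ n)))⁻¹ * ((tau (A (φ n)))⁻¹ * (-1))) atTop
        (𝓝 (0 * (0 * (-1)))) := hi.mul (hi.mul_const _)
    simp only [zero_mul] at h4
    have h5 := tendsto_nhds_unique h3 (h4.congr fun n => by
      rw [← (hA (φ n)).row_sq]
      simp only [Pi.smul_apply, smul_eq_mul]
      ring)
    rw [h22] at h5
    simp [lorentz, hr]
    linarith
  refine ⟨T (bv 2), r, φ, hφ, hp, hrn, ht', fun x => ?_⟩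
  rw [← hTr]
  exact hT x

/-! ### The main inequality -/

/-- The images of a bounded sequence of points go to infinity in the direction `u`. -/
structure Escapes (γ : ℕ → Aff) (z : ℕ → R21) (u : R21) : Prop where
  norm : Tendsto (fun n => ‖γ n (z n)‖) atTop atTop
  dir : Tendsto (fun n => ‖γ n (z n)‖⁻¹ • γ n (z n)) atTop (𝓝 u)

/-- Standing assumptions: the holonomy group, normalized so that the invariants of its hyperbolic
elements are nonnegative. -/
structure Normalized (Γ : Subgroup Aff) : Prop where
  holonomy : IsMargulisHolonomy Γ
  nonneg : ∀ a ∈ Γ, IsHyperbolic a.linear → 0 ≤ inv a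

theorem Normalized.so {Γ : Subgroup Aff} (hΓ : Normalized Γ) {g : Aff} (hg : g ∈ Γ) :
    IsSO21o g.linear := hΓ.holonomy.linear_mem g hg

/-- The invariant of `γ n * h` is computed at the point `h⁻¹ (z n)`: the displacement is `γ n (z n)`
minus a bounded vector, so its direction tends to `u`. -/
theorem Normalized.kap_nonneg {Γ : Subgroup Aff} (hΓ : Normalized Γ) {K : Set R21}
    (hK : IsCompact K) {γ : ℕ → Aff} (hγ : ∀ n, γ n ∈ Γ) {z : ℕ → R21} (hz : ∀ n, z n ∈ K)
    {u : R21} (hu : Escapes γ z u) {c : ℕ → ℝ} (hc : ∀ n, 0 ≤ c n) {T : R21 →ₗ[ℝ] R21}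
    (hT : ∀ x, Tendsto (fun n => c n • (γ n).linear x) atTop (𝓝 (T x))) {h : Aff} (hh : h ∈ Γ)
    (htr : ∀ᶠ n in atTop, 3 < tr3 ((γ n * h).linear : R21 →ₗ[ℝ] R21)) :
    0 ≤ kap (T ∘ₗ (h.linear : R21 →ₗ[ℝ] R21)) u := by
  have hlim : Tendsto (fun n => ‖γ n (z n)‖⁻¹ • γ n (z n) - ‖γ n (z n)‖⁻¹ • h⁻¹ (z n)) atTop
      (𝓝 (u - 0)) := by
    refine hu.dir.sub ?_
    have hb := (hK.image (continuous_aff h⁻¹)).isBounded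
    obtain ⟨R, hR⟩ := hb.exists_norm_le
    have h0 : Tendsto (fun n => ‖γ n (z n)‖⁻¹) atTop (𝓝 0) := tendsto_inv_atTop_zero.comp hu.norm
    refine h0.zero_smul_isBoundedUnder_le ?_
    exact isBoundedUnder_of ⟨R, fun n => hR _ ⟨z n, hz n, rfl⟩⟩
  rw [sub_zero] at hlim
  have hS : ∀ x, Tendsto (fun n => (c n • ((γ n * h).linear : R21 →ₗ[ℝ] R21)) x) atTop
      (𝓝 ((T ∘ₗ (h.linear : R21 →ₗ[ℝ] R21)) x)) := fun x => hT (h.linear x)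
  have hk := tendsto_kap hS hlim
  refine ge_of_tendsto hk ?_
  filter_upwards [htr] with n hn
  have hmem : γ n * h ∈ Γ := Γ.mul_mem (hγ n) hh
  have h1 := hΓ.nonneg _ hmem ((hΓ.so hmem).hyperbolic_of_trace hn)
  rw [← inv_eq (hΓ.so hmem) (h⁻¹ (z n)), aff_mul, aff_inv'] at h1
  rw [← smul_sub, kap_smul_left, kap_smul_right]
  exact mul_nonneg (hc n) (mul_nonneg (by positivity) h1)

theorem Normalized.det3_nonneg {Γ : Subgroup Aff} (hΓ : Normalized Γ) {K : Set R21}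
    (hK : IsCompact K) {γ : ℕ → Aff} (hγ : ∀ n, γ n ∈ Γ) {z : ℕ → R21} (hz : ∀ n, z n ∈ K)
    {u : R21} (hu : Escapes γ z u) {p r : R21} (hd : Diverges (fun n => (γ n).linear) p r)
    {h : Aff} (hh : h ∈ Γ) : 0 ≤ det3 u (h.linear r) p := by
  have hpos : ∀ n, 0 < tau (γ n).linear := fun n => by linarith [(hΓ.so (hγ n)).one_le_tau]
  have hhs := hΓ.so hh
  set T : R21 →ₗ[ℝ] R21 := rankOne (-p) r with hT
  have hTx : ∀ x, T x = -lorentz x r • p := by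
    intro x; change lorentz x r • -p = _; module
  have hcomp : ∀ x, (T ∘ₗ ((h⁻¹).linear : R21 →ₗ[ℝ] R21)) x = -lorentz x (h.linear r) • p := by
    intro x
    rw [LinearMap.comp_apply, hTx]
    change -lorentz (h.linear.symm x) r • p = _
    rw [hhs.lorentz_symm]
  -- In the parallel case nothing is known about the trace, but the determinant vanishes.
  by_cases h0 : lorentz p (h.linear r) = 0
  · obtain ⟨c, -, hc⟩ := hd.nfp.parallel (hhs.isNF hd.nfr) h0
    have : det3 u (h.linear r) p = 0 := by rw [hc]; simp [det3]; ring
    rw [this]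
  · rw [← kap_rankOne p _ u _ hcomp]
    refine hΓ.kap_nonneg hK hγ hz hu (c := fun n => (tau (γ n).linear)⁻¹)
      (fun n => (inv_pos.mpr (hpos n)).le) (fun x => by rw [hTx]; exact hd.lim x)
      (Γ.inv_mem hh) ?_
    have hS : ∀ x, Tendsto (fun n => ((tau (γ n).linear)⁻¹ • ((γ n * h⁻¹).linear : R21 →ₗ[ℝ] R21)) x)
        atTop (𝓝 ((T ∘ₗ ((h⁻¹).linear : R21 →ₗ[ℝ] R21)) x)) := by
      intro x
      rw [LinearMap.comp_apply, hTx]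
      exact hd.lim _
    have h1 := tendsto_tr3 hS
    have h2 : 0 < tr3 (T ∘ₗ ((h⁻¹).linear : R21 →ₗ[ℝ] R21)) := by
      have : tr3 (T ∘ₗ ((h⁻¹).linear : R21 →ₗ[ℝ] R21)) = -lorentz p (h.linear r) := by
        simp only [tr3, hcomp]
        simp [lorentz, bv]; ring
      rw [this]
      have := lt_of_le_of_ne (hd.nfp.lorentz_nonpos (hhs.isNF hd.nfr)) h0
      linarith
    have h3 := hd.tau.atTop_mul_pos h2 h1
    filter_upwards [h3.eventually_gt_atTop 3] with n hn
    refine lt_of_lt_of_eq hn ?_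
    simp only [tr3, LinearMap.smul_apply, Pi.smul_apply, smul_eq_mul]
    have := (hpos n).ne'
    field_simp

/-! ### Groups of isometries and their limit sets -/

/-- A group of orientation preserving isometries without invariant null line. -/
structure NonElementary (G : Subgroup (R21 ≃ₗ[ℝ] R21)) : Prop where
  so : ∀ A ∈ G, IsSO21o A
  moved : ∀ x, IsNF x → ∃ A ∈ G, lorentz (A x) x ≠ 0

/-- The closed cone over the orbit of a null vector. -/
def limitCone (G : Subgroup (R21 ≃ₗ[ℝ] R21)) (r : R21) : Set R21 :=
  closure {x | ∃ c : ℝ, 0 ≤ c ∧ ∃ A ∈ G, x = c • A r}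

theorem mem_limitCone_self {G : Subgroup (R21 ≃ₗ[ℝ] R21)} (r : R21) : r ∈ limitCone G r :=
  subset_closure ⟨1, zero_le_one, 1, G.one_mem, by rw [one_smul]; rfl⟩

theorem map_mem_limitCone {G : Subgroup (R21 ≃ₗ[ℝ] R21)} {r x : R21} {A : R21 ≃ₗ[ℝ] R21}
    (hA : A ∈ G) (hx : x ∈ limitCone G r) : A x ∈ limitCone G r := by
  refine map_mem_closure (continuous_lin A) hx ?_
  rintro _ ⟨c, hc, B, hB, rfl⟩
  exact ⟨c, hc, A * B, G.mul_mem hA hB, by rw [map_smul]; rfl⟩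

theorem smul_mem_limitCone {G : Subgroup (R21 ≃ₗ[ℝ] R21)} {r x : R21} {t : ℝ} (ht : 0 ≤ t)
    (hx : x ∈ limitCone G r) : t • x ∈ limitCone G r := by
  refine map_mem_closure (continuous_const_smul t) hx ?_
  rintro _ ⟨c, hc, B, hB, rfl⟩
  exact ⟨t * c, mul_nonneg ht hc, B, hB, by rw [smul_smul]⟩

theorem IsNF.lorentz_neg {x y : R21} (hx : IsNF x) (hy : IsNF y) (h : lorentz x y ≠ 0) :
    lorentz x y < 0 := lt_of_le_of_ne (hx.lorentz_nonpos hy) h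

namespace NonElementary

variable {G : Subgroup (R21 ≃ₗ[ℝ] R21)}

theorem exists_not_parallel (hG : NonElementary G) {x y : R21} (hx : IsNF x) (hy : IsNF y) :
    ∃ A ∈ G, lorentz (A x) y ≠ 0 := by
  by_cases h : lorentz x y = 0
  · obtain ⟨c, hc, rfl⟩ := hx.parallel hy h
    obtain ⟨A, hA, h1⟩ := hG.moved y hy
    refine ⟨A, hA, ?_⟩
    rw [map_smul, lorentz_smul_left]
    exact mul_ne_zero hc.ne' h1
  · exact ⟨1, G.one_mem, h⟩

/-- Some point of the orbit of `r` is off the repelling direction, and its images under `A n`,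
rescaled, tend to a positive multiple of `p'`. -/
theorem attracting_mem (hG : NonElementary G) {A : ℕ → R21 ≃ₗ[ℝ] R21} (hA : ∀ n, A n ∈ G)
    {p' r' r : R21} (hd : Diverges A p' r') (hr : IsNF r) : p' ∈ limitCone G r := by
  obtain ⟨B, hB, hne⟩ := hG.exists_not_parallel hr hd.nfr
  have hneg := ((hG.so B hB).isNF hr).lorentz_neg hd.nfr hne
  have h1 : -lorentz (B r) r' • p' ∈ limitCone G r := by
    refine isClosed_closure.mem_of_tendsto (hd.lim (B r)) (Eventually.of_forall fun n => ?_)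
    have := (hG.so _ (hA n)).one_le_tau
    exact subset_closure ⟨(tau (A n))⁻¹, by positivity, A n * B, G.mul_mem (hA n) hB, rfl⟩
  have h2 := smul_mem_limitCone (t := (-lorentz (B r) r')⁻¹)
    (inv_nonneg.mpr (by linarith)) h1
  rwa [smul_smul, inv_mul_cancel₀ (by linarith), one_smul] at h2

end NonElementary

theorem tau_inv {A : R21 ≃ₗ[ℝ] R21} (hA : IsSO21o A) : tau A⁻¹ = tau A := by
  have := hA.lorentz_symm (bv 2) (bv 2)
  simp only [lorentz] at this
  simp [bv] at this
  exact this

theorem Diverges.symm {A : ℕ → R21 ≃ₗ[ℝ] R21} (hA : ∀ n, IsSO21o (A n)) {p r : R21}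
    (hd : Diverges A p r) : Diverges (fun n => (A n)⁻¹) r p := by
  have ht : ∀ n, Margulis.tau (A n)⁻¹ = Margulis.tau (A n) := fun n => tau_inv (hA n)
  refine ⟨hd.nfr, hd.nfp, by simpa only [ht] using hd.tau, fun x => ?_⟩
  have key : ∀ y, Tendsto (fun n => lorentz ((Margulis.tau (A n)⁻¹)⁻¹ • (A n)⁻¹ x) y) atTop
      (𝓝 (lorentz (-lorentz x p • r) y)) := by
    intro y
    have h1 := tendsto_lorentz (tendsto_const_nhds (x := x)) (hd.lim y)
    have e : lorentz x (-lorentz y r • p) = lorentz (-lorentz x p • r) y := by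
      rw [lorentz_smul_right, lorentz_smul_left, lorentz_comm y r]; ring
    rw [e] at h1
    refine h1.congr fun n => ?_
    rw [ht, lorentz_smul_right, lorentz_smul_left]
    congr 1
    exact ((hA n).lorentz_symm x y).symm
  rw [tendsto_pi_nhds]
  intro i
  have h0 := key (bv 0); have h1 := key (bv 1); have h2 := key (bv 2)
  fin_cases i
  · simpa [lorentz, bv] using h0
  · simpa [lorentz, bv] using h1
  · simpa [lorentz, bv] using h2.neg

theorem NonElementary.repelling_mem {G : Subgroup (R21 ≃ₗ[ℝ] R21)} (hG : NonElementary G)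
    {A : ℕ → R21 ≃ₗ[ℝ] R21} (hA : ∀ n, A n ∈ G)
    {p' r' r : R21} (hd : Diverges A p' r') (hr : IsNF r) : r' ∈ limitCone G r :=
  hG.attracting_mem (fun n => G.inv_mem (hA n)) (hd.symm fun n => hG.so _ (hA n)) hr

/-- An isometry that fixes a null vector and another null line is the identity. -/
theorem IsSO21o.eq_one_of_fixed {A : R21 ≃ₗ[ℝ] R21} (hA : IsSO21o A) {x y : R21} (hx : IsNF x)
    (hy : IsNF y) (hxy : lorentz x y ≠ 0) (hAx : A x = x) (h : Margulis.det3 x (A y) y = 0) :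
    A = 1 := by
  have hB : lorentz x (A y) = lorentz x y := by
    conv_lhs => rw [← hAx]
    exact hA.isometry x y
  have hyA : lorentz (A y) y = 0 := by
    by_contra hne
    exact hx.det3_ne_zero (hA.isNF hy) hy (by rw [hB]; exact hxy) hne hxy h
  obtain ⟨c, hc, hcy⟩ := (hA.isNF hy).parallel hy hyA
  have hc1 : c = 1 := by
    rw [hcy, lorentz_smul_right] at hB
    exact mul_right_cancel₀ hxy (by rw [hB, one_mul])
  rw [hc1, one_smul] at hcy
  have hAn : A (Margulis.cross y x) = Margulis.cross y x := by rw [hA.cross, hcy, hAx]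
  ext1 z
  have hd := cross_decomp hx.1 hy.1 z
  have := congrArg A hd
  rw [map_smul, map_add, map_add, map_smul, map_smul, map_smul, hAn, hAx, hcy, ← hd] at this
  exact smul_right_injective _ (pow_ne_zero 2 hxy) this

/-! ### The cyclic order of null directions -/

/-- The cyclic order of null directions, for the orientation given by the sign of `e`. -/
def Cyc (e : ℝ) (a b c : R21) : Prop := IsNF a ∧ IsNF b ∧ IsNF c ∧ 0 < e * det3 a b c

namespace Cyc

variable {e : ℝ} {a b c d : R21}

theorem rot (h : Cyc e a b c) : Cyc e b c a :=
  ⟨h.2.1, h.2.2.1, h.1, by rw [← det3_rotate]; exact h.2.2.2⟩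

theorem rot' (h : Cyc e a b c) : Cyc e c a b := h.rot.rot

theorem asymm (h : Cyc e a b c) : ¬ Cyc e a c b := by
  intro h'
  have h1 := h.2.2.2
  have h2 := h'.2.2.2
  rw [det3_swap] at h2
  linarith

theorem det3_ne (h : Cyc e a b c) : det3 a b c ≠ 0 := by
  intro h0
  have := h.2.2.2
  rw [h0] at this; linarith

theorem lorentz_ne (h : Cyc e a b c) : lorentz a b ≠ 0 := by
  intro h0
  obtain ⟨k, -, hk⟩ := h.1.parallel h.2.1 h0
  apply h.det3_ne
  rw [hk]; simp [det3]; ring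

theorem trans (h : Cyc e a b c) (h' : Cyc e a c d) : Cyc e a b d := by
  refine ⟨h.1, h.2.1, h'.2.2.1, ?_⟩
  have p := plucker h.1.1 b c d
  have n1 := h.1.lorentz_neg h.2.1 h.lorentz_ne
  have n2 := h.1.lorentz_neg h'.2.1 h'.lorentz_ne
  have n3 : lorentz a d < 0 := by
    rw [lorentz_comm]
    exact h'.2.2.1.lorentz_neg h.1 h'.rot'.lorentz_ne
  have m1 := mul_neg_of_pos_of_neg h.2.2.2 n3
  have m2 := mul_neg_of_pos_of_neg h'.2.2.2 n1
  by_contra hle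
  have m3 := mul_nonneg_of_nonpos_of_nonpos (not_lt.mp hle) n2.le
  have m4 : e * det3 a b d * lorentz a c
      = e * det3 a b c * lorentz a d + e * det3 a c d * lorentz a b := by
    linear_combination e * p
  linarith

theorem map {A : R21 ≃ₗ[ℝ] R21} (hA : IsSO21o A) (h : Cyc e a b c) :
    Cyc e (A a) (A b) (A c) :=
  ⟨hA.isNF h.1, hA.isNF h.2.1, hA.isNF h.2.2.1, by rw [hA.det3]; exact h.2.2.2⟩

theorem total (he : e ≠ 0) (ha : IsNF a) (hb : IsNF b) (hc : IsNF c) (hab : lorentz a b ≠ 0)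
    (hbc : lorentz b c ≠ 0) (hac : lorentz a c ≠ 0) : Cyc e a b c ∨ Cyc e a c b := by
  have h := mul_ne_zero he (ha.det3_ne_zero hb hc hab hbc hac)
  rcases lt_or_gt_of_ne h with h | h
  · right
    refine ⟨ha, hc, hb, ?_⟩
    rw [det3_swap]; linarith
  · exact Or.inl ⟨ha, hb, hc, h⟩

theorem smul_mid {t : ℝ} (ht : 0 < t) (h : Cyc e a b c) : Cyc e a (t • b) c := by
  refine ⟨h.1, h.2.1.smul ht, h.2.2.1, ?_⟩
  have : det3 a (t • b) c = t * det3 a b c := by simp [det3]; ring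
  rw [this, mul_left_comm]
  exact mul_pos ht h.2.2.2

end Cyc

/-- The points of the null cone in the chart given by two null vectors. -/
theorem isNF_chart {p q : R21} (hp : IsNF p) (hq : IsNF q) (hpq : lorentz p q ≠ 0) (t : ℝ) :
    IsNF (q + t • cross p q - (t ^ 2 / 2 * lorentz p q) • p) := by
  set x := q + t • cross p q - (t ^ 2 / 2 * lorentz p q) • p with hx
  have e1 : lorentz (cross p q) (cross p q) = lorentz p q ^ 2 := by
    rw [lorentz_cross_cross, hp.1, hq.1, lorentz_comm q p]; ring
  have e2 : lorentz (cross p q) p = 0 := by simp [lorentz]; ring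
  have e3 : lorentz (cross p q) q = 0 := by simp [lorentz]; ring
  have h0 : lorentz x x = 0 := by
    rw [hx]
    simp only [lorentz_sub_left, lorentz_sub_right, lorentz_add_left, lorentz_add_right,
      lorentz_smul_left, lorentz_smul_right, e1, e2, e3, hp.1, hq.1, lorentz_comm p (cross p q),
      lorentz_comm q (cross p q), lorentz_comm q p]
    ring
  have hxp : lorentz x p < 0 := by
    have : lorentz x p = lorentz p q := by
      rw [hx]
      simp only [lorentz_sub_left, lorentz_add_left, lorentz_smul_left, e2, hp.1,
        lorentz_comm q p]
      ring
    rw [this]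
    exact hp.lorentz_neg hq hpq
  refine ⟨h0, ?_⟩
  by_contra hle
  rcases (not_lt.mp hle).eq_or_lt with h | h
  · have : x = 0 := by
      simp only [lorentz, h] at h0
      apply ext3 <;> simp <;> nlinarith [sq_nonneg (x 0), sq_nonneg (x 1)]
    rw [this] at hxp; simp [lorentz] at hxp
  · have hn : IsNF (-(1 : ℝ) • x) := ⟨by rw [lorentz_smul_left, lorentz_smul_right, h0]; simp,
      by simpa using h⟩
    have := hn.lorentz_nonpos hp
    rw [lorentz_smul_left] at this; linarith

/-! ### Isolated sides of limit points -/

/-- An open arc that starts at a limit point `p` and contains no limit points. -/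
structure FreeArc (G : Subgroup (R21 ≃ₗ[ℝ] R21)) (e : ℝ) (p r q : R21) : Prop where
  ne : e ≠ 0
  nfp : IsNF p
  nfr : IsNF r
  nfq : IsNF q
  pq : lorentz p q ≠ 0
  mem : p ∈ limitCone G r
  free : ∀ x ∈ limitCone G r, ¬ Cyc e p x q
  not_hyp : ∀ A ∈ G, ∀ l : ℝ, 1 < l → A p ≠ l • p

namespace FreeArc

variable {G : Subgroup (R21 ≃ₗ[ℝ] R21)} {e : ℝ} {p r q : R21}

/-- In the affine coordinate `det3 p x q / lorentz p x` on the null directions other than `p`, an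
isometry fixing `p` acts by a translation. With the wrong sign, its iterates would carry a limit
point into the free arc. -/
theorem parabolic_side (F : FreeArc G e p r q) (hG : NonElementary G) {A : R21 ≃ₗ[ℝ] R21}
    (hA : A ∈ G) (hAp : A p = p) : 0 ≤ e * (det3 p (A q) q / lorentz p q) := by
  have hAs := hG.so A hA
  have hB : ∀ x, lorentz p (A x) = lorentz p x := by
    intro x
    conv_lhs => rw [← hAp]
    exact hAs.isometry p x
  have hD : ∀ x, det3 p (A x) (A q) = det3 p x q := by
    intro x
    conv_lhs => rw [← hAp]
    exact hAs.det3 p x q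
  obtain ⟨C, hC, hne⟩ := hG.exists_not_parallel F.nfr F.nfp
  set x₀ := C r with hx₀
  have hx₀nf : IsNF x₀ := (hG.so C hC).isNF F.nfr
  have hx₀m : x₀ ∈ limitCone G r := map_mem_limitCone hC (mem_limitCone_self r)
  have hpx : lorentz p x₀ ≠ 0 := by rwa [lorentz_comm]
  set s := det3 p (A q) q / lorentz p q with hs
  have hiter : ∀ n : ℕ, ∃ x ∈ limitCone G r, IsNF x ∧ lorentz p x = lorentz p x₀ ∧
      det3 p x q / lorentz p x = det3 p x₀ q / lorentz p x₀ + n * s := by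
    intro n
    induction n with
    | zero => exact ⟨x₀, hx₀m, hx₀nf, rfl, by simp⟩
    | succ n ih =>
      obtain ⟨x, hxm, hxn, hxl, hxd⟩ := ih
      refine ⟨A x, map_mem_limitCone hA hxm, hAs.isNF hxn, by rw [hB, hxl], ?_⟩
      have hpl := plucker F.nfp.1 (A x) (A q) q
      rw [hB, hB, hD] at hpl
      rw [hB]
      have hx0 : lorentz p x ≠ 0 := by rw [hxl]; exact hpx
      have hpq := F.pq
      have e1 : det3 p (A x) q / lorentz p x = det3 p x q / lorentz p x + s := by
        rw [hs]; field_simp; linarith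
      rw [e1, hxd]; push_cast; ring
  have hge : ∀ n : ℕ, 0 ≤ e * (det3 p x₀ q / lorentz p x₀) + n * (e * s) := by
    intro n
    obtain ⟨x, hxm, hxn, hxl, hxd⟩ := hiter n
    have h1 : e * det3 p x q ≤ 0 := by
      by_contra hlt
      exact F.free x hxm ⟨F.nfp, hxn, F.nfq, not_le.mp hlt⟩
    have h2 : lorentz p x < 0 := F.nfp.lorentz_neg hxn (by rw [hxl]; exact hpx)
    have h3 : 0 ≤ e * det3 p x q / lorentz p x := div_nonneg_of_nonpos h1 h2.le
    have h4 : e * det3 p x q / lorentz p x = e * (det3 p x q / lorentz p x) := by ring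
    rw [h4, hxd] at h3
    linarith
  by_contra hneg
  obtain ⟨n, hn⟩ := exists_nat_gt (e * (det3 p x₀ q / lorentz p x₀) / (-(e * s)))
  rw [div_lt_iff₀ (by linarith [not_le.mp hneg])] at hn
  have := hge n
  linarith

/-- Translates of a free arc are disjoint. -/
theorem eq_one (F : FreeArc G e p r q) (hG : NonElementary G) {A : R21 ≃ₗ[ℝ] R21}
    (hA : A ∈ G) {x : R21} (hx : Cyc e p x q) (hAx : Cyc e p (A x) q) : A = 1 := by
  have hAs := hG.so A hA
  have hpar : lorentz (A p) p = 0 := by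
    by_contra hne
    have hAp := hAs.isNF F.nfp
    have h1 := hx.map hAs
    -- If the arc meets its translate and `A` moves `p`, then either `A p` lies in the arc or `p`
    -- lies in the translate; both are excluded, as `p` is a limit point.
    rcases Cyc.total F.ne F.nfp hAp hAx.2.1 (by rwa [lorentz_comm]) h1.lorentz_ne hAx.lorentz_ne
      with h | h
    · exact F.free _ (map_mem_limitCone hA F.mem) (h.trans hAx)
    · have h2 := h.rot'.trans h1
      have h3 := h2.map (hG.so _ (G.inv_mem hA))
      have e1 : ∀ y, A⁻¹ (A y) = y := fun y => A.symm_apply_apply y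
      rw [e1, e1] at h3
      exact F.free _ (map_mem_limitCone (G.inv_mem hA) F.mem) h3
  obtain ⟨l, hl, hlp⟩ := (hAs.isNF F.nfp).parallel F.nfp hpar
  have hl1 : l = 1 := by
    rcases lt_trichotomy l 1 with h | h | h
    · exfalso
      apply F.not_hyp A⁻¹ (G.inv_mem hA) l⁻¹ ((one_lt_inv₀ hl).mpr h)
      change A.symm p = _
      rw [LinearEquiv.symm_apply_eq, map_smul, hlp, smul_smul, inv_mul_cancel₀ hl.ne', one_smul]
    · exact h
    · exact absurd hlp (F.not_hyp A hA l h)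
  rw [hl1, one_smul] at hlp
  have hlp' : A⁻¹ p = p := by
    change A.symm p = p
    rw [LinearEquiv.symm_apply_eq, hlp]
  have h1 := F.parabolic_side hG hA hlp
  -- `A` and its inverse translate in opposite directions and both are constrained to the same side,
  -- so the translation is zero.
  have h2 := F.parabolic_side hG (G.inv_mem hA) hlp'
  have h3 : det3 p (A⁻¹ q) q = -det3 p (A q) q := by
    have : det3 p (A⁻¹ q) q = det3 (A p) (A (A⁻¹ q)) (A q) := (hAs.det3 _ _ _).symm
    rw [this, hlp]
    have e1 : A (A⁻¹ q) = q := A.apply_symm_apply q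
    rw [e1, det3_swap]
  have h4 : det3 p (A q) q = 0 := by
    rw [h3] at h2
    have h5 : e * (det3 p (A q) q / lorentz p q) = 0 := by
      have : e * (-det3 p (A q) q / lorentz p q) = -(e * (det3 p (A q) q / lorentz p q)) := by ring
      rw [this] at h2
      linarith
    have h6 := (mul_eq_zero.mp h5).resolve_left F.ne
    exact (div_eq_zero_iff.mp h6).resolve_right F.pq
  exact hAs.eq_one_of_fixed F.nfp F.nfq F.pq hlp h4

theorem exists_points (F : FreeArc G e p r q) :
    ∃ z z' : R21, Cyc e p z q ∧ Cyc e p z' q ∧ Cyc e p z' z := by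
  have hB : 0 < lorentz p q ^ 2 := by have := F.pq; positivity
  have h1 := isNF_chart F.nfp F.nfq F.pq (-e)
  have h2 := isNF_chart F.nfp F.nfq F.pq (-2 * e)
  have he : 0 < e ^ 2 := by have := F.ne; positivity
  have e1 : lorentz (cross p q) (cross p q) = lorentz p q ^ 2 := by
    rw [lorentz_cross_cross, F.nfp.1, F.nfq.1, lorentz_comm q p]; ring
  rw [lorentz_cross] at e1
  have d1 : ∀ t, det3 p (q + t • cross p q - (t ^ 2 / 2 * lorentz p q) • p) q
      = -t * det3 p q (cross p q) := by
    intro t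
    simp only [det3, Pi.add_apply, Pi.sub_apply, Pi.smul_apply, smul_eq_mul]; ring
  have d2 : ∀ t t', det3 p (q + t • cross p q - (t ^ 2 / 2 * lorentz p q) • p)
      (q + t' • cross p q - (t' ^ 2 / 2 * lorentz p q) • p) = (t' - t) * det3 p q (cross p q) := by
    intro t t'
    simp only [det3, Pi.add_apply, Pi.sub_apply, Pi.smul_apply, smul_eq_mul]; ring
  refine ⟨_, _, ⟨F.nfp, h1, F.nfq, ?_⟩, ⟨F.nfp, h2, F.nfq, ?_⟩, ⟨F.nfp, h2, h1, ?_⟩⟩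
  · rw [d1, e1]; nlinarith [mul_pos he hB]
  · rw [d1, e1]; nlinarith [mul_pos he hB]
  · rw [d2, e1]; nlinarith [mul_pos he hB]

/-- Sequences of distinct elements diverge. -/
theorem exists_diverges (F : FreeArc G e p r q) (hG : NonElementary G) {A : ℕ → R21 ≃ₗ[ℝ] R21}
    (hA : ∀ n, A n ∈ G) (hinj : Function.Injective A) :
    ∃ (p' r' : R21) (φ : ℕ → ℕ), StrictMono φ ∧ Diverges (fun n => A (φ n)) p' r' := by
  refine Margulis.exists_diverges (fun n => hG.so _ (hA n)) ?_
  rw [tendsto_atTop]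
  intro C
  by_contra hC
  rw [not_eventually] at hC
  obtain ⟨φ, hφ, hφC⟩ := extraction_of_frequently_atTop hC
  obtain ⟨T, ψ, hψ, hT⟩ := exists_subseq_linear (R := C)
    (S := fun n => (A (φ n) : R21 →ₗ[ℝ] R21))
    (fun n j i => ((hG.so _ (hA _)).abs_entry_le j i).trans (not_le.mp (hφC n)).le)
  simp only [LinearEquiv.coe_coe] at hT
  obtain ⟨z, -, hz, -, -⟩ := F.exists_points
  have h1 := tendsto_det3 (hT p) (hT z) (hT q)
  -- Discreteness comes from the free arc: if a subsequence converged, two consecutive terms would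
  -- differ by an element sending `z` into the arc, hence by the identity.
  have h2 := tendsto_det3 ((hT p).comp (tendsto_add_atTop_nat 1)) (hT z)
    ((hT q).comp (tendsto_add_atTop_nat 1))
  have h3 : det3 (T p) (T z) (T q) = det3 p z q := by
    refine tendsto_nhds_unique h1 ?_
    have : ∀ n, det3 (A (φ (ψ n)) p) (A (φ (ψ n)) z) (A (φ (ψ n)) q) = det3 p z q :=
      fun n => (hG.so _ (hA _)).det3 _ _ _
    simp only [this]
    exact tendsto_const_nhds
  rw [h3] at h2
  have h4 := (h2.const_mul e).eventually_const_lt hz.2.2.2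
  obtain ⟨n, hn⟩ := h4.exists
  simp only [Function.comp_apply] at hn
  set B := A (φ (ψ (n + 1))) with hB
  set B' := A (φ (ψ n)) with hB'
  have hBG : B ∈ G := hA _
  have hBG' : B' ∈ G := hA _
  have e1 : ∀ y, B⁻¹ (B y) = y := fun y => B.symm_apply_apply y
  have h5 : Cyc e (B p) (B' z) (B q) :=
    ⟨(hG.so _ hBG).isNF F.nfp, (hG.so _ hBG').isNF hz.2.1, (hG.so _ hBG).isNF F.nfq, hn⟩
  have h6 := h5.map (hG.so _ (G.inv_mem hBG))
  rw [e1, e1] at h6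
  have h7 := F.eq_one hG (G.mul_mem (G.inv_mem hBG) hBG') hz h6
  have h8 : B = B' := inv_mul_eq_one.mp h7
  have h9 := hψ.injective (hφ.injective (hinj h8))
  omega

end FreeArc

/-! ### The group action on the translates of a free arc -/

namespace FreeArc

variable {G : Subgroup (R21 ≃ₗ[ℝ] R21)} {e : ℝ} {p r q : R21}

theorem orbit_not_parallel (F : FreeArc G e p r q) (hG : NonElementary G) {A : R21 ≃ₗ[ℝ] R21}
    (hA : A ∈ G) {z : R21} (hz : Cyc e p z q) {x : R21} (hx : x ∈ limitCone G r) (hxn : IsNF x) :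
    lorentz (A z) x ≠ 0 := by
  intro h
  obtain ⟨c, hc, hcx⟩ := ((hG.so A hA).isNF hz.2.1).parallel hxn h
  refine F.free z ?_ hz
  have h1 := smul_mem_limitCone hc.le (map_mem_limitCone (G.inv_mem hA) hx)
  rw [← map_smul, ← hcx] at h1
  have e1 : A⁻¹ (A z) = z := A.symm_apply_apply z
  rwa [e1] at h1

theorem eq_of_parallel (F : FreeArc G e p r q) (hG : NonElementary G) {A B : R21 ≃ₗ[ℝ] R21}
    (hA : A ∈ G) (hB : B ∈ G) {x y : R21} (hx : Cyc e p x q) (hy : Cyc e p y q)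
    (h : lorentz (A x) (B y) = 0) : A = B ∧ lorentz x y = 0 := by
  obtain ⟨c, hc, hcx⟩ := ((hG.so A hA).isNF hx.2.1).parallel ((hG.so B hB).isNF hy.2.1) h
  have h1 : (B⁻¹ * A) x = c • y := by
    change B⁻¹ (A x) = _
    rw [hcx, map_smul]
    congr 1
    exact B.symm_apply_apply y
  have h2 := F.eq_one hG (G.mul_mem (G.inv_mem hB) hA) hx (by rw [h1]; exact hy.smul_mid hc)
  have h3 : B = A := inv_mul_eq_one.mp h2
  refine ⟨h3.symm, ?_⟩
  rw [h3, (hG.so A hA).isometry] at h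
  exact h

theorem cyc_orbit (F : FreeArc G e p r q) (hG : NonElementary G) {A : R21 ≃ₗ[ℝ] R21}
    (hA : A ∈ G) (hA1 : A ≠ 1) {x y w : R21} (hx : Cyc e p x q) (hy : Cyc e p y q)
    (hw : Cyc e p w q) (hxy : Cyc e p x y) : Cyc e x y (A w) := by
  have hne : ∀ {v}, Cyc e p v q → lorentz v (A w) ≠ 0 := fun hv h =>
    hA1 (F.eq_of_parallel hG G.one_mem hA hv hw h).1.symm
  rcases Cyc.total F.ne hx.2.1 hy.2.1 ((hG.so A hA).isNF hw.2.1) hxy.rot.lorentz_ne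
    (hne hy) (hne hx) with h | h
  · exact h
  · exact absurd (F.eq_one hG hA hw (((hxy.rot'.trans h.rot').rot).trans hy)) hA1

theorem cyclicAction (F : FreeArc G e p r q) (hG : NonElementary G) {z z' : R21}
    (hz : Cyc e p z q) (hz' : Cyc e p z' q) (hzz : Cyc e p z' z) :
    CyclicAction (G := G) (Cyc e) z z' where
  rot := Cyc.rot
  asymm := Cyc.asymm
  trans := Cyc.trans
  smul g _ _ _ h := h.map (hG.so g g.2)
  total := by
    have key : ∀ {a b : R21}, (∃ g : G, a = g • z ∨ a = g • z') →
        (∃ g : G, b = g • z ∨ b = g • z') → a ≠ b → lorentz a b ≠ 0 := by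
      rintro a b ⟨g, hg⟩ ⟨h, hh⟩ hab h0
      have hzz' : lorentz z' z ≠ 0 := hzz.rot.lorentz_ne
      rcases hg with rfl | rfl <;> rcases hh with rfl | rfl
      · exact hab (by rw [Subtype.ext (F.eq_of_parallel hG g.2 h.2 hz hz h0).1])
      · exact hzz' (by rw [lorentz_comm]; exact (F.eq_of_parallel hG g.2 h.2 hz hz' h0).2)
      · exact hzz' (F.eq_of_parallel hG g.2 h.2 hz' hz h0).2
      · exact hab (by rw [Subtype.ext (F.eq_of_parallel hG g.2 h.2 hz' hz' h0).1])
    have nf : ∀ {a : R21}, (∃ g : G, a = g • z ∨ a = g • z') → IsNF a := by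
      rintro a ⟨g, rfl | rfl⟩
      · exact (hG.so g g.2).isNF hz.2.1
      · exact (hG.so g g.2).isNF hz'.2.1
    intro a b c ha hb hc hab hbc hac
    exact Cyc.total F.ne (nf ha) (nf hb) (nf hc) (key ha hb hab) (key hb hc hbc) (key ha hc hac)
  inj g h := Subtype.ext (F.eq_one hG g.2 hz (by
    have : (g : R21 ≃ₗ[ℝ] R21) z = z := h
    rwa [this]))
  inj' g h := Subtype.ext (F.eq_one hG g.2 hz' (by
    have : (g : R21 ≃ₗ[ℝ] R21) z' = z' := h
    rwa [this]))
  ne g h := by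
    have h1 : lorentz ((g : R21 ≃ₗ[ℝ] R21) z) ((1 : R21 ≃ₗ[ℝ] R21) z') = 0 := by
      have : (g : R21 ≃ₗ[ℝ] R21) z = z' := h
      rw [this]; exact hz'.2.1.1
    have h2 := (F.eq_of_parallel hG g.2 G.one_mem hz hz' h1).2
    rw [lorentz_comm] at h2
    exact hzz.rot.lorentz_ne h2
  adj g hg := by
    have hg' : (g : R21 ≃ₗ[ℝ] R21) ≠ 1 := fun h => hg (Subtype.ext h)
    exact ⟨F.cyc_orbit hG g.2 hg' hz' hz hz hzz, F.cyc_orbit hG g.2 hg' hz' hz hz' hzz⟩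

/-- Seen from `p`, a translate of `z` preceding `z'` would lie in the arc; only the identity allows
that, and then `z` follows `z'`. -/
theorem cyc_limit (F : FreeArc G e p r q) (hG : NonElementary G) {z z' : R21}
    (hz : Cyc e p z q) (hz' : Cyc e p z' q) (hzz : Cyc e p z' z) {A : R21 ≃ₗ[ℝ] R21} (hA : A ∈ G) :
    Cyc e p z' (A z) := by
  by_cases h1 : A = 1
  · rw [h1]; exact hzz
  have hAz := (hG.so A hA).isNF hz.2.1
  have n1 : lorentz z' (A z) ≠ 0 := fun h =>
    h1 (F.eq_of_parallel hG G.one_mem hA hz' hz h).1.symm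
  have n2 : lorentz p (A z) ≠ 0 := by
    rw [lorentz_comm]
    exact F.orbit_not_parallel hG hA hz F.mem F.nfp
  rcases Cyc.total F.ne F.nfp hz'.2.1 hAz hz'.lorentz_ne n1 n2 with h | h
  · exact h
  · exact absurd (F.eq_one hG hA hz (h.trans hz')) h1

/-- Infinitely many crossing edges would diverge, and both their ends would converge to the same
limit point. It would lie in both closed arcs bounded by `c` and `d`, hence be parallel to one of
them, whereas orbit points of the arc are not limit points. -/
theorem finite_crossing (F : FreeArc G e p r q) (hG : NonElementary G) {z z' : R21}
    (hz : Cyc e p z q) (hz' : Cyc e p z' q) {c d : R21}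
    (hc : ∃ g : G, c = g • z ∨ c = g • z') (hd : ∃ g : G, d = g • z ∨ d = g • z') (s : G) :
    {g : G | Cyc e c (g • z) d ∧ Cyc e d ((g * s) • z) c}.Finite := by
  by_contra hinf
  obtain ⟨f⟩ : Nonempty (ℕ ↪ {g : G | Cyc e c (g • z) d ∧ Cyc e d ((g * s) • z) c}) :=
    ⟨Set.Infinite.natEmbedding _ hinf⟩
  have hmemG : ∀ n, ((f n : G) : R21 ≃ₗ[ℝ] R21) ∈ G := fun n => (f n : G).2
  obtain ⟨p', r', φ, hφ, hD⟩ := F.exists_diverges hG hmemG (fun a b h =>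
    f.injective (Subtype.ext (Subtype.ext h)))
  have hp' := hG.attracting_mem (fun n => hmemG (φ n)) hD F.nfr
  have hr' := hG.repelling_mem (fun n => hmemG (φ n)) hD F.nfr
  have hpos : ∀ n, 0 ≤ (tau ((f (φ n) : G) : R21 ≃ₗ[ℝ] R21))⁻¹ := fun n =>
    inv_nonneg.mpr (by linarith [(hG.so _ (hmemG (φ n))).one_le_tau])
  have key : ∀ {a b x : R21}, lorentz x r' < 0 →
      (∀ n, 0 < e * det3 a (((f (φ n) : G) : R21 ≃ₗ[ℝ] R21) x) b) → 0 ≤ e * det3 a p' b := by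
    intro a b x hx hn
    have h1 := (tendsto_det3 (tendsto_const_nhds (x := a)) (hD.lim x)
      (tendsto_const_nhds (x := b))).const_mul e
    have h2 : 0 ≤ e * det3 a (-lorentz x r' • p') b := by
      refine ge_of_tendsto' h1 fun n => ?_
      have : ∀ (t : ℝ) y, det3 a (t • y) b = t * det3 a y b := by
        intro t y; simp [det3]; ring
      rw [this, mul_left_comm]
      exact mul_nonneg (hpos n) (hn n).le
    have : det3 a (-lorentz x r' • p') b = -lorentz x r' * det3 a p' b := by simp [det3]; ring
    rw [this, mul_left_comm] at h2
    exact nonneg_of_mul_nonneg_right h2 (by linarith)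
  have hneg : ∀ A ∈ G, lorentz (A z) r' < 0 := fun A hA =>
    ((hG.so A hA).isNF hz.2.1).lorentz_neg hD.nfr (F.orbit_not_parallel hG hA hz hr' hD.nfr)
  have h1 := key (hneg 1 G.one_mem) (fun n => (f (φ n)).2.1.2.2.2)
  have h2 := key (hneg s s.2) (fun n => (f (φ n)).2.2.2.2.2)
  have hcyc := (f 0).2.1
  have h3 : det3 d p' c = -det3 c p' d := by simp [det3]; ring
  rw [h3] at h2
  have h4 : e * det3 c p' d = 0 := by linarith
  have h5 := (mul_eq_zero.mp h4).resolve_left F.ne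
  have orb : ∀ {x : R21}, (∃ g : G, x = g • z ∨ x = g • z') → lorentz x p' ≠ 0 := by
    rintro x ⟨g, rfl | rfl⟩
    · exact F.orbit_not_parallel hG g.2 hz hp' hD.nfp
    · exact F.orbit_not_parallel hG g.2 hz' hp' hD.nfp
  refine hcyc.1.det3_ne_zero hD.nfp hcyc.2.2.1 (orb hc) ?_ ?_ h5
  · rw [lorentz_comm]; exact orb hd
  · rw [lorentz_comm]; exact hcyc.rot'.lorentz_ne

/-- A limit point of a finitely generated group that is isolated on one side and not fixed by a
hyperbolic element is not the attracting point of a diverging sequence. -/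
theorem false_of_diverges (F : FreeArc G e p r q) (hG : NonElementary G) [Group.FG G]
    {A : ℕ → R21 ≃ₗ[ℝ] R21} (hA : ∀ n, A n ∈ G) {r' : R21} (hD : Diverges A p r') : False := by
  classical
  obtain ⟨z, z', hz, hz', hzz⟩ := F.exists_points
  have C := F.cyclicAction hG hz hz' hzz
  obtain ⟨S₀, hS₀⟩ := Group.fg_def.mp (inferInstance : Group.FG G)
  let S : Finset G := S₀ ∪ S₀.image (fun s => s⁻¹)
  let a : ℕ → G := fun n => ⟨A n, hA n⟩
  have hr' := hG.repelling_mem hA hD F.nfr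
  refine C.false_of_accumulation (S := S) (H := Set.range a) ?_ ?_ ?_ ?_ ?_
  · intro s hs
    rcases Finset.mem_union.mp hs with h | h
    · exact Finset.mem_union_right _ (Finset.mem_image_of_mem _ h)
    · obtain ⟨t, ht, rfl⟩ := Finset.mem_image.mp h
      rw [inv_inv]
      exact Finset.mem_union_left _ ht
  · rintro W ⟨k, hk⟩ hW
    have h1 : ∀ x : G, k * x ∈ W := by
      intro x
      have hx : x ∈ Subgroup.closure (S₀ : Set G) := by rw [hS₀]; trivial
      induction hx using Subgroup.closure_induction_right with
      | one => rwa [mul_one]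
      | mul_right x _ y hy ih =>
        rw [← mul_assoc]
        exact hW _ ih _ (Finset.mem_union_left _ hy)
      | mul_inv_cancel x _ y hy ih =>
        rw [← mul_assoc]
        exact hW _ ih _ (Finset.mem_union_right _ (Finset.mem_image_of_mem _ hy))
    refine Set.eq_univ_of_forall fun x => ?_
    have := h1 (k⁻¹ * x)
    rwa [mul_inv_cancel_left] at this
  · intro c d hc hd s _
    exact F.finite_crossing hG hz hz' hc hd s
  · intro hfin
    obtain ⟨M, hM⟩ := (hfin.image (fun g : G => tau (g : R21 ≃ₗ[ℝ] R21))).bddAbove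
    obtain ⟨n, hn⟩ := (hD.tau.eventually_gt_atTop M).exists
    exact absurd (hM ⟨a n, ⟨n, rfl⟩, rfl⟩) (not_le.mpr hn)
  -- The points `A n z'` tend to `p`, which is outside the arc from `z'` to `g • z`; so only
  -- finitely many of them lie inside it.
  · intro g
    have hcyc := F.cyc_limit hG hz hz' hzz g.2
    have hzr : lorentz z' r' < 0 :=
      hz'.2.1.lorentz_neg hD.nfr (F.orbit_not_parallel hG G.one_mem hz' hr' hD.nfr)
    have h1 := (tendsto_det3 (tendsto_const_nhds (x := z')) (hD.lim z')
      (tendsto_const_nhds (x := g • z))).const_mul e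
    have h2 : e * det3 z' (-lorentz z' r' • p) (g • z) < 0 := by
      have h3 : det3 z' (-lorentz z' r' • p) (g • z)
          = lorentz z' r' * det3 p z' (g • z) := by simp [det3]; ring
      rw [h3, mul_left_comm]
      exact mul_neg_of_neg_of_pos hzr hcyc.2.2.2
    have h4 := h1.eventually_lt_const h2
    obtain ⟨N, hN⟩ := eventually_atTop.mp h4
    refine ((Set.finite_Iio N).image a).subset ?_
    rintro _ ⟨⟨n, rfl⟩, hn⟩
    refine ⟨n, ?_, rfl⟩
    by_contra hle
    have h5 := hN n (not_lt.mp hle)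
    have h6 := hn.2.2.2
    have h7 : det3 z' ((tau (A n))⁻¹ • A n z') (g • z)
        = (tau (A n))⁻¹ * det3 z' (a n • z') (g • z) := by
      change det3 z' ((tau (A n))⁻¹ • A n z') (g • z)
        = (tau (A n))⁻¹ * det3 z' (A n z') (g • z)
      simp [det3]; ring
    rw [h7, mul_left_comm] at h5
    have h8 : 0 < (tau (A n))⁻¹ := inv_pos.mpr (by linarith [(hG.so _ (hA n)).one_le_tau])
    linarith [mul_pos h8 h6]

end FreeArc

/-! ### The linear holonomy group -/

/-- The group of linear parts. -/
def lin (Γ : Subgroup Aff) : Subgroup (R21 ≃ₗ[ℝ] R21) := Γ.map AffineEquiv.linearHom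

theorem mem_lin {Γ : Subgroup Aff} {g : Aff} (hg : g ∈ Γ) : g.linear ∈ lin Γ :=
  ⟨g, hg, rfl⟩

theorem IsMargulisHolonomy.nonElementary {Γ : Subgroup Aff} (h : IsMargulisHolonomy Γ) :
    NonElementary (lin Γ) where
  so := by
    rintro _ ⟨g, hg, rfl⟩
    exact h.linear_mem g hg
  moved x hx := by
    obtain ⟨g, hg, hne⟩ := h.exists_moved hx
    exact ⟨g.linear, mem_lin hg, hne⟩

theorem IsMargulisHolonomy.fg {Γ : Subgroup Aff} (h : IsMargulisHolonomy Γ) :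
    Group.FG (lin Γ) := by
  obtain ⟨n, -, ⟨f⟩⟩ := h.free
  have : Group.FG Γ := Group.fg_of_surjective (f := f.symm.toMonoidHom) f.symm.surjective
  exact Group.fg_of_surjective (MonoidHom.subgroupMap_surjective AffineEquiv.linearHom Γ)

theorem Normalized.det3_nonneg_of_mem {Γ : Subgroup Aff} (hΓ : Normalized Γ) {K : Set R21}
    (hK : IsCompact K) {γ : ℕ → Aff} (hγ : ∀ n, γ n ∈ Γ) {z : ℕ → R21} (hz : ∀ n, z n ∈ K)
    {u : R21} (hu : Escapes γ z u) {p r : R21} (hd : Diverges (fun n => (γ n).linear) p r)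
    {x : R21} (hx : x ∈ limitCone (lin Γ) r) : 0 ≤ det3 u x p := by
  have hcl : IsClosed {x : R21 | 0 ≤ det3 u x p} := by
    have hc : Continuous fun x : R21 => det3 u x p := by unfold det3; fun_prop
    exact isClosed_Ici.preimage hc
  refine closure_minimal ?_ hcl hx
  rintro _ ⟨c, hc, _, ⟨h, hh, rfl⟩, rfl⟩
  have h1 := hΓ.det3_nonneg hK hγ hz hu hd hh
  have h2 : det3 u (c • h.linear r) p = c * det3 u (h.linear r) p := by simp [det3]; ring
  change 0 ≤ det3 u (c • h.linear r) p
  rw [h2]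
  exact mul_nonneg hc h1

/-! ### Escaping along the axis of a hyperbolic element -/

theorem IsAxis.pow_linear_p {g : Aff} {l s : ℝ} {xp xm o : R21} (h : IsAxis g l s xp xm o)
    (n : ℕ) : (g ^ n).linear xp = l ^ n • xp := by
  induction n with
  | zero => rw [pow_zero, pow_zero, one_smul]; rfl
  | succ n ih =>
    rw [pow_succ', linear_mul, ih, map_smul, h.map_p, smul_smul, pow_succ]

theorem IsAxis.pow_linear_n {g : Aff} {l s : ℝ} {xp xm o : R21} (h : IsAxis g l s xp xm o)
    (n : ℕ) : (g ^ n).linear (cross xm xp) = cross xm xp := by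
  induction n with
  | zero => rw [pow_zero]; rfl
  | succ n ih =>
    rw [pow_succ', linear_mul, ih, h.map_n]

theorem IsAxis.pow_linear_apply {g : Aff} {l s : ℝ} {xp xm o : R21} (h : IsAxis g l s xp xm o)
    (n : ℕ) (v : R21) : (g ^ n).linear v =
      (lorentz xp xm ^ 2)⁻¹ • (lorentz (cross xm xp) v • cross xm xp
        + (lorentz xp xm * lorentz v xm) • l ^ n • xp
        + (lorentz xp xm * lorentz v xp) • l⁻¹ ^ n • xm) := by
  have h1 := congrArg (g ^ n).linear (cross_decomp h.nfp.1 h.nfm.1 v)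
  rw [map_smul, map_add, map_add, map_smul, map_smul, map_smul, h.pow_linear, h.pow_linear_p,
    h.pow_linear_n] at h1
  rw [← h1, smul_smul, inv_mul_cancel₀ (pow_ne_zero 2 h.lorentz_ne), one_smul]

/-- Relative to `‖w i‖ * l ^ n i`, the origin, the drift along the axis and the neutral and
contracting components are negligible; only the expanding component survives. -/
theorem IsAxis.tendsto_pow {g : Aff} {l s : ℝ} {xp xm o : R21} (h : IsAxis g l s xp xm o)
    {w : ℕ → R21} {u : R21} (hw : Tendsto (fun i => ‖w i‖) atTop atTop)
    (hu : Tendsto (fun i => ‖w i‖⁻¹ • w i) atTop (𝓝 u)) {n : ℕ → ℕ} (hn : Tendsto n atTop atTop) :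
    Tendsto (fun i => (‖w i‖⁻¹ * l⁻¹ ^ n i) • (g ^ n i) (w i)) atTop
      (𝓝 ((lorentz u xm / lorentz xp xm) • xp)) := by
  have hl0 : 0 < l := by linarith [h.one_lt]
  have hl1 : l⁻¹ < 1 := inv_lt_one_of_one_lt₀ h.one_lt
  have hl2 : 0 < l⁻¹ := inv_pos.mpr hl0
  have ht : Tendsto (fun i => ‖w i‖⁻¹) atTop (𝓝 0) := tendsto_inv_atTop_zero.comp hw
  have hm : Tendsto (fun i => l⁻¹ ^ n i) atTop (𝓝 0) :=
    (tendsto_pow_atTop_nhds_zero_of_lt_one hl2.le hl1).comp hn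
  have hmn : Tendsto (fun i => (n i : ℝ) * l⁻¹ ^ n i) atTop (𝓝 0) :=
    (tendsto_self_mul_const_pow_of_lt_one hl2.le hl1).comp hn
  have hv : Tendsto (fun i => ‖w i‖⁻¹ • (w i - o)) atTop (𝓝 u) := by
    have := hu.sub (ht.smul_const o)
    rw [zero_smul, sub_zero] at this
    exact this.congr fun i => (smul_sub _ _ _).symm
  have hB := h.lorentz_ne
  have e : ∀ i, (‖w i‖⁻¹ * l⁻¹ ^ n i) • (g ^ n i) (w i) =
      (‖w i‖⁻¹ * l⁻¹ ^ n i) • o + (‖w i‖⁻¹ * (s * ((n i : ℝ) * l⁻¹ ^ n i))) • cross xm xp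
      + (lorentz xp xm ^ 2)⁻¹ • (
        (l⁻¹ ^ n i * lorentz (cross xm xp) (‖w i‖⁻¹ • (w i - o))) • cross xm xp
        + (lorentz xp xm * lorentz (‖w i‖⁻¹ • (w i - o)) xm) • xp
        + (lorentz xp xm * (l⁻¹ ^ n i * l⁻¹ ^ n i * lorentz (‖w i‖⁻¹ • (w i - o)) xp)) • xm) := by
    intro i
    have h1 : (g ^ n i) (w i) = (o + (n i * s) • cross xm xp) + (g ^ n i).linear (w i - o) := by
      have h2 := h.pow_apply (n i) 0 0
      simp only [zero_smul, add_zero, zero_add, mul_zero] at h2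
      rw [← h2, ← aff_apply_add]
      congr 1; abel
    rw [h1, h.pow_linear_apply]
    have h3 : l⁻¹ ^ n i * l ^ n i = 1 := by
      rw [← mul_pow, inv_mul_cancel₀ hl0.ne', one_pow]
    simp only [lorentz_smul_left, lorentz_smul_right]
    have h4 : ((lorentz xp xm * (‖w i‖⁻¹ * lorentz (w i - o) xm)) • xp)
        = ((l⁻¹ ^ n i * l ^ n i) * (lorentz xp xm * (‖w i‖⁻¹ * lorentz (w i - o) xm))) • xp := by
      rw [h3, one_mul]
    rw [h4]
    module
  have hlim := (((ht.mul hm).smul_const o).add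
      ((ht.mul (hmn.const_mul s)).smul_const (cross xm xp))).add
      (((((hm.mul (tendsto_lorentz (tendsto_const_nhds (x := cross xm xp)) hv)).smul_const
          (cross xm xp)).add
        (((tendsto_lorentz hv (tendsto_const_nhds (x := xm))).const_mul
          (lorentz xp xm)).smul_const xp)).add
        ((((hm.mul hm).mul (tendsto_lorentz hv (tendsto_const_nhds (x := xp)))).const_mul
          (lorentz xp xm)).smul_const xm)).const_smul ((lorentz xp xm ^ 2)⁻¹))
  have e2 : (0 * 0 : ℝ) • o + (0 * (s * 0)) • cross xm xp + (lorentz xp xm ^ 2)⁻¹ •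
      ((0 * lorentz (cross xm xp) u) • cross xm xp + (lorentz xp xm * lorentz u xm) • xp
        + (lorentz xp xm * (0 * 0 * lorentz u xp)) • xm)
      = (lorentz u xm / lorentz xp xm) • xp := by
    simp only [zero_mul, mul_zero, zero_smul, zero_add, add_zero, smul_smul]
    congr 1
    field_simp
  rw [e2] at hlim
  exact hlim.congr fun i => (e i).symm

theorem escapes_of_tendsto {γ : ℕ → Aff} {z : ℕ → R21} {t : ℕ → ℝ} {v : R21}
    (ht : Tendsto t atTop (𝓝[>] 0)) (hv : v ≠ 0)
    (h : Tendsto (fun i => t i • γ i (z i)) atTop (𝓝 v)) : Escapes γ z (‖v‖⁻¹ • v) := by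
  have hpos : ∀ᶠ i in atTop, 0 < t i := ht.eventually self_mem_nhdsWithin
  have hvn : 0 < ‖v‖ := norm_pos_iff.mpr hv
  refine ⟨?_, ?_⟩
  · have h1 := (tendsto_inv_nhdsGT_zero.comp ht).atTop_mul_pos hvn h.norm
    refine h1.congr' ?_
    filter_upwards [hpos] with i hi
    rw [Function.comp_apply, norm_smul, Real.norm_of_nonneg hi.le, inv_mul_cancel_left₀ hi.ne']
  · refine ((h.norm.inv₀ hvn.ne').smul h).congr' ?_
    filter_upwards [hpos] with i hi
    rw [norm_smul, Real.norm_of_nonneg hi.le, smul_smul]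
    congr 1
    field_simp

theorem Escapes.comp {γ : ℕ → Aff} {z : ℕ → R21} {u : R21} (h : Escapes γ z u) {φ : ℕ → ℕ}
    (hφ : Tendsto φ atTop atTop) : Escapes (fun n => γ (φ n)) (fun n => z (φ n)) u :=
  ⟨h.norm.comp hφ, h.dir.comp hφ⟩

/-! ### Traces of hyperbolic elements -/

theorem tr3_mul_det3 (T : R21 →ₗ[ℝ] R21) (x y z : R21) :
    det3 (T x) y z + det3 x (T y) z + det3 x y (T z) = tr3 T * det3 x y z := by
  simp only [det3, map_apply3 T x, map_apply3 T y, map_apply3 T z, tr3]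
  ring

theorem IsAxis.tr3_gt {g : Aff} {l s : ℝ} {xp xm o : R21} (h : IsAxis g l s xp xm o) :
    3 < tr3 (g.linear : R21 →ₗ[ℝ] R21) := by
  have h1 := tr3_mul_det3 (g.linear : R21 →ₗ[ℝ] R21) xm xp (cross xm xp)
  simp only [LinearEquiv.coe_coe, h.map_p, h.map_m, h.map_n] at h1
  have h2 : det3 xm xp (cross xm xp) ≠ 0 := by
    rw [← lorentz_cross, lorentz_cross_cross, h.nfp.1, h.nfm.1, lorentz_comm xm xp]
    have := h.lorentz_ne
    simpa using this
  have h3 : ∀ t : ℝ, det3 (t • xm) xp (cross xm xp) = t * det3 xm xp (cross xm xp) := by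
    intro t; simp [det3]; ring
  have h4 : ∀ t : ℝ, det3 xm (t • xp) (cross xm xp) = t * det3 xm xp (cross xm xp) := by
    intro t; simp [det3]; ring
  rw [h3, h4, ← add_mul, ← add_one_mul] at h1
  rw [← mul_right_cancel₀ h2 h1]
  have hl := h.one_lt
  have hl0 : 0 < l := by linarith
  have h5 : l⁻¹ + l + 1 - 3 = (l - 1) ^ 2 / l := by field_simp; ring
  have h6 : 0 < (l - 1) ^ 2 / l := div_pos (pow_pos (by linarith) 2) hl0
  linarith

/-! ### Directions of escape -/

/-- The orbit of a fixed point of a hyperbolic element is not contained in its fixed lines. -/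
theorem IsMargulisHolonomy.exists_orbit_off {Γ : Subgroup Aff} (hΓ : IsMargulisHolonomy Γ)
    (hpar : ∃ g ∈ Γ, IsParabolic g.linear) {p q : R21} (hp : IsNF p) (hq : IsNF q) :
    ∃ h ∈ Γ, lorentz (h.linear q) p ≠ 0 ∧ lorentz (h.linear q) q ≠ 0 := by
  by_contra! hcon
  obtain ⟨g, hg, hgp⟩ := hpar
  have hgs := hΓ.linear_mem g hg
  obtain ⟨v, hv0, hvv, -, hgv⟩ := hgs.parabolic_form hgp
  have e1 : ∀ x, IsNF x → lorentz (g.linear x) x = -(lorentz v x ^ 2) / 2 := by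
    intro x hx
    rw [hgv x, lorentz_sub_left, lorentz_add_left, hx.1, lorentz_cross, lorentz_smul_left]
    simp [det3]; ring
  have e2 : ∀ x, IsNF x → lorentz ((g ^ 2).linear x) x = -2 * (lorentz v x ^ 2) := by
    intro x hx
    rw [pow_linear_parabolic hvv hgv, lorentz_sub_left, lorentz_add_left, hx.1,
      lorentz_smul_left, lorentz_cross, lorentz_smul_left]
    simp [det3]; ring
  have par : ∀ {x y w : R21}, IsNF x → IsNF y → IsNF w → lorentz x y = 0 → lorentz y w = 0 →
      lorentz x w = 0 := by
    intro x y w hx hy hw h1 h2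
    obtain ⟨c, -, rfl⟩ := hx.parallel hy h1
    rw [lorentz_smul_left, h2, mul_zero]
  have hvq : lorentz v q = 0 := by
    by_contra hne
    have hgq := hgs.isNF hq
    have h1 : lorentz (g.linear q) q ≠ 0 := by
      rw [e1 q hq]; have : 0 < lorentz v q ^ 2 := by positivity
      linarith
    have h2 : lorentz ((g ^ 2).linear q) q ≠ 0 := by
      rw [e2 q hq]; have : 0 < lorentz v q ^ 2 := by positivity
      linarith
    have h3 : lorentz (g.linear q) p = 0 := by
      by_contra h; exact h1 (hcon g hg h)
    have h4 : lorentz ((g ^ 2).linear q) p = 0 := by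
      by_contra h; exact h2 (hcon (g ^ 2) (Γ.pow_mem hg 2) h)
    have hg2 := (hΓ.linear_mem _ (Γ.pow_mem hg 2)).isNF hq
    have h5 := par hg2 hp hgq h4 (by rwa [lorentz_comm])
    rw [pow_two] at h5
    have h6 : lorentz (g.linear (g.linear q)) (g.linear q) = 0 := h5
    rw [hgs.isometry] at h6
    exact h1 h6
  obtain ⟨h, hh, hne⟩ := hΓ.exists_moved hq
  have hw := (hΓ.linear_mem h hh).isNF hq
  set w := h.linear q with hwdef
  have hvw : lorentz v w ≠ 0 := by
    intro h0
    have h1 := eq_smul_of_null hvv hq hvq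
    have h2 : v 2 / q 2 ≠ 0 := by
      intro h2; rw [h2, zero_smul] at h1; exact hv0 h1
    rw [h1, lorentz_smul_left] at h0
    rw [lorentz_comm] at hne
    exact hne ((mul_eq_zero.mp h0).resolve_left h2)
  have hwp : lorentz w p = 0 := by
    by_contra h0; exact hne (hcon h hh h0)
  have hgq : g.linear q = q := by
    have h1 := eq_smul_of_null hvv hq hvq
    rw [hgv q, hvq, h1]
    apply ext3 <;> simp <;> ring
  have hgw := hgs.isNF hw
  have h7 : lorentz (g.linear w) q ≠ 0 := by
    conv_lhs => rw [← hgq]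
    rw [hgs.isometry]; exact hne
  have h8 : lorentz (g.linear w) p = 0 := by
    by_contra h0; exact h7 (hcon (g * h) (Γ.mul_mem hg hh) h0)
  have h9 := par hgw hp hw h8 (by rwa [lorentz_comm])
  rw [e1 w hw] at h9
  have : 0 < lorentz v w ^ 2 := by positivity
  linarith

/-- When `u` is on a fixed line of `a`, the limit vectors `a p'` and `a⁻¹ p'` lie on opposite sides
of the plane of `u` and `p'`, or in it. The inequality forces the latter, so `a` fixes the direction
of `p'`, which is neither of its two null directions. -/
theorem Normalized.false_of_diverges {Γ : Subgroup Aff} (hΓ : Normalized Γ) {K : Set R21}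
    (hK : IsCompact K) {a : Aff} (ha : a ∈ Γ) {l s : ℝ} {q p o : R21} (hax : IsAxis a l s q p o)
    {γ : ℕ → Aff} (hγ : ∀ n, γ n ∈ Γ) {z : ℕ → R21} (hz : ∀ n, z n ∈ K) {k : ℝ} (hk : k ≠ 0)
    (hu : Escapes γ z (k • q)) {p' r' : R21} (hd : Diverges (fun n => (γ n).linear) p' r')
    (hp : lorentz p' p ≠ 0) (hq : lorentz p' q ≠ 0) : False := by
  have has := hΓ.so ha
  have hl := hax.one_lt
  have hl0 : 0 < l := by linarith
  have hpm := hΓ.holonomy.nonElementary.attracting_mem (fun n => mem_lin (hγ n)) hd hd.nfr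
  have h1 := hΓ.det3_nonneg_of_mem hK hγ hz hu hd (map_mem_limitCone (mem_lin ha) hpm)
  have h2 := hΓ.det3_nonneg_of_mem hK hγ hz hu hd
    (map_mem_limitCone ((lin Γ).inv_mem (mem_lin ha)) hpm)
  have e1 : ∀ x, det3 (k • q) x p' = k * det3 q x p' := by
    intro x; simp [det3]; ring
  have e2 : det3 q (a.linear⁻¹ p') p' = -l * det3 q (a.linear p') p' := by
    rw [← has.det3, hax.map_p]
    have : a.linear (a.linear⁻¹ p') = p' := a.linear.apply_symm_apply p'
    rw [this]
    simp [det3]; ring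
  rw [e1] at h1 h2
  rw [e2] at h2
  have h3 : k * det3 q (a.linear p') p' = 0 := by
    have : 0 ≤ -l * (k * det3 q (a.linear p') p') := by linarith
    nlinarith
  have h4 := (mul_eq_zero.mp h3).resolve_left hk
  have hap := has.isNF hd.nfp
  have f1 : lorentz (a.linear p') q = l⁻¹ * lorentz p' q := by
    have : q = l⁻¹ • a.linear q := by
      rw [hax.map_p, smul_smul, inv_mul_cancel₀ hl0.ne', one_smul]
    conv_lhs => rw [this]
    rw [lorentz_smul_right, has.isometry]
  have f2 : lorentz (a.linear p') p = l * lorentz p' p := by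
    have : p = l • a.linear p := by
      rw [hax.map_m, smul_smul, mul_inv_cancel₀ hl0.ne', one_smul]
    conv_lhs => rw [this]
    rw [lorentz_smul_right, has.isometry]
  have h5 : lorentz (a.linear p') p' = 0 := by
    by_contra hne
    refine hax.nfp.det3_ne_zero hap hd.nfp ?_ hne ?_ h4
    · rw [lorentz_comm, f1]; exact mul_ne_zero (inv_ne_zero hl0.ne') hq
    · rwa [lorentz_comm]
  obtain ⟨c, hc, hcp⟩ := hap.parallel hd.nfp h5
  rw [hcp, lorentz_smul_left] at f1 f2
  have g1 := mul_right_cancel₀ hq f1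
  have g2 := mul_right_cancel₀ hp f2
  have : l⁻¹ < 1 := inv_lt_one_of_one_lt₀ hl
  linarith

theorem tendsto_apply_lin {S : ℕ → R21 →ₗ[ℝ] R21} {T : R21 →ₗ[ℝ] R21} {v : ℕ → R21} {x : R21}
    (hS : ∀ x, Tendsto (fun n => S n x) atTop (𝓝 (T x))) (hv : Tendsto v atTop (𝓝 x)) :
    Tendsto (fun n => S n (v n)) atTop (𝓝 (T x)) := by
  have hv' := tendsto_pi_nhds.mp hv
  have := (((hv' 0).smul (hS (bv 0))).add ((hv' 1).smul (hS (bv 1)))).add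
    ((hv' 2).smul (hS (bv 2)))
  rw [← map_vec] at this
  exact this.congr fun n => (map_vec (S n) (v n)).symm

/-- Along a convergent subsequence, `γ n` times the inverse of a far term times `g` has linear part
near that of `g`. It is therefore hyperbolic with nonnegative invariant. The limit is taken first in
`n`, then in the far term. -/
theorem Normalized.kap_nonneg_of_bounded {Γ : Subgroup Aff} (hΓ : Normalized Γ) {K : Set R21}
    (hK : IsCompact K) {γ : ℕ → Aff} (hγ : ∀ n, γ n ∈ Γ) {z : ℕ → R21} (hz : ∀ n, z n ∈ K)
    {u : R21} (hu : Escapes γ z u) {C : ℝ} (hC : ∀ n, tau (γ n).linear ≤ C) {g : Aff}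
    (hg : g ∈ Γ) (htr : 3 < tr3 (g.linear : R21 →ₗ[ℝ] R21)) :
    0 ≤ kap (g.linear : R21 →ₗ[ℝ] R21) u := by
  obtain ⟨T, φ, hφ, hT⟩ := exists_subseq_linear (R := C)
    (S := fun n => ((γ n).linear : R21 →ₗ[ℝ] R21))
    (fun n j i => ((hΓ.so (hγ n)).abs_entry_le j i).trans (hC n))
  obtain ⟨T', ψ, hψ, hT'⟩ := exists_subseq_linear (R := C)
    (S := fun n => ((γ (φ n))⁻¹.linear : R21 →ₗ[ℝ] R21)) (fun n j i => by
      refine ((hΓ.so (Γ.inv_mem (hγ (φ n)))).abs_entry_le j i).trans ?_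
      have : tau (γ (φ n))⁻¹.linear = tau (γ (φ n)).linear := tau_inv (hΓ.so (hγ (φ n)))
      rw [this]
      exact hC _)
  have hT2 : ∀ x, Tendsto (fun n => ((γ (φ (ψ n))).linear : R21 →ₗ[ℝ] R21) x) atTop (𝓝 (T x)) :=
    fun x => (hT x).comp hψ.tendsto_atTop
  have hTT : ∀ x, T (T' x) = x := by
    intro x
    refine tendsto_nhds_unique (tendsto_apply_lin hT2 (hT' x)) ?_
    refine tendsto_const_nhds.congr fun n => ?_
    exact ((γ (φ (ψ n))).linear.apply_symm_apply x).symm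
  have hlim : ∀ x, Tendsto (fun n => (T ∘ₗ (((γ (φ (ψ n)))⁻¹ * g).linear : R21 →ₗ[ℝ] R21)) x) atTop
      (𝓝 ((g.linear : R21 →ₗ[ℝ] R21) x)) := by
    intro x
    have h1 := (T.continuous_of_finiteDimensional.tendsto _).comp (hT' (g.linear x))
    rw [hTT] at h1
    exact h1
  have htrj := (tendsto_tr3 hlim).eventually_const_lt htr
  refine ge_of_tendsto (tendsto_kap hlim (tendsto_const_nhds (x := u))) ?_
  filter_upwards [htrj] with j hj
  refine hΓ.kap_nonneg hK (fun n => hγ (φ n)) (fun n => hz (φ n)) (hu.comp hφ.tendsto_atTop)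
    (c := fun _ => 1) (fun _ => zero_le_one) (fun x => by simpa using hT x)
    (Γ.mul_mem (Γ.inv_mem (hγ _)) hg) ?_
  have h2 : Tendsto (fun n => tr3 ((γ (φ n) * ((γ (φ (ψ j)))⁻¹ * g)).linear : R21 →ₗ[ℝ] R21)) atTop
      (𝓝 (tr3 (T ∘ₗ (((γ (φ (ψ j)))⁻¹ * g).linear : R21 →ₗ[ℝ] R21)))) :=
    tendsto_tr3 fun x => hT _
  exact h2.eventually_const_lt hj

theorem IsAxis.axial_ne {g : Aff} {l s : ℝ} {xp xm o : R21} (h : IsAxis g l s xp xm o) :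
    axial (g.linear : R21 →ₗ[ℝ] R21) ≠ 0 := by
  intro h0
  have h1 := det3_axial (g.linear : R21 →ₗ[ℝ] R21) xp xm
  simp only [LinearEquiv.coe_coe, h.map_p, h.map_m, lorentz_smul_left, lorentz_smul_right, h0] at h1
  have h2 : (l - l⁻¹) * lorentz xp xm = 0 := by
    have : det3 0 xp xm = 0 := by simp [det3]
    rw [this] at h1; linarith
  have h3 := (mul_eq_zero.mp h2).resolve_right h.lorentz_ne
  have : l⁻¹ < 1 := inv_lt_one_of_one_lt₀ h.one_lt
  linarith [h.one_lt]

/-- The axial vector is a multiple of `cross xm xp`, whose orthogonal plane meets the null cone only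
in the two fixed lines. -/
theorem IsAxis.kap_ne {g : Aff} (hg : IsSO21o g.linear) {l s : ℝ} {xp xm o : R21}
    (h : IsAxis g l s xp xm o) {x : R21} (hx : IsNF x) (hxp : lorentz x xp ≠ 0)
    (hxm : lorentz x xm ≠ 0) : kap (g.linear : R21 →ₗ[ℝ] R21) x ≠ 0 := by
  intro h0
  have hl := h.one_lt
  have hl0 : 0 < l := by linarith
  have hl1 : l⁻¹ < 1 := inv_lt_one_of_one_lt₀ hl
  set v := axial (g.linear : R21 →ₗ[ℝ] R21) with hv
  have hvf : g.linear v = v := hg.axial_fixed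
  have f1 : lorentz v xp = 0 := by
    have h1 : lorentz (g.linear v) (g.linear xp) = lorentz v xp := hg.isometry _ _
    rw [hvf, h.map_p, lorentz_smul_right] at h1
    nlinarith
  have f2 : lorentz v xm = 0 := by
    have h1 : lorentz (g.linear v) (g.linear xm) = lorentz v xm := hg.isometry _ _
    rw [hvf, h.map_m, lorentz_smul_right] at h1
    nlinarith
  have h1 := cross_decomp h.nfp.1 h.nfm.1 v
  rw [f1, f2, mul_zero, zero_smul, zero_smul, add_zero, add_zero] at h1
  have h2 : lorentz (cross xm xp) v ≠ 0 := by
    intro h2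
    rw [h2, zero_smul] at h1
    rcases smul_eq_zero.mp h1 with h3 | h3
    · exact pow_ne_zero 2 h.lorentz_ne h3
    · exact h.axial_ne h3
  have h3 := congrArg (fun y => lorentz y x) h1
  simp only [lorentz_smul_left] at h3
  have h4 : lorentz v x = 0 := h0
  rw [h4, mul_zero, lorentz_cross xm xp x] at h3
  refine h.nfm.det3_ne_zero h.nfp hx ?_ ?_ ?_ ((mul_eq_zero.mp h3.symm).resolve_left h2)
  · rw [lorentz_comm]; exact h.lorentz_ne
  · rwa [lorentz_comm]
  · rwa [lorentz_comm]

/-- The pairing with `u` is nonnegative for a hyperbolic element and for its inverse, hence zero. A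
conjugate of `a` whose fixed lines avoid `q` contradicts this. -/
theorem Normalized.false_of_bounded {Γ : Subgroup Aff} (hΓ : Normalized Γ)
    (hpar : ∃ g ∈ Γ, IsParabolic g.linear) {K : Set R21}
    (hK : IsCompact K) {a : Aff} (ha : a ∈ Γ) {l s : ℝ} {q p o : R21} (hax : IsAxis a l s q p o)
    {γ : ℕ → Aff} (hγ : ∀ n, γ n ∈ Γ) {z : ℕ → R21} (hz : ∀ n, z n ∈ K) {k : ℝ} (hk : k ≠ 0)
    (hu : Escapes γ z (k • q)) {C : ℝ} (hC : ∀ n, tau (γ n).linear ≤ C) : False := by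
  obtain ⟨h, hh, h1, h2⟩ := hΓ.holonomy.exists_orbit_off hpar hax.nfm hax.nfp
  have hhs := hΓ.so hh
  have hax' := hax.conj (hΓ.so (Γ.inv_mem hh))
  have hmem : h⁻¹ * a * h⁻¹⁻¹ ∈ Γ :=
    Γ.mul_mem (Γ.mul_mem (Γ.inv_mem hh) ha) (Γ.inv_mem (Γ.inv_mem hh))
  have h3 := hΓ.kap_nonneg_of_bounded hK hγ hz hu hC hmem hax'.tr3_gt
  have h4 := hΓ.kap_nonneg_of_bounded hK hγ hz hu hC (Γ.inv_mem hmem) hax'.inv_apply.tr3_gt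
  have h5 : kap ((h⁻¹ * a * h⁻¹⁻¹)⁻¹.linear : R21 →ₗ[ℝ] R21) (k • q)
      = -kap ((h⁻¹ * a * h⁻¹⁻¹).linear : R21 →ₗ[ℝ] R21) (k • q) := (hΓ.so hmem).kap_symm _
  rw [h5, kap_smul_right] at h4
  rw [kap_smul_right] at h3
  have h6 := (mul_eq_zero.mp (le_antisymm (by linarith) h3)).resolve_left hk
  have e : ∀ x, lorentz q ((h⁻¹).linear x) = lorentz (h.linear q) x := by
    intro x
    rw [lorentz_comm, linear_inv, hhs.lorentz_symm, lorentz_comm]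
  refine hax'.kap_ne (hΓ.so hmem) hax.nfp ?_ ?_ h6
  · rw [e]; exact h2
  · rw [e]; exact h1

theorem IsAxis.isometry_pow_p {g : Aff} (hg : IsSO21o g.linear) {l s : ℝ} {xp xm o : R21}
    (h : IsAxis g l s xp xm o) (n : ℕ) (y : R21) :
    lorentz ((g ^ n).linear y) xp = l⁻¹ ^ n * lorentz y xp := by
  have hl : l ^ n ≠ 0 := pow_ne_zero n (by linarith [h.one_lt])
  have h1 := aff_pow_isometry hg n y xp
  rw [h.pow_linear_p, lorentz_smul_right] at h1
  rw [← h1, inv_pow, inv_mul_cancel_left₀ hl]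

theorem IsAxis.isometry_pow_m {g : Aff} (hg : IsSO21o g.linear) {l s : ℝ} {xp xm o : R21}
    (h : IsAxis g l s xp xm o) (n : ℕ) (y : R21) :
    lorentz ((g ^ n).linear y) xm = l ^ n * lorentz y xm := by
  have hl : l ^ n ≠ 0 := pow_ne_zero n (by linarith [h.one_lt])
  have h1 := aff_pow_isometry hg n y xm
  rw [h.pow_linear, lorentz_smul_right] at h1
  rw [← h1, inv_pow, mul_inv_cancel_left₀ hl]

/-- Exponents that renormalize a sequence converging to infinity, up to a bounded factor. -/
theorem exists_pow_near {x : ℕ → ℝ} (hx : Tendsto x atTop atTop) {b : ℝ} (hb : 1 < b) :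
    ∃ n : ℕ → ℕ, Tendsto n atTop atTop ∧ ∀ᶠ i in atTop, b ^ n i ≤ x i ∧ x i < b ^ (n i + 1) := by
  have h : ∀ i, ∃ n : ℕ, b ^ n ≤ max 1 (x i) ∧ max 1 (x i) < b ^ (n + 1) := fun i =>
    exists_nat_pow_near (le_max_left _ _) hb
  choose n hn using h
  refine ⟨n, ?_, ?_⟩
  · rw [tendsto_atTop]
    intro M
    filter_upwards [hx.eventually_ge_atTop (b ^ M)] with i hi
    have h1 := (hi.trans (le_max_right 1 (x i))).trans_lt (hn i).2
    have h2 := (pow_lt_pow_iff_right₀ hb).mp h1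
    omega
  · filter_upwards [hx.eventually_ge_atTop 1] with i hi
    have := hn i
    rwa [max_eq_right hi] at this

/-- Otherwise powers of `a⁻¹` push the escape direction onto the other fixed line `q`, while the
exponents are chosen to keep any new attracting direction away from both fixed lines. -/
theorem Normalized.lorentz_eq_zero_of_hyperbolic {Γ : Subgroup Aff} (hΓ : Normalized Γ)
    (hpar : ∃ g ∈ Γ, IsParabolic g.linear) {K : Set R21}
    (hK : IsCompact K) {γ : ℕ → Aff} (hγ : ∀ n, γ n ∈ Γ) {z : ℕ → R21} (hz : ∀ n, z n ∈ K)
    {u : R21} (hu : Escapes γ z u) {p r : R21} (hd : Diverges (fun n => (γ n).linear) p r)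
    {a : Aff} (ha : a ∈ Γ) {l : ℝ} (hl : 1 < l) (hap : a.linear p = l • p) : lorentz u p = 0 := by
  have has := hΓ.so ha
  obtain ⟨m, s, xp, q, o, hax, -⟩ := exists_axis has ⟨l, hl, p, hd.nfp.ne_zero, hap⟩
  have hm := hax.one_lt
  have hm0 : 0 < m := by linarith
  have hpx : lorentz p xp = 0 := by
    have h1 := has.isometry p xp
    rw [hap, hax.map_p, lorentz_smul_left, lorentz_smul_right] at h1
    have h2 : (l * m - 1) * lorentz p xp = 0 := by linarith
    refine (mul_eq_zero.mp h2).resolve_left ?_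
    nlinarith
  obtain ⟨c, hc, hcp⟩ := hd.nfp.parallel hax.nfp hpx
  rw [hcp, lorentz_smul_right]
  by_contra hne
  have hux : lorentz u xp ≠ 0 := fun h => hne (by rw [h, mul_zero])
  have hpq : lorentz p q ≠ 0 := by
    rw [hcp, lorentz_smul_left]
    exact mul_ne_zero hc.ne' hax.lorentz_ne
  have hbx := hax.inv_apply
  have hbs := hΓ.so (Γ.inv_mem ha)
  have htf : ∀ {g : Aff}, g ∈ Γ → IsTF (g.linear (bv 2)) := fun hg => (hΓ.so hg).isTF isTF_bv
  have hX : ∀ {g : Aff}, g ∈ Γ → lorentz (g.linear (bv 2)) xp < 0 := fun hg =>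
    (htf hg).lorentz_neg (Or.inr hax.nfp)
  have hY : ∀ {g : Aff}, g ∈ Γ → lorentz (g.linear (bv 2)) q < 0 := fun hg =>
    (htf hg).lorentz_neg (Or.inr hax.nfm)
  have hτ : ∀ {g : Aff}, g ∈ Γ → 0 < (tau g.linear)⁻¹ := fun hg =>
    inv_pos.mpr (by linarith [(hΓ.so hg).one_le_tau])
  have hratio : Tendsto (fun i => lorentz ((γ i).linear (bv 2)) q
      / lorentz ((γ i).linear (bv 2)) xp) atTop atTop := by
    have h1 := tendsto_lorentz (hd.lim (bv 2)) (tendsto_const_nhds (x := xp))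
    have h2 := tendsto_lorentz (hd.lim (bv 2)) (tendsto_const_nhds (x := q))
    rw [lorentz_smul_left, hpx, mul_zero] at h1
    have hr : lorentz (bv 2) r < 0 := isTF_bv.lorentz_neg (Or.inr hd.nfr)
    have h3 : lorentz (-lorentz (bv 2) r • p) q ≠ 0 := by
      rw [lorentz_smul_left]
      exact mul_ne_zero (by linarith) hpq
    have h4 := h1.div h2 h3
    rw [zero_div] at h4
    have h5 : Tendsto (fun i => lorentz ((γ i).linear (bv 2)) xp
        / lorentz ((γ i).linear (bv 2)) q) atTop (𝓝[>] 0) := by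
      refine tendsto_nhdsWithin_iff.mpr ⟨h4.congr fun i => ?_, Eventually.of_forall fun i =>
        div_pos_of_neg_of_neg (hX (hγ i)) (hY (hγ i))⟩
      simp only [lorentz_smul_left, Pi.div_apply]
      exact mul_div_mul_left _ _ (hτ (hγ i)).ne'
    refine (tendsto_inv_nhdsGT_zero.comp h5).congr fun i => ?_
    exact inv_div _ _
  -- Each factor `a⁻¹` divides the ratio of the two pairings by `m ^ 2`; these exponents bring it
  -- into the interval from 1 to `m ^ 2`.
  obtain ⟨n, hn, hnb⟩ := exists_pow_near hratio (b := m ^ 2) (one_lt_pow₀ hm two_ne_zero)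
  have hη : ∀ i, a⁻¹ ^ n i * γ i ∈ Γ := fun i => Γ.mul_mem (Γ.pow_mem (Γ.inv_mem ha) _) (hγ i)
  have hlim := hbx.tendsto_pow hu.norm hu.dir hn
  have hk : lorentz u xp / lorentz q xp ≠ 0 := by
    refine div_ne_zero hux ?_
    rw [lorentz_comm]; exact hax.lorentz_ne
  have hv : (lorentz u xp / lorentz q xp) • q ≠ 0 := smul_ne_zero hk hax.nfm.ne_zero
  have ht : Tendsto (fun i => ‖γ i (z i)‖⁻¹ * m⁻¹ ^ n i) atTop (𝓝[>] 0) := by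
    refine tendsto_nhdsWithin_iff.mpr ⟨?_, ?_⟩
    · have h1 : Tendsto (fun i => m⁻¹ ^ n i) atTop (𝓝 0) :=
        (tendsto_pow_atTop_nhds_zero_of_lt_one (inv_pos.mpr hm0).le
          (inv_lt_one_of_one_lt₀ hm)).comp hn
      have := (tendsto_inv_atTop_zero.comp hu.norm).mul h1
      rwa [mul_zero] at this
    · filter_upwards [hu.norm.eventually_gt_atTop 0] with i hi
      exact mul_pos (inv_pos.mpr hi) (pow_pos (inv_pos.mpr hm0) _)
  have hesc := escapes_of_tendsto (γ := fun i => a⁻¹ ^ n i * γ i) (z := z) ht hv hlim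
  rw [smul_smul] at hesc
  have hk' := mul_ne_zero (inv_ne_zero (norm_ne_zero_iff.mpr hv)) hk
  by_cases htau : Tendsto (fun i => tau (a⁻¹ ^ n i * γ i).linear) atTop atTop
  · obtain ⟨p', r', φ, hφ, hD⟩ := exists_diverges (fun i => hΓ.so (hη i)) htau
    have hr' : lorentz (bv 2) r' < 0 := isTF_bv.lorentz_neg (Or.inr hD.nfr)
    have h1 := tendsto_lorentz (hD.lim (bv 2)) (tendsto_const_nhds (x := xp))
    have h2 := tendsto_lorentz (hD.lim (bv 2)) (tendsto_const_nhds (x := q))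
    have hb : ∀ᶠ i in atTop, lorentz ((a⁻¹ ^ n i * γ i).linear (bv 2)) q
        ≤ lorentz ((a⁻¹ ^ n i * γ i).linear (bv 2)) xp ∧
        m ^ 2 * lorentz ((a⁻¹ ^ n i * γ i).linear (bv 2)) xp
        ≤ lorentz ((a⁻¹ ^ n i * γ i).linear (bv 2)) q := by
      filter_upwards [hnb] with i hi
      rw [linear_mul, hbx.isometry_pow_p hbs, hbx.isometry_pow_m hbs]
      have hx := hX (hγ i)
      set X := lorentz ((γ i).linear (bv 2)) xp
      set Y := lorentz ((γ i).linear (bv 2)) q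
      have i1 := (le_div_iff_of_neg hx).mp hi.1
      have i2 := (div_lt_iff_of_neg hx).mp hi.2
      have hmn : 0 < m⁻¹ ^ n i := pow_pos (inv_pos.mpr hm0) _
      have e : m⁻¹ ^ n i * (m ^ 2) ^ n i = m ^ n i := by
        rw [← mul_pow]; congr 1; field_simp
      have j1 := mul_le_mul_of_nonneg_left i1 hmn.le
      have j2 := mul_le_mul_of_nonneg_left i2.le hmn.le
      rw [← mul_assoc, e] at j1
      rw [pow_succ, mul_assoc, ← mul_assoc, e] at j2
      exact ⟨j1, by linarith⟩
    have hbφ := hφ.tendsto_atTop.eventually hb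
    have k1 : lorentz (-lorentz (bv 2) r' • p') q ≤ lorentz (-lorentz (bv 2) r' • p') xp := by
      refine le_of_tendsto_of_tendsto h2 h1 ?_
      filter_upwards [hbφ] with i hi
      rw [lorentz_smul_left, lorentz_smul_left]
      exact mul_le_mul_of_nonneg_left hi.1 (hτ (hη _)).le
    have k2 : m ^ 2 * lorentz (-lorentz (bv 2) r' • p') xp
        ≤ lorentz (-lorentz (bv 2) r' • p') q := by
      refine le_of_tendsto_of_tendsto (h1.const_mul (m ^ 2)) h2 ?_
      filter_upwards [hbφ] with i hi
      rw [lorentz_smul_left, lorentz_smul_left, mul_left_comm]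
      exact mul_le_mul_of_nonneg_left hi.2 (hτ (hη _)).le
    rw [lorentz_smul_left, lorentz_smul_left] at k1
    rw [lorentz_smul_left, lorentz_smul_left, mul_left_comm] at k2
    have k1' := le_of_mul_le_mul_left k1 (by linarith)
    have k2' := le_of_mul_le_mul_left k2 (by linarith)
    have np := hD.nfp.lorentz_nonpos hax.nfp
    have nq := hD.nfp.lorentz_nonpos hax.nfm
    -- The limiting ratio bounds make either pairing vanish as soon as the other does, so excluding
    -- both at once suffices.
    have hboth : ¬ (lorentz p' xp = 0 ∧ lorentz p' q = 0) := by
      rintro ⟨z1, z2⟩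
      obtain ⟨d, hd0, hdp⟩ := hD.nfp.parallel hax.nfp z1
      rw [hdp, lorentz_smul_left] at z2
      exact hax.lorentz_ne ((mul_eq_zero.mp z2).resolve_left hd0.ne')
    refine hΓ.false_of_diverges hK (Γ.inv_mem ha) hbx (fun i => hη (φ i)) (fun i => hz (φ i)) hk'
      (hesc.comp hφ.tendsto_atTop) hD (fun z1 => hboth ⟨z1, ?_⟩) (fun z2 => hboth ⟨?_, z2⟩)
    · rw [z1, mul_zero] at k2'; exact le_antisymm nq k2'
    · rw [z2] at k1'; exact le_antisymm np k1'
  · rw [tendsto_atTop] at htau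
    push Not at htau
    obtain ⟨C, hC⟩ := htau
    obtain ⟨φ, hφ, hφC⟩ := extraction_of_frequently_atTop hC
    exact hΓ.false_of_bounded hpar hK (Γ.inv_mem ha) hbx (fun i => hη (φ i)) (fun i => hz (φ i))
      hk' (hesc.comp hφ.tendsto_atTop) (C := C) (fun i => (hφC i).le)

/-- The tangent vector of the null cone that is used in the definition of accordant segments. -/
def tang (p : R21) : R21 := ![-(p 1), p 0, 0]

theorem IsNF.exists_tang {p u : R21} (hp : IsNF p) (h : lorentz u p = 0) :
    ∃ s k : ℝ, u = s • p + k • tang p := by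
  have h2 := hp.2.ne'
  have h0 := hp.1
  simp only [lorentz] at h0 h
  refine ⟨u 2 / p 2, (u 1 * p 0 - u 0 * p 1) / p 2 ^ 2, ?_⟩
  apply ext3 <;> simp [tang] <;> field_simp
  · linear_combination p 0 * h - u 0 * h0
  · linear_combination p 1 * h - u 1 * h0

theorem IsNF.det3_tang {p : R21} (hp : IsNF p) (x : R21) :
    det3 (tang p) x p = -(p 2 * lorentz x p) := by
  have h0 := hp.1
  simp only [lorentz] at h0
  simp only [det3, tang, lorentz, Matrix.cons_val_zero, Matrix.cons_val_one, Matrix.cons_val]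
  linear_combination x 2 * h0

theorem Normalized.lorentz_eq_zero {Γ : Subgroup Aff} (hΓ : Normalized Γ)
    (hpar : ∃ g ∈ Γ, IsParabolic g.linear) {K : Set R21}
    (hK : IsCompact K) {γ : ℕ → Aff} (hγ : ∀ n, γ n ∈ Γ) {z : ℕ → R21} (hz : ∀ n, z n ∈ K)
    {u : R21} (hu : Escapes γ z u) {p r : R21} (hd : Diverges (fun n => (γ n).linear) p r) :
    lorentz u p = 0 := by
  by_contra hne
  have hG := hΓ.holonomy.nonElementary
  have := hΓ.holonomy.fg
  -- This makes `u - t • p` null. The scalar `e` below serves twice: it makes the vector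
  -- future-pointing, and its sign selects the arc that is free of limit points.
  set t := lorentz u u / (2 * lorentz u p) with ht
  have hpp := hd.nfp.1
  have hw : lorentz (u - t • p) (u - t • p) = 0 := by
    simp only [lorentz_sub_left, lorentz_sub_right, lorentz_smul_left, lorentz_smul_right, hpp,
      lorentz_comm p u]
    rw [ht]; field_simp; ring
  have hwp : lorentz (u - t • p) p = lorentz u p := by
    rw [lorentz_sub_left, lorentz_smul_left, hpp, mul_zero, sub_zero]
  have hw0 : u - t • p ≠ 0 := by
    intro h0
    rw [h0] at hwp
    apply hne
    rw [← hwp]; simp [lorentz]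
  obtain ⟨e, he, hq⟩ := exists_NF_of_null hw hw0
  have F : FreeArc (lin Γ) e p r (e • (u - t • p)) := by
    refine ⟨he, hd.nfp, hd.nfr, hq, ?_, hG.attracting_mem (fun n => mem_lin (hγ n)) hd hd.nfr,
      ?_, ?_⟩
    · rw [lorentz_comm, lorentz_smul_left, hwp]
      exact mul_ne_zero he hne
    · intro x hx hcyc
      have h1 := hΓ.det3_nonneg_of_mem hK hγ hz hu hd hx
      have h2 := hcyc.2.2.2
      have h3 : e * det3 p x (e • (u - t • p)) = -(e ^ 2 * det3 u x p) := by
        simp [det3]; ring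
      rw [h3] at h2
      have := mul_nonneg (sq_nonneg e) h1
      linarith
    · rintro _ ⟨a, ha, rfl⟩ l hl hap
      exact hne (hΓ.lorentz_eq_zero_of_hyperbolic hpar hK hγ hz hu hd ha hl hap)
  exact F.false_of_diverges hG (fun n => mem_lin (hγ n)) hd

/-- Directions of escape lie in the closed accordant half-plane. -/
theorem Normalized.exists_accordant {Γ : Subgroup Aff} (hΓ : Normalized Γ)
    (hpar : ∃ g ∈ Γ, IsParabolic g.linear) {K : Set R21}
    (hK : IsCompact K) {γ : ℕ → Aff} (hγ : ∀ n, γ n ∈ Γ) {z : ℕ → R21} (hz : ∀ n, z n ∈ K)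
    {u : R21} (hu : Escapes γ z u) {p r : R21} (hd : Diverges (fun n => (γ n).linear) p r) :
    ∃ s k : ℝ, 0 ≤ k ∧ u = s • p + k • tang p := by
  obtain ⟨s, k, huk⟩ := hd.nfp.exists_tang (hΓ.lorentz_eq_zero hpar hK hγ hz hu hd)
  refine ⟨s, k, ?_, huk⟩
  obtain ⟨_, ⟨h, hh, rfl⟩, hne⟩ :=
    hΓ.holonomy.nonElementary.exists_not_parallel hd.nfr hd.nfp
  have h1 := hΓ.det3_nonneg hK hγ hz hu hd hh
  have h2 := ((hΓ.so hh).isNF hd.nfr).lorentz_neg hd.nfp hne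
  have h3 : det3 u (h.linear r) p = k * det3 (tang p) (h.linear r) p := by
    rw [huk]; simp [det3]; ring
  rw [h3, hd.nfp.det3_tang] at h1
  have h4 : 0 < -(p 2 * lorentz (h.linear r) p) := by
    have := mul_neg_of_pos_of_neg hd.nfp.2 h2
    linarith
  exact nonneg_of_mul_nonneg_left h1 h4

/-! ### Divergence from convergence at infinity -/

theorem act_coe (g : Aff) (p : SI3) :
    ((act g p : SI3) : R4) = ‖homogenize g p‖⁻¹ • homogenize g p := rfl

theorem space_smul (t : ℝ) (v : R4) : space (t • v) = t • space v := rfl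

theorem continuous_space : Continuous space := by
  unfold space
  fun_prop

theorem continuous_coord (i : Fin 4) : Continuous fun v : R4 => v i := by fun_prop

theorem norm_vec4_zero_pos {x : R21} (hx : x ≠ 0) : 0 < ‖vec4 0 x‖ :=
  norm_pos_iff.mpr (vec4_ne_zero (Or.inr hx))

/-- The Lorentzian square of the image of `y` is constant and nonzero while its direction becomes
null, so its norm, and with it `tau`, tends to infinity. The attracting direction must then be that
of `yinf`. -/
theorem exists_diverges_of_act {γ : ℕ → Aff} (hγ : ∀ n, IsSO21o (γ n).linear) {y yinf : SI3}
    (hy : y ∈ Splus) (hyinf : yinf ∈ bdSplus)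
    (hlim : Tendsto (fun i => act (γ i) y) atTop (𝓝 yinf)) :
    ∃ (r : R21) (φ : ℕ → ℕ), StrictMono φ ∧
      Diverges (fun n => (γ (φ n)).linear) (space yinf) r := by
  obtain ⟨hy0, hyn, hy2⟩ := hy
  set Y := space y with hY
  have hYT : IsTF Y := ⟨hyn, hy2⟩
  have hp : IsNF (space yinf) := ⟨hyinf.2.1, hyinf.2.2⟩
  set p := space yinf with hpdef
  have hAY : ∀ n, IsTF ((γ n).linear Y) := fun n => (hγ n).isTF hYT
  have hhom : ∀ n, homogenize (γ n) y = vec4 0 ((γ n).linear Y) := by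
    intro n
    simp only [homogenize, hy0, zero_smul, add_zero, hY]
  have hlim' : Tendsto (fun n => ‖vec4 0 ((γ n).linear Y)‖⁻¹ • (γ n).linear Y) atTop (𝓝 p) := by
    have h1 := (continuous_space.tendsto _).comp ((continuous_subtype_val.tendsto _).comp hlim)
    refine h1.congr fun n => ?_
    simp only [Function.comp_apply, act_coe, hhom, space_smul, space_vec4]
  have hN : ∀ n, 0 < ‖vec4 0 ((γ n).linear Y)‖⁻¹ := fun n =>
    inv_pos.mpr (norm_vec4_zero_pos (by
      intro h0
      have := (hAY n).2
      rw [h0] at this; simp at this))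
  have hsq : Tendsto (fun n => ‖vec4 0 ((γ n).linear Y)‖⁻¹) atTop (𝓝 0) := by
    have h1 := tendsto_lorentz hlim' hlim'
    rw [hp.1] at h1
    have h2 : Tendsto (fun n => ‖vec4 0 ((γ n).linear Y)‖⁻¹ ^ 2) atTop (𝓝 0) := by
      have h3 := h1.mul_const (lorentz Y Y)⁻¹
      rw [zero_mul] at h3
      refine h3.congr fun n => ?_
      have hyn' := hyn.ne
      rw [lorentz_smul_left, lorentz_smul_right, (hγ n).isometry]
      field_simp
    have h4 := h2.sqrt
    rw [Real.sqrt_zero] at h4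
    exact h4.congr fun n => Real.sqrt_sq (hN n).le
  have hτ : Tendsto (fun n => tau (γ n).linear) atTop atTop := by
    have hS : 0 < |Y 0| + |Y 1| + |Y 2| := by
      have : 0 < |Y 2| := abs_pos.mpr hy2.ne'
      positivity
    have hbound : ∀ n, (γ n).linear Y 2 ≤ (|Y 0| + |Y 1| + |Y 2|) * tau (γ n).linear := by
      intro n
      have h1 : (γ n).linear Y 2 = Y 0 * (γ n).linear (bv 0) 2 + Y 1 * (γ n).linear (bv 1) 2
          + Y 2 * (γ n).linear (bv 2) 2 := map_apply3 ((γ n).linear : R21 →ₗ[ℝ] R21) Y 2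
      have h2 : ∀ j, Y j * (γ n).linear (bv j) 2 ≤ |Y j| * tau (γ n).linear := by
        intro j
        refine (le_abs_self _).trans ?_
        rw [abs_mul]
        exact mul_le_mul_of_nonneg_left ((hγ n).abs_entry_le j 2) (abs_nonneg _)
      rw [h1]
      linarith [h2 0, h2 1, h2 2]
    have h2 : Tendsto (fun n => (γ n).linear Y 2) atTop atTop := by
      have h3 : Tendsto (fun n => ‖vec4 0 ((γ n).linear Y)‖⁻¹) atTop (𝓝[>] 0) :=
        tendsto_nhdsWithin_iff.mpr ⟨hsq, Eventually.of_forall hN⟩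
      have h4 := (tendsto_inv_nhdsGT_zero.comp h3).atTop_mul_pos hp.2
        (tendsto_pi_nhds.mp hlim' 2)
      refine h4.congr fun n => ?_
      simp only [Function.comp_apply, Pi.smul_apply, smul_eq_mul]
      rw [inv_mul_cancel_left₀ (hN n).ne']
    have h5 := tendsto_atTop_mono hbound h2
    exact (tendsto_const_mul_atTop_of_pos hS).mp h5
  obtain ⟨p', r, φ, hφ, hD⟩ := exists_diverges hγ hτ
  have hYr : lorentz Y r < 0 := hYT.lorentz_neg (Or.inr hD.nfr)
  have hpar : lorentz p' p = 0 := by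
    have h1 := tendsto_cross (hD.lim Y) (hlim'.comp hφ.tendsto_atTop)
    have h2 : ∀ n, cross ((tau (γ (φ n)).linear)⁻¹ • (γ (φ n)).linear Y)
        (((fun n => ‖vec4 0 ((γ n).linear Y)‖⁻¹ • (γ n).linear Y) ∘ φ) n) = 0 := by
      intro n
      apply ext3 <;> simp <;> ring
    have h3 : cross (-lorentz Y r • p') p = 0 :=
      tendsto_nhds_unique h1 (tendsto_const_nhds.congr fun n => (h2 n).symm)
    have h4 := lorentz_cross_cross (-lorentz Y r • p') p (-lorentz Y r • p') p
    rw [h3, hp.1, mul_zero, sub_zero, lorentz_comm p, lorentz_smul_left] at h4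
    have h5 : lorentz (0 : R21) 0 = 0 := by simp [lorentz]
    rw [h5] at h4
    have h6 := mul_self_eq_zero.mp h4.symm
    exact (mul_eq_zero.mp h6).resolve_left (by linarith)
  obtain ⟨c, hc, hcp⟩ := hD.nfp.parallel hp hpar
  refine ⟨c • r, φ, hφ, hp, hD.nfr.smul hc, hD.tau, fun x => ?_⟩
  have := hD.lim x
  rw [hcp] at this
  rw [lorentz_smul_right]
  have e : (-(c * lorentz x r)) • p = -lorentz x r • c • p := by module
  rw [e]
  exact this

/-- Properly discontinuous actions: a diverging sequence moves compact sets to infinity. -/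
theorem tendsto_norm_of_diverges {Γ : Subgroup Aff} (hΓ : ActsProperlyDiscontinuously Γ)
    {K : Set R21} (hK : IsCompact K) {γ : ℕ → Aff} (hγ : ∀ n, γ n ∈ Γ) {z : ℕ → R21}
    (hz : ∀ n, z n ∈ K) {p r : R21} (hd : Diverges (fun n => (γ n).linear) p r) :
    Tendsto (fun n => ‖γ n (z n)‖) atTop atTop := by
  rw [tendsto_atTop]
  intro R
  have hfin := hΓ (K ∪ Metric.closedBall 0 R) (hK.union (isCompact_closedBall 0 R))
  obtain ⟨M, hM⟩ := (hfin.image (fun g : Aff => tau g.linear)).bddAbove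
  filter_upwards [hd.tau.eventually_gt_atTop M] with n hn
  by_contra hlt
  refine absurd (hM ⟨γ n, ⟨hγ n, γ n (z n), ⟨z n, Or.inl (hz n), rfl⟩, Or.inr ?_⟩, rfl⟩)
    (not_le.mpr hn)
  rw [mem_closedBall_zero_iff]
  exact (not_le.mp hlt).le

theorem norm_le_norm_vec4 (t : ℝ) (x : R21) : ‖x‖ ≤ ‖vec4 t x‖ := by
  rw [pi_norm_le_iff_of_nonneg (norm_nonneg _)]
  intro i
  exact PiLp.norm_apply_le (vec4 t x) i.succ

/-- For `k = 0` the point is `p` or its antipode, an end of the open semicircle; it is approached by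
adding small positive multiples of the tangent vector. -/
theorem mem_closure_zeta {P p : SI3} (hp : p ∈ bdSplus) {s k : ℝ} (hk : 0 ≤ k)
    (h : (P : R4) = s • (p : R4) + k • vec4 0 (tang (space p))) : P ∈ closure (zeta p) := by
  rcases hk.eq_or_lt with rfl | hk
  · rw [zero_smul, add_zero] at h
    have hP : (P : R4) ≠ 0 := ne_zero_of_mem_unit_sphere P
    have hs : s ≠ 0 := by
      rintro rfl
      rw [zero_smul] at h; exact hP h
    set T : R4 := vec4 0 (tang (space p)) with hT
    have hne : ∀ t : ℝ, (P : R4) + t • T ≠ 0 := by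
      intro t h0
      have h1 : space ((P : R4) + t • T) 2 = 0 := by rw [h0]; rfl
      have h2 : space ((P : R4) + t • T) 2 = s * space p 2 := by
        rw [h]
        change s * space p 2 + t * tang (space p) 2 = _
        simp [tang]
      rw [h2] at h1
      exact mul_ne_zero hs hp.2.2.ne' h1
    have hlim : Tendsto (fun n : ℕ => (P : R4) + (1 / ((n : ℝ) + 1)) • T) atTop (𝓝 (P : R4)) := by
      have := (tendsto_one_div_add_atTop_nhds_zero_nat (𝕜 := ℝ)).smul_const T
      have h2 := this.const_add (P : R4)
      rwa [zero_smul, add_zero] at h2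
    refine mem_closure_of_tendsto (f := fun n : ℕ => ray _ (hne (1 / ((n : ℝ) + 1)))) (b := atTop)
      ?_ (Eventually.of_forall fun n => ?_)
    · rw [tendsto_subtype_rng]
      have h3 := (hlim.norm.inv₀ (norm_ne_zero_iff.mpr hP)).smul hlim
      rw [norm_eq_of_mem_sphere P, inv_one, one_smul] at h3
      exact h3
    · have hN := inv_pos.mpr (norm_pos_iff.mpr (hne (1 / ((n : ℝ) + 1))))
      refine ⟨‖(P : R4) + (1 / ((n : ℝ) + 1)) • T‖⁻¹ * s,
        ‖(P : R4) + (1 / ((n : ℝ) + 1)) • T‖⁻¹ * (1 / ((n : ℝ) + 1)), by positivity, ?_⟩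
      change ‖(P : R4) + (1 / ((n : ℝ) + 1)) • T‖⁻¹ • ((P : R4) + (1 / ((n : ℝ) + 1)) • T) = _
      rw [smul_add, smul_smul, ← smul_smul _ s, ← h]
      rfl
  · exact subset_closure ⟨s, k, hk, h⟩

theorem Normalized.mem_closure_zeta_of_tendsto {Γ : Subgroup Aff} (hΓ : Normalized Γ)
    (hpar : ∃ g ∈ Γ, IsParabolic g.linear) {K : Set R21} (hK : IsCompact K) {y : SI3}
    (hy : y ∈ Splus) {γ : ℕ → Aff} (hγ : ∀ i, γ i ∈ Γ) {yinf : SI3} (hyinf : yinf ∈ bdSplus)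
    (hlim : Tendsto (fun i => act (γ i) y) atTop (𝓝 yinf)) {z : ℕ → R21} (hz : ∀ i, z i ∈ K)
    {P : SI3} (hP : Tendsto (fun i => embed (γ i (z i))) atTop (𝓝 P)) :
    P ∈ closure (zeta yinf) := by
  obtain ⟨r, φ, hφ, hD⟩ := exists_diverges_of_act (fun n => hΓ.so (hγ n)) hy hyinf hlim
  have hnorm := tendsto_norm_of_diverges hΓ.holonomy.proper hK (fun n => hγ (φ n))
    (fun n => hz (φ n)) hD
  set w : ℕ → R21 := fun n => γ (φ n) (z (φ n)) with hw
  have hPφ : Tendsto (fun n => ‖vec4 1 (w n)‖⁻¹ • vec4 1 (w n)) atTop (𝓝 (P : R4)) :=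
    (continuous_subtype_val.tendsto _).comp (hP.comp hφ.tendsto_atTop)
  have hN : Tendsto (fun n => ‖vec4 1 (w n)‖) atTop atTop :=
    tendsto_atTop_mono (fun n => norm_le_norm_vec4 1 (w n)) hnorm
  have hN0 : Tendsto (fun n => ‖vec4 1 (w n)‖⁻¹) atTop (𝓝 0) := tendsto_inv_atTop_zero.comp hN
  have hP0 : (P : R4) 0 = 0 := by
    refine tendsto_nhds_unique (((continuous_coord 0).tendsto _).comp hPφ) ?_
    refine hN0.congr fun n => ?_
    change _ = ‖vec4 1 (w n)‖⁻¹ * 1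
    rw [mul_one]
  have hsp : Tendsto (fun n => ‖vec4 1 (w n)‖⁻¹ • w n) atTop (𝓝 (space P)) :=
    (continuous_space.tendsto _).comp hPφ
  have hv : space P ≠ 0 := fun h0 => ne_zero_of_mem_unit_sphere P (eq_zero_of_space hP0 h0)
  have hpos : ∀ n, 0 < ‖vec4 1 (w n)‖⁻¹ := fun n =>
    inv_pos.mpr (norm_pos_iff.mpr (vec4_ne_zero (Or.inl one_ne_zero)))
  have hesc := escapes_of_tendsto (γ := fun n => γ (φ n)) (z := fun n => z (φ n))
    (tendsto_nhdsWithin_iff.mpr ⟨hN0, Eventually.of_forall hpos⟩) hv hsp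
  obtain ⟨s, k, hk, hsk⟩ := hΓ.exists_accordant hpar hK (fun n => hγ (φ n)) (fun n => hz (φ n))
    hesc hD
  have hvn : 0 < ‖space (P : R4)‖ := norm_pos_iff.mpr hv
  refine mem_closure_zeta hyinf (s := ‖space (P : R4)‖ * s) (k := ‖space (P : R4)‖ * k)
    (mul_nonneg hvn.le hk) ?_
  have h1 : space P = (‖space (P : R4)‖ * s) • space yinf
      + (‖space (P : R4)‖ * k) • tang (space yinf) := by
    rw [mul_smul, mul_smul, ← smul_add, ← hsk, smul_inv_smul₀ hvn.ne']
  ext i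
  refine Fin.cases ?_ (fun j => ?_) i
  · change (P : R4) 0 = (‖space (P : R4)‖ * s) * (yinf : R4) 0 + (‖space (P : R4)‖ * k) * 0
    rw [hP0, hyinf.1, mul_zero, mul_zero, add_zero]
  · exact congrFun h1 j

theorem tendsto_angle_self {E : Type*} [NormedAddCommGroup E] [InnerProductSpace ℝ E] {f : ℕ → E}
    {x : E} (hx : x ≠ 0) (h : Tendsto f atTop (𝓝 x)) :
    Tendsto (fun n => InnerProductGeometry.angle (f n) x) atTop (𝓝 0) := by
  have h1 : ContinuousAt (fun y : E × E => InnerProductGeometry.angle y.1 y.2) (x, x) :=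
    InnerProductGeometry.continuousAt_angle hx hx
  have h2 := h1.tendsto.comp (h.prodMk_nhds (tendsto_const_nhds (x := x)))
  rw [InnerProductGeometry.angle_self hx] at h2
  exact h2

theorem tendsto_bdd {f : ℕ → SI3} {P : SI3} (h : Tendsto f atTop (𝓝 P)) :
    Tendsto (fun n => bdd (f n) P) atTop (𝓝 0) :=
  tendsto_angle_self (ne_zero_of_mem_unit_sphere P) ((continuous_subtype_val.tendsto P).comp h)

end Margulis

end

/-! ### Uniform convergence and accumulation points -/

theorem corollary4p7
    (Γ : Subgroup Margulis.Aff) (hΓ : Margulis.IsMargulisHolonomy Γ)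
    (hpar : ∃ g ∈ Γ, Margulis.IsParabolic g.linear)
    (hpos : ∃ g ∈ Γ, Margulis.HasPositiveInvariant g)
    (K : Set Margulis.R21) (hK : IsCompact K)
    (y : Margulis.SI3) (hy : y ∈ Margulis.Splus)
    (γ : ℕ → Margulis.Aff) (hγ : ∀ i, γ i ∈ Γ)
    (yinf : Margulis.SI3) (hyinf : yinf ∈ Margulis.bdSplus)
    (hlim : Tendsto (fun i => Margulis.act (γ i) y) atTop (𝓝 yinf)) :
    (∀ ε : ℝ, 0 < ε → ∃ I₀ : ℕ, ∀ i : ℕ, I₀ < i →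
      Margulis.embed '' (γ i '' K) ⊆ Margulis.nbhd ε (closure (Margulis.zeta yinf))) ∧
    (∀ z : ℕ → Margulis.R21, (∀ i, z i ∈ K) →
      ∀ p : Margulis.SI3, MapClusterPt p atTop (fun i => Margulis.embed (γ i (z i))) →
        p ∈ closure (Margulis.zeta yinf)) := by
  have hN : Margulis.Normalized Γ :=
    ⟨hΓ, fun a ha hah => hΓ.inv_nonneg_of_hyperbolic hpos ha hah⟩
  refine ⟨fun ε hε => ?_, fun z hz p hp => ?_⟩
  · by_contra! hcon
    have hex : ∀ I₀ : ℕ, ∃ i > I₀, ∃ x ∈ K,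
        Margulis.embed (γ i x) ∉ Margulis.nbhd ε (closure (Margulis.zeta yinf)) := by
      intro I₀
      obtain ⟨i, hi, hnot⟩ := hcon I₀
      obtain ⟨_, ⟨_, ⟨x, hx, rfl⟩, rfl⟩, hxn⟩ := Set.not_subset.mp hnot
      exact ⟨i, hi, x, hx, hxn⟩
    -- If uniformity fails, bad points are chosen along a subsequence; compactness of the sphere
    -- gives them a limit, which must lie in the closed segment.
    obtain ⟨φ, hφ, hφx⟩ := extraction_forall_of_frequently
      (P := fun _ i => ∃ x ∈ K, Margulis.embed (γ i x) ∉
        Margulis.nbhd ε (closure (Margulis.zeta yinf)))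
      (fun _ => frequently_atTop'.mpr hex)
    choose x hxK hxn using hφx
    obtain ⟨P, ψ, hψ, hP⟩ :=
      CompactSpace.tendsto_subseq (fun n => Margulis.embed (γ (φ n) (x n)))
    have hmem := hN.mem_closure_zeta_of_tendsto hpar hK hy (γ := fun n => γ (φ (ψ n)))
      (fun n => hγ _) hyinf (hlim.comp (hφ.tendsto_atTop.comp hψ.tendsto_atTop))
      (z := fun n => x (ψ n)) (fun n => hxK _) hP
    obtain ⟨n, hn⟩ := ((Margulis.tendsto_bdd hP).eventually_lt_const hε).exists
    exact hxn (ψ n) ⟨P, hmem, hn⟩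
  · obtain ⟨ψ, hψ, hP⟩ := hp.tendsto_subseq
    exact hN.mem_closure_zeta_of_tendsto hpar hK hy (γ := fun n => γ (ψ n))
      (fun n => hγ _) hyinf (hlim.comp hψ.tendsto_atTop) (z := fun n => z (ψ n)) (fun n => hz _) hP
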